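/- **Theorem (Parametrising $sc$-symplectomorphisms).** *Setting.* Let $\mathbb S^n_+=\{(v,t)\in\mathbb R^n\times\mathbb R: |v|^2+t^2=1,\ t\ge 0\}$, with the embedding $R:\mathbb R^n\to\mathbb S^n_+$, $R(x)=\langle x\rangle^{-1}(x,1)$, $\langle x\rangle=(1+|x|^2)^{1/2}$. The boundary $B=\partial(\mathbb S^n_+\times\mathbb S^n_+)$ is the union of the closed faces $\overline{\mathcal W}_e=\mathbb S^{n-1}\times\mathbb S^n_+$ and $\overline{\mathcal W}_\psi=\mathbb S^n_+\times\mathbb S^{n-1}$, which meet in the corner $\mathbb S^{n-1}\times\mathbb S^{n-1}$; via $R$ their interiors are $\mathbb S^{n-1}\times\mathbb R^n$ and $\mathbb R^n\times\mathbb S^{n-1}$. For $U\subseteq B$ let $U_e\subseteq(\mathbb R^n\setminus0)\times\mathbb R^n$, $U_\psi\subseteq\mathbb R^n\times(\mathbb R^n\setminus 0)$, $U_{\psi e}\subseteq(\mathbb R^n\setminus0)\times(\mathbb R^n\setminus0)$ be the sets of $(x,\xi)$ with $(x/|x|,R\xi)\in U$, $(Rx,\xi/|\xi|)\in U$, $(x/|x|,\xi/|\xi|)\in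 U$ respectively. The same notation is used for subsets of $\partial(\mathbb S^{2n}_+\times\mathbb S^N_+)$, with $(z,\theta)\in\mathbb R^{2n}\times\mathbb R^N$ in place of $(x,\xi)$. A *(local) scattering canonical transformation* is a bijection $\chi:U\to V$ between relatively open subsets of $B$ which preserves each of the two faces, restricts on $U\cap\overline{\mathcal W}_\bullet$ ($\bullet\in\{e,\psi\}$) to a diffeomorphism $\chi_\bullet$ smooth up to the corner, and such that (i) on the open faces $\chi_e^*\alpha_e=g_e\alpha_e$ and $\chi_\psi^*\alpha_\psi=g_\psi\alpha_\psi$ with $g_\bullet>0$, where $\alpha_e=\sum x^j d\xi_j$ on $|x|=1$ and $\alpha_\psi=\sum\xi_jdx^j$ on $|\xi|=1$; (ii) if $U$ meets the corner, $\chi$ preserves the Poisson bracket across the corner, in the following sense. A section of $S^{l,m}$ ($l,m\in\mathbb R$) is given by a pair of smooth functions on the two faces which agree on the corner, written $u$, and has the components $|x|^l\langle\xi\rangle^m u(x/|x|,R\xi)$ and $\langle x\rangle^l|\xi|^m u(Rx,\xi/|\xi|)$. It is required that there are extensions of $\chi_e$ and $\chi_\psi$, homogeneous in $x$ and in $\xi$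 respectively, such that pull-back along them maps sections of $S^{l,m}$ over $V$ to sections of $S^{l,m}$ over $U$, for all $l,m$, and commutes with the Poisson brackets of the components. *Claim.* Let $\chi:U\to V$ be a scattering canonical transformation. Then there are smooth symplectic maps $C_e$ on $U_e$, $C_\psi$ on $U_\psi$, $C_{\psi e}$ on $U_{\psi e}$, homogeneous in $x$, in $\xi$, and in $x$ and $\xi$ separately, and inducing $\chi_e$, $\chi_\psi$ and the restriction $\chi_{\psi e}$ of $\chi$ to the corner, respectively, where, writing $C_\bullet=(Y_\bullet,H_\bullet)$, for $(x,\xi)\in U_{\psi e}$ $$Y_{\psi e}(x,\xi)=\lim_{t\to\infty}Y_e(x,t\xi)=\lim_{t\to\infty}t^{-1}Y_\psi(tx,\xi),\qquad H_{\psi e}(x,\xi)=\lim_{t\to\infty}t^{-1}H_e(x,t\xi)=\lim_{t\to\infty}H_\psi(tx,\xi).$$ Moreover, for every $p\in U$, with $q=\chi(p)$, there are $N\in\mathbb N$, a real-valued classical $SG$-symbol $\phi(x,y,\theta)$ of order $(1,1)$ on $\mathbb R^{2n}_{(x,y)}\times\mathbb R^N_\theta$ with exit, pseudo-differential and corner principal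 symbols $(\phi_e,\phi_\psi,\phi_{\psi e})$ (the leading homogeneous terms of $\phi$ as $|(x,y)|\to\infty$, as $|\theta|\to\infty$, and in both), relatively open sets $\tilde U\ni p$, $\tilde V\ni q$ of $B$ contained in $U$ and $V$, and a relatively open set $\Gamma\subseteq\partial(\mathbb S^{2n}_+\times\mathbb S^N_+)$ such that, for each $\bullet\in\{e,\psi,\psi e\}$, $\phi_\bullet$ is smooth on $\Gamma_\bullet$, is non-degenerate there (the differentials $d(\partial_{\theta_1}\phi_\bullet),\dots,d(\partial_{\theta_N}\phi_\bullet)$ are linearly independent wherever $\partial_\theta\phi_\bullet=0$), and parametrises the graph of $C_\bullet$: the map $$(x,y,\theta)\mapsto\big((x,\partial_x\phi_\bullet),(y,-\partial_y\phi_\bullet)\big)$$ is a bijection from $\{(x,y,\theta)\in\Gamma_\bullet:\partial_\theta\phi_\bullet=0\}$ onto $\{((x,\xi),(y,\eta)):(x,\xi)\in\tilde U_\bullet,\ (y,\eta)\in\tilde V_\bullet,\ (y,\eta)=C_\bullet(x,\xi)\}$. Furthermore $d\phi_\psi\ne0$ on $\Gamma_\psi$, $d\phi_{\psi e}\ne0$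 on $\Gamma_{\psi e}$, and $d\phi_e\neq0$ on $\Gamma_e$ unless $p$ and $q$ both lie on the zero section of the open exit face. In particular, at a point $p$ of the open $\psi$-face (open $e$-face) the graph of the homogeneous symplectic extension of $\chi$ is parametrised near $p$ by a phase function homogeneous of degree one in $\theta$ (in $(x,y)$), and at a point $p$ of the corner one and the same $SG$-phase function provides compatible parametrisations of $C_e$, $C_\psi$ and $C_{\psi e}$. -/

import Mathlib

open scoped ContDiff
open Filter Topology Set

namespace SGGeom

noncomputable section

/-! ### The radial compactification `𝕊ⁿ₊` and the boundary of `𝕊ᵃ₊ × 𝕊ᵇ₊` -/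

/-- Euclidean space `ℝⁿ`. -/
abbrev Eu (n : ℕ) : Type := EuclideanSpace ℝ (Fin n)

/-- `ℝⁿ × ℝⁿ` with its Euclidean norm, the space of pairs `(x, y)`. -/
abbrev Eu2 (n : ℕ) : Type := WithLp 2 (Eu n × Eu n)

/-- The Japanese bracket `⟨x⟩ = (1 + |x|²)^{1/2}`. -/
def jap {E : Type*} [NormedAddCommGroup E] (x : E) : ℝ := Real.sqrt (1 + ‖x‖ ^ 2)

/-- The closed upper half-sphere `𝕊ⁿ₊ ⊆ ℝⁿ × ℝ`; the last coordinate defines its boundary. -/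
def hemi (E : Type*) [NormedAddCommGroup E] : Set (E × ℝ) :=
  {p | ‖p.1‖ ^ 2 + p.2 ^ 2 = 1 ∧ 0 ≤ p.2}

/-- The radial compactification `R : ℝⁿ → 𝕊ⁿ₊`: intersect the half-sphere with the line joining
the origin to `(x, 1)`. -/
def radComp {E : Type*} [NormedAddCommGroup E] [NormedSpace ℝ E] (x : E) : E × ℝ :=
  ((jap x)⁻¹ • x, (jap x)⁻¹)

/-- The point at infinity in the direction of `x ≠ 0`. -/
def atInf {E : Type*} [NormedAddCommGroup E] [NormedSpace ℝ E] (x : E) : E × ℝ :=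
  (‖x‖⁻¹ • x, 0)

/-- The closed exit face `∂𝕊ᵃ₊ × 𝕊ᵇ₊`. -/
def faceE (E F : Type*) [NormedAddCommGroup E] [NormedAddCommGroup F] :
    Set ((E × ℝ) × (F × ℝ)) :=
  {p | p.1 ∈ hemi E ∧ p.2 ∈ hemi F ∧ p.1.2 = 0}

/-- The closed pseudo-differential face `𝕊ᵃ₊ × ∂𝕊ᵇ₊`. -/
def facePsi (E F : Type*) [NormedAddCommGroup E] [NormedAddCommGroup F] :
    Set ((E × ℝ) × (F × ℝ)) :=
  {p | p.1 ∈ hemi E ∧ p.2 ∈ hemi F ∧ p.2.2 = 0}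

/-- The corner `∂𝕊ᵃ₊ × ∂𝕊ᵇ₊`. -/
def corner (E F : Type*) [NormedAddCommGroup E] [NormedAddCommGroup F] :
    Set ((E × ℝ) × (F × ℝ)) :=
  faceE E F ∩ facePsi E F

/-- The boundary `∂(𝕊ᵃ₊ × 𝕊ᵇ₊)`. -/
def bdry (E F : Type*) [NormedAddCommGroup E] [NormedAddCommGroup F] :
    Set ((E × ℝ) × (F × ℝ)) :=
  faceE E F ∪ facePsi E F

/-- `U` is a relatively open subset of `S`. -/
def IsRelOpen {X : Type*} [TopologicalSpace X] (U S : Set X) : Prop :=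
  ∃ O : Set X, IsOpen O ∧ U = O ∩ S

/-- Smoothness of a map on a subset of a normed space (here: relatively open pieces of manifolds
with boundary): near every point of the set the map is the restriction of a smooth map. -/
def SmoothOn {X Y : Type*} [NormedAddCommGroup X] [NormedSpace ℝ X] [NormedAddCommGroup Y]
    [NormedSpace ℝ Y] (f : X → Y) (S : Set X) : Prop :=
  ∀ p ∈ S, ∃ (O : Set X) (F : X → Y), IsOpen O ∧ p ∈ O ∧ ContDiffOn ℝ ∞ F O ∧ EqOn f F (O ∩ S)

/-! ### Cones over subsets of the boundary -/

section Cones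

variable {E F : Type*} [NormedAddCommGroup E] [NormedSpace ℝ E] [NormedAddCommGroup F]
  [NormedSpace ℝ F]

/-- `(x, ξ) ↦ (x/|x|, R ξ)`, the projection of `ℝᵃ₀ × ℝᵇ` onto the open exit face. -/
def projE (z : E × F) : (E × ℝ) × (F × ℝ) := (atInf z.1, radComp z.2)

/-- `(x, ξ) ↦ (R x, ξ/|ξ|)`, the projection of `ℝᵃ × ℝᵇ₀` onto the open `ψ`-face. -/
def projPsi (z : E × F) : (E × ℝ) × (F × ℝ) := (radComp z.1, atInf z.2)

/-- `(x, ξ) ↦ (x/|x|, ξ/|ξ|)`, the projection of `ℝᵃ₀ × ℝᵇ₀` onto the corner. -/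
def projC (z : E × F) : (E × ℝ) × (F × ℝ) := (atInf z.1, atInf z.2)

/-- The set in `ℝᵃ₀ × ℝᵇ`, conic in `x`, over the part of `U` in the open exit face. -/
def coneE (U : Set ((E × ℝ) × (F × ℝ))) : Set (E × F) := {z | z.1 ≠ 0 ∧ projE z ∈ U}

/-- The set in `ℝᵃ × ℝᵇ₀`, conic in `ξ`, over the part of `U` in the open `ψ`-face. -/
def conePsi (U : Set ((E × ℝ) × (F × ℝ))) : Set (E × F) := {z | z.2 ≠ 0 ∧ projPsi z ∈ U}

/-- The bi-conic set in `ℝᵃ₀ × ℝᵇ₀` over the part of `U` in the corner. -/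
def coneC (U : Set ((E × ℝ) × (F × ℝ))) : Set (E × F) :=
  {z | z.1 ≠ 0 ∧ z.2 ≠ 0 ∧ projC z ∈ U}

end Cones

/-! ### Scattering canonical transformations -/

/-- The ambient space of `∂(𝕊ⁿ₊ × 𝕊ⁿ₊)`. -/
abbrev Amb (n : ℕ) : Type := (Eu n × ℝ) × (Eu n × ℝ)

/-- `χ` is a diffeomorphism between relatively open subsets `χ.source`, `χ.target` of
`∂(𝕊ⁿ₊ × 𝕊ⁿ₊)`: a bijection that respects the two boundary faces and restricts to a
diffeomorphism, smooth up to the corner, on each of them. -/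
structure IsBdryDiffeo {n : ℕ} (χ : PartialEquiv (Amb n) (Amb n)) : Prop where
  source_open : IsRelOpen χ.source (bdry (Eu n) (Eu n))
  target_open : IsRelOpen χ.target (bdry (Eu n) (Eu n))
  faceE_iff : ∀ p ∈ χ.source, χ p ∈ faceE (Eu n) (Eu n) ↔ p ∈ faceE (Eu n) (Eu n)
  facePsi_iff : ∀ p ∈ χ.source, χ p ∈ facePsi (Eu n) (Eu n) ↔ p ∈ facePsi (Eu n) (Eu n)
  smoothE : SmoothOn χ (χ.source ∩ faceE (Eu n) (Eu n))
  smoothPsi : SmoothOn χ (χ.source ∩ facePsi (Eu n) (Eu n))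
  smoothE_symm : SmoothOn χ.symm (χ.target ∩ faceE (Eu n) (Eu n))
  smoothPsi_symm : SmoothOn χ.symm (χ.target ∩ facePsi (Eu n) (Eu n))

/-- The inverse of `projE` on `𝕊ⁿ⁻¹ × ℝⁿ`. -/
def chartE {n : ℕ} (p : Amb n) : Eu n × Eu n := (p.1.1, p.2.2⁻¹ • p.2.1)

/-- The inverse of `projPsi` on `ℝⁿ × 𝕊ⁿ⁻¹`. -/
def chartPsi {n : ℕ} (p : Amb n) : Eu n × Eu n := (p.1.2⁻¹ • p.1.1, p.2.1)

/-- On the open exit face `𝕊ⁿ⁻¹ × ℝⁿ`, the map `χ` is a contact map for the contact form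
`α_e = ∑ xʲ dξⱼ` (`|x| = 1`): `χ^* α_e = g α_e` with `g > 0`. -/
def IsContactE {n : ℕ} (χ : PartialEquiv (Amb n) (Amb n)) : Prop :=
  ∀ z ∈ coneE χ.source, ‖z.1‖ = 1 → ∃ g : ℝ, 0 < g ∧
    ∀ v : Eu n × Eu n, inner ℝ z.1 v.1 = 0 →
      inner ℝ (chartE (χ (projE z))).1
        (fderiv ℝ (fun z' : Eu n × Eu n => chartE (χ (projE z'))) z v).2 = g * inner ℝ z.1 v.2

/-- On the open `ψ`-face `ℝⁿ × 𝕊ⁿ⁻¹`, the map `χ` is a contact map for the contact form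
`α_ψ = ∑ ξⱼ dxʲ` (`|ξ| = 1`): `χ^* α_ψ = g α_ψ` with `g > 0`. -/
def IsContactPsi {n : ℕ} (χ : PartialEquiv (Amb n) (Amb n)) : Prop :=
  ∀ z ∈ conePsi χ.source, ‖z.2‖ = 1 → ∃ g : ℝ, 0 < g ∧
    ∀ v : Eu n × Eu n, inner ℝ z.2 v.2 = 0 →
      inner ℝ (chartPsi (χ (projPsi z))).2
        (fderiv ℝ (fun z' : Eu n × Eu n => chartPsi (χ (projPsi z'))) z v).1
          = g * inner ℝ z.2 v.1

/-- `C` is an extension of `χ_e`, homogeneous in `x`, to the cone over the open exit face. -/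
structure IsHomExtE {n : ℕ} (χ : PartialEquiv (Amb n) (Amb n))
    (C : Eu n × Eu n → Eu n × Eu n) : Prop where
  smooth : ContDiffOn ℝ ∞ C (coneE χ.source)
  ne_zero : ∀ z ∈ coneE χ.source, (C z).1 ≠ 0
  proj : ∀ z ∈ coneE χ.source, projE (C z) = χ (projE z)
  homog : ∀ z ∈ coneE χ.source, ∀ t : ℝ, 0 < t → C (t • z.1, z.2) = (t • (C z).1, (C z).2)

/-- `C` is an extension of `χ_ψ`, homogeneous in `ξ`, to the cone over the open `ψ`-face. -/
structure IsHomExtPsi {n : ℕ} (χ : PartialEquiv (Amb n) (Amb n))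
    (C : Eu n × Eu n → Eu n × Eu n) : Prop where
  smooth : ContDiffOn ℝ ∞ C (conePsi χ.source)
  ne_zero : ∀ z ∈ conePsi χ.source, (C z).2 ≠ 0
  proj : ∀ z ∈ conePsi χ.source, projPsi (C z) = χ (projPsi z)
  homog : ∀ z ∈ conePsi χ.source, ∀ t : ℝ, 0 < t → C (z.1, t • z.2) = ((C z).1, t • (C z).2)

/-- `C` is a bi-homogeneous extension of `χ_{ψe}` to the bi-cone over the corner. -/
structure IsHomExtC {n : ℕ} (χ : PartialEquiv (Amb n) (Amb n))
    (C : Eu n × Eu n → Eu n × Eu n) : Prop where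
  smooth : ContDiffOn ℝ ∞ C (coneC χ.source)
  ne_zero : ∀ z ∈ coneC χ.source, (C z).1 ≠ 0 ∧ (C z).2 ≠ 0
  proj : ∀ z ∈ coneC χ.source, projC (C z) = χ (projC z)
  homog : ∀ z ∈ coneC χ.source, ∀ s t : ℝ, 0 < s → 0 < t →
    C (s • z.1, t • z.2) = (s • (C z).1, t • (C z).2)

/-- `C` preserves the symplectic form `∑ dξⱼ ∧ dxʲ` on the (open) set `S`. -/
def IsSymplecticOn {n : ℕ} (C : Eu n × Eu n → Eu n × Eu n) (S : Set (Eu n × Eu n)) : Prop :=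
  ∀ z ∈ S, ∀ v w : Eu n × Eu n,
    inner ℝ (fderiv ℝ C z v).2 (fderiv ℝ C z w).1
        - inner ℝ (fderiv ℝ C z v).1 (fderiv ℝ C z w).2
      = inner ℝ v.2 w.1 - inner ℝ v.1 w.2

/-- The Poisson bracket `{f, g} = ∑ ∂f/∂ξⱼ ∂g/∂xʲ - ∂f/∂xʲ ∂g/∂ξⱼ`. -/
def poisson {n : ℕ} (f g : Eu n × Eu n → ℝ) (z : Eu n × Eu n) : ℝ :=
  ∑ j : Fin n,
    (fderiv ℝ f z (0, EuclideanSpace.single j 1) * fderiv ℝ g z (EuclideanSpace.single j 1, 0)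
      - fderiv ℝ f z (EuclideanSpace.single j 1, 0) * fderiv ℝ g z (0, EuclideanSpace.single j 1))

/-- Smooth functions on a relatively open subset `U` of `∂(𝕊ⁿ₊ × 𝕊ⁿ₊)`: pairs of smooth functions
on the two faces that agree on the corner. -/
def IsSmoothFun {n : ℕ} (u : Amb n → ℝ) (U : Set (Amb n)) : Prop :=
  SmoothOn u (U ∩ faceE (Eu n) (Eu n)) ∧ SmoothOn u (U ∩ facePsi (Eu n) (Eu n))

/-- The exit component of the section `ρ_N^{-l} ρ_σ^{-m} u` of `S^{l,m}`, as a function on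
`ℝⁿ₀ × ℝⁿ` homogeneous of degree `l` in `x`. -/
def secE {n : ℕ} (l m : ℝ) (u : Amb n → ℝ) (z : Eu n × Eu n) : ℝ :=
  ‖z.1‖ ^ l * jap z.2 ^ m * u (projE z)

/-- The pseudo-differential component of the section `ρ_N^{-l} ρ_σ^{-m} u` of `S^{l,m}`, as a
function on `ℝⁿ × ℝⁿ₀` homogeneous of degree `m` in `ξ`. -/
def secPsi {n : ℕ} (l m : ℝ) (u : Amb n → ℝ) (z : Eu n × Eu n) : ℝ :=
  jap z.1 ^ l * ‖z.2‖ ^ m * u (projPsi z)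

/-- `χ` preserves the Poisson bracket of sections of the bundles `S^{l,m}` across the corner.
Sections of `S^{l,m}` are pairs of homogeneous functions, which are pulled back along homogeneous
extensions `C_e`, `C_ψ` of `χ_e`, `χ_ψ`: the pull-back of a section of `S^{l,m}` over the target
is a section of `S^{l,m}` over the source (in particular its two components are compatible at the
corner), and pull-back commutes with the bracket. -/
def PreservesPoisson {n : ℕ} (χ : PartialEquiv (Amb n) (Amb n)) : Prop :=
  ∃ Ce Cpsi : Eu n × Eu n → Eu n × Eu n, IsHomExtE χ Ce ∧ IsHomExtPsi χ Cpsi ∧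
    (∀ (l m : ℝ) (u : Amb n → ℝ), IsSmoothFun u χ.target →
      ∃ u' : Amb n → ℝ, IsSmoothFun u' χ.source ∧
        (∀ z ∈ coneE χ.source, secE l m u (Ce z) = secE l m u' z) ∧
        (∀ z ∈ conePsi χ.source, secPsi l m u (Cpsi z) = secPsi l m u' z)) ∧
    (∀ (l₁ m₁ l₂ m₂ : ℝ) (u₁ u₂ : Amb n → ℝ), IsSmoothFun u₁ χ.target → IsSmoothFun u₂ χ.target →
      (∀ z ∈ coneE χ.source,
        poisson (secE l₁ m₁ u₁ ∘ Ce) (secE l₂ m₂ u₂ ∘ Ce) z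
          = poisson (secE l₁ m₁ u₁) (secE l₂ m₂ u₂) (Ce z)) ∧
      (∀ z ∈ conePsi χ.source,
        poisson (secPsi l₁ m₁ u₁ ∘ Cpsi) (secPsi l₂ m₂ u₂ ∘ Cpsi) z
          = poisson (secPsi l₁ m₁ u₁) (secPsi l₂ m₂ u₂) (Cpsi z)))

/-- A (local) scattering canonical transformation of `∂(𝕊ⁿ₊ × 𝕊ⁿ₊)`. -/
structure IsSCT {n : ℕ} (χ : PartialEquiv (Amb n) (Amb n)) : Prop where
  diffeo : IsBdryDiffeo χ
  contactE : IsContactE χ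
  contactPsi : IsContactPsi χ
  preservesPoisson : (χ.source ∩ corner (Eu n) (Eu n)).Nonempty → PreservesPoisson χ

/-- `C_{ψe}` is the common corner symbol of the components of `C_e` (of order `(1,0)` and `(0,1)`)
and of `C_ψ`: it is the extension of `χ_{ψe}` by the two homogeneity factors of `C_e`, `C_ψ`. -/
def IsCornerSymbolOfMaps {n : ℕ} (S : Set (Eu n × Eu n))
    (Ce Cpsi Cpsie : Eu n × Eu n → Eu n × Eu n) : Prop :=
  ∀ z ∈ S,
    Tendsto (fun t : ℝ => (Ce (z.1, t • z.2)).1) atTop (𝓝 (Cpsie z).1) ∧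
    Tendsto (fun t : ℝ => t⁻¹ • (Ce (z.1, t • z.2)).2) atTop (𝓝 (Cpsie z).2) ∧
    Tendsto (fun t : ℝ => t⁻¹ • (Cpsi (t • z.1, z.2)).1) atTop (𝓝 (Cpsie z).1) ∧
    Tendsto (fun t : ℝ => (Cpsi (t • z.1, z.2)).2) atTop (𝓝 (Cpsie z).2)

/-! ### Classical `SG`-symbols -/

section Symbols

variable {E F : Type*} [NormedAddCommGroup E] [NormedSpace ℝ E] [NormedAddCommGroup F]
  [NormedSpace ℝ F]

/-- `SG`-symbols of order `(mₑ, m_ψ)`. -/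
def SG (me mpsi : ℝ) (a : E × F → ℝ) : Prop :=
  ContDiff ℝ ∞ a ∧ ∀ i j : ℕ, ∃ c : ℝ, ∀ (x : E) (ξ : F),
    ‖iteratedFDeriv ℝ i (fun x' => iteratedFDeriv ℝ j (fun ξ' => a (x', ξ')) ξ) x‖
      ≤ c * jap x ^ (me - i) * jap ξ ^ (mpsi - j)

/-- Homogeneity of degree `m` in `x` for large `x`. -/
def EvHomE (m : ℝ) (a : E × F → ℝ) : Prop :=
  ∃ c : ℝ, 0 < c ∧ ∀ (x : E) (ξ : F) (s : ℝ), c < ‖x‖ → 1 ≤ s → a (s • x, ξ) = s ^ m * a (x, ξ)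

/-- Homogeneity of degree `m` in `ξ` for large `ξ`. -/
def EvHomPsi (m : ℝ) (a : E × F → ℝ) : Prop :=
  ∃ c : ℝ, 0 < c ∧ ∀ (x : E) (ξ : F) (t : ℝ), c < ‖ξ‖ → 1 ≤ t → a (x, t • ξ) = t ^ m * a (x, ξ)

/-- Bi-homogeneity of degree `(mₑ, m_ψ)` for large `x` and `ξ`. -/
def EvHomBi (me mpsi : ℝ) (a : E × F → ℝ) : Prop :=
  ∃ c : ℝ, 0 < c ∧ ∀ (x : E) (ξ : F) (s t : ℝ), c < ‖x‖ → c < ‖ξ‖ → 1 ≤ s → 1 ≤ t →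
    a (s • x, t • ξ) = s ^ me * t ^ mpsi * a (x, ξ)

/-- `SG^{[mₑ],m_ψ}_{cl(ψ)}`. -/
def SGHomEClPsi (me mpsi : ℝ) (a : E × F → ℝ) : Prop :=
  SG me mpsi a ∧ EvHomE me a ∧
    ∃ b : ℕ → E × F → ℝ, (∀ k : ℕ, SG me (mpsi - k) (b k) ∧ EvHomBi me (mpsi - k) (b k)) ∧
      ∀ N : ℕ, SG me (mpsi - N - 1) (fun z => a z - ∑ k ∈ Finset.range (N + 1), b k z)

/-- `SG^{mₑ,m_ψ}_{cl(ψ)}`. -/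
def SGClPsi (me mpsi : ℝ) (a : E × F → ℝ) : Prop :=
  SG me mpsi a ∧
    ∃ b : ℕ → E × F → ℝ, (∀ k : ℕ, SG me (mpsi - k) (b k) ∧ EvHomPsi (mpsi - k) (b k)) ∧
      ∀ N : ℕ, SG me (mpsi - N - 1) (fun z => a z - ∑ k ∈ Finset.range (N + 1), b k z)

/-- `SG^{mₑ,[m_ψ]}_{cl(e)}`. -/
def SGHomPsiClE (me mpsi : ℝ) (a : E × F → ℝ) : Prop :=
  SG me mpsi a ∧ EvHomPsi mpsi a ∧
    ∃ b : ℕ → E × F → ℝ, (∀ k : ℕ, SG (me - k) mpsi (b k) ∧ EvHomBi (me - k) mpsi (b k)) ∧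
      ∀ N : ℕ, SG (me - N - 1) mpsi (fun z => a z - ∑ k ∈ Finset.range (N + 1), b k z)

/-- `SG^{mₑ,m_ψ}_{cl(e)}`. -/
def SGClE (me mpsi : ℝ) (a : E × F → ℝ) : Prop :=
  SG me mpsi a ∧
    ∃ b : ℕ → E × F → ℝ, (∀ k : ℕ, SG (me - k) mpsi (b k) ∧ EvHomE (me - k) (b k)) ∧
      ∀ N : ℕ, SG (me - N - 1) mpsi (fun z => a z - ∑ k ∈ Finset.range (N + 1), b k z)

/-- Classical `SG`-symbols of order `(mₑ, m_ψ)`. -/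
def SGCl (me mpsi : ℝ) (a : E × F → ℝ) : Prop :=
  SG me mpsi a ∧
    (∃ b : ℕ → E × F → ℝ, (∀ k : ℕ, SGHomPsiClE me (mpsi - k) (b k)) ∧
      ∀ N : ℕ, SGClE me (mpsi - N - 1) (fun z => a z - ∑ k ∈ Finset.range (N + 1), b k z)) ∧
    (∃ b : ℕ → E × F → ℝ, (∀ j : ℕ, SGHomEClPsi (me - j) mpsi (b j)) ∧
      ∀ N : ℕ, SGClPsi (me - N - 1) mpsi (fun z => a z - ∑ j ∈ Finset.range (N + 1), b j z))

/-- `(aₑ, a_ψ, a_{ψe})` is the principal symbol of the classical `SG`-symbol `a` of order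
`(mₑ, m_ψ)`: its leading homogeneous terms at `|x| = ∞`, at `|ξ| = ∞` and at the corner. -/
def IsPrincipalSymbol (me mpsi : ℝ) (a ae apsi apsie : E × F → ℝ) : Prop :=
  (∀ (x : E) (ξ : F), x ≠ 0 →
    Tendsto (fun s : ℝ => s ^ (-me) * a (s • x, ξ)) atTop (𝓝 (ae (x, ξ)))) ∧
  (∀ (x : E) (ξ : F), ξ ≠ 0 →
    Tendsto (fun t : ℝ => t ^ (-mpsi) * a (x, t • ξ)) atTop (𝓝 (apsi (x, ξ)))) ∧
  (∀ (x : E) (ξ : F), x ≠ 0 → ξ ≠ 0 →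
    Tendsto (fun t : ℝ => t ^ (-mpsi) * ae (x, t • ξ)) atTop (𝓝 (apsie (x, ξ))) ∧
    Tendsto (fun s : ℝ => s ^ (-me) * apsi (s • x, ξ)) atTop (𝓝 (apsie (x, ξ))))

end Symbols

/-! ### Parametrisation of canonical graphs -/

/-- The points of `Γ` where `∂φ/∂θ = 0`. -/
def critSet {n N : ℕ} (φ : Eu2 n × Eu N → ℝ) (Γ : Set (Eu2 n × Eu N)) : Set (Eu2 n × Eu N) :=
  {z | z ∈ Γ ∧ ∀ w : Eu N, fderiv ℝ φ z (0, w) = 0}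

/-- `(x, y, θ) ↦ ((x, ∂ₓφ), (y, -∂_yφ))`. -/
def graphMap {n N : ℕ} (φ : Eu2 n × Eu N → ℝ) (z : Eu2 n × Eu N) :
    (Eu n × Eu n) × (Eu n × Eu n) :=
  ((z.1.fst, (gradient (fun b => φ (b, z.2)) z.1).fst),
    (z.1.snd, -(gradient (fun b => φ (b, z.2)) z.1).snd))

/-- `φ` is smooth and non-degenerate on `Γ` (the differentials of the `∂φ/∂θⱼ` are linearly
independent where `∂φ/∂θ = 0`) and parametrises the graph `Λ`: the map
`(x, y, θ) ↦ (x, ∂ₓφ, y, -∂_yφ)` is a bijection of the critical set onto `Λ`. -/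
structure Parametrises {n N : ℕ} (φ : Eu2 n × Eu N → ℝ) (Γ : Set (Eu2 n × Eu N))
    (Λ : Set ((Eu n × Eu n) × (Eu n × Eu n))) : Prop where
  smooth : ContDiffOn ℝ ∞ φ Γ
  nondegenerate : ∀ z ∈ critSet φ Γ, LinearIndependent ℝ (fun j : Fin N =>
    fderiv ℝ (fun z' => fderiv ℝ φ z' (0, EuclideanSpace.single j 1)) z)
  bijOn : BijOn (graphMap φ) (critSet φ Γ) Λ

/-- The part of the graph of `C` with `(x, ξ) ∈ S` and `C (x, ξ) ∈ T`. -/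
def graphOver {n : ℕ} (C : Eu n × Eu n → Eu n × Eu n) (S T : Set (Eu n × Eu n)) :
    Set ((Eu n × Eu n) × (Eu n × Eu n)) :=
  {w | w.1 ∈ S ∧ w.2 ∈ T ∧ w.2 = C w.1}

end

end SGGeom

set_option linter.unusedSectionVars false

namespace SGGeom

noncomputable section

/-! ### Smooth dependence of integrals on parameters -/

/-! All three homogeneous maps come from one pair of functions Y, Z on U. For heights (c₁, c₂) put
C(x, ξ) = (|(x, c₁)| Y, |(ξ, c₂)| Z), with Y, Z taken at the direction of ((x, c₁), (ξ, c₂)); the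
heights (0, 1), (1, 0), (0, 0) give C_e, C_ψ, C_ψe (`gmap`). One needs Y, Z smooth up to the corner
from both faces and symplectic maps (`HomData`). If U meets the corner, the coordinates xʲ and ξⱼ
are sections of S^{1,0} and S^{0,1}; their pull-backs are the components of Y and Z, and the
preserved brackets say that the derivative matrix A satisfies A J Aᵀ = J
(`exists_homData_of_preservesPoisson`). Otherwise the faces decouple, and the contact factor
determines the extension (`exists_symplectic_of_contact`). C_ψe is symplectic as a limit of
rescalings of C_e (`isSymplecticOn_corner`), and the limit formulas express continuity of Y and Z.

For the phase take N = 2n, θ = (θ₁, θ₂), write C = (Y, H), and let X be θ₁ times the ratio of the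
norms of (x, y, c₁) and (θ, c₂), u = (X, θ₂). With a primitive ds = ⟨ξ, dx⟩ - ⟨H, dY⟩ the phase is
⟨θ₂, x - X⟩ - ⟨H(u), y - Y(u)⟩ + s(u) + (τ m/2)|x - X|², where m is the inverse ratio of norms. The
primitive cancels the variation of u, so dφ is ⟨θ₂, dx⟩ - ⟨H, dy⟩ up to terms with a factor x - X or
y - Y(u). The fibre derivative pairs (x - X, -(y - Y)) with a linear map of ℝ²ⁿ; where that map is
invertible, the critical set is x = X, y = Y(u), it is non-degenerate, and it projects to the graph
(`PhaseModel`). On the critical set invertibility reduces to that of ∂ₓH + τ ∂_ξH. Its determinant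
is a polynomial in τ that does not vanish at τ = i, by symplecticity, so a real τ exists
(`exists_transversal`).

By Euler's identity s = ⟨ξ, x⟩ - ⟨H, Y⟩ when c₁ = 0 and s = 0 when c₂ = 0; the two agree at the
corner. Hence near p the maps of all heights and their primitives are restrictions of smooth
functions on the ambient space (`exists_localModel`), and the phases on the three faces are
restrictions of a single smooth function f of directions times the two norms. After a cut-off, ⟨(x,
y)⟩⟨θ⟩ f(R(x, y), Rθ) is a classical SG-symbol, by Taylor expansion at the boundary spheres
(`sgCl_compactSymbol`), and its principal symbols are the values of f on the faces
(`isPrincipalSymbol_compactSymbol`). The conditions needed are open and invariant under scaling, so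
one neighbourhood Ω in the compactified space serves all faces at once (`exists_parametrisation`).
-/

theorem hasFDerivAt_intervalIntegral_of_contDiff {P G : Type} [NormedAddCommGroup P]
    [NormedSpace ℝ P] [FiniteDimensional ℝ P] [NormedAddCommGroup G] [NormedSpace ℝ G]
    [CompleteSpace G] {F : P × ℝ → G} (hF : ContDiff ℝ 1 F) (p : P) :
    HasFDerivAt (fun q => ∫ s in (0 : ℝ)..1, F (q, s))
      (∫ s in (0 : ℝ)..1, (fderiv ℝ F (p, s)).comp (ContinuousLinearMap.inl ℝ P ℝ)) p := by
  have hF' : Continuous fun z : P × ℝ =>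
      (fderiv ℝ F z).comp (ContinuousLinearMap.inl ℝ P ℝ) :=
    (hF.continuous_fderiv (by simp)).clm_comp continuous_const
  have hK : IsCompact (Metric.closedBall p 1 ×ˢ Icc (0 : ℝ) 1) :=
    (isCompact_closedBall p 1).prod isCompact_Icc
  obtain ⟨C, hC⟩ := hK.exists_bound_of_continuousOn hF'.continuousOn
  refine (intervalIntegral.hasFDerivAt_integral_of_dominated_of_fderiv_le
    (bound := fun _ => C) (F' := fun q s => (fderiv ℝ F (q, s)).comp
      (ContinuousLinearMap.inl ℝ P ℝ)) (Metric.ball_mem_nhds p one_pos)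
    (Eventually.of_forall fun q => ?_) ?_ ?_ ?_ ?_ ?_)
  · exact (hF.continuous.comp (by fun_prop : Continuous fun s : ℝ => (q, s))).aestronglyMeasurable
  · exact (hF.continuous.comp (by fun_prop : Continuous fun s : ℝ => (p, s))).intervalIntegrable _ _
  · exact (hF'.comp (by fun_prop : Continuous fun s : ℝ => (p, s))).aestronglyMeasurable
  · refine Eventually.of_forall fun s hs q hq => hC (q, s) ⟨Metric.ball_subset_closedBall hq, ?_⟩
    rw [uIoc_of_le zero_le_one] at hs
    exact ⟨hs.1.le, hs.2⟩
  · exact intervalIntegrable_const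
  · refine Eventually.of_forall fun s _ q _ => ?_
    have h1 : HasFDerivAt F (fderiv ℝ F (q, s)) (q, s) :=
      (hF.differentiable (by simp) _).hasFDerivAt
    exact h1.comp q (hasFDerivAt_prodMk_left q s)

/-- The derivative of the integral is again such an integral, with values in a space of linear maps;
the codomain is therefore quantified inside the induction. -/
theorem contDiff_nat_intervalIntegral {P : Type} [NormedAddCommGroup P] [NormedSpace ℝ P]
    [FiniteDimensional ℝ P] (n : ℕ) : ∀ {G : Type} [NormedAddCommGroup G] [NormedSpace ℝ G]
    [CompleteSpace G] {F : P × ℝ → G}, ContDiff ℝ ∞ F →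
      ContDiff ℝ n (fun q => ∫ s in (0 : ℝ)..1, F (q, s)) := by
  induction n with
  | zero =>
    intro G _ _ _ F hF
    have hd : Differentiable ℝ (fun q => ∫ s in (0 : ℝ)..1, F (q, s)) := fun p =>
      (hasFDerivAt_intervalIntegral_of_contDiff (hF.of_le (by simp)) p).differentiableAt
    exact contDiff_zero.2 hd.continuous
  | succ n ih =>
    intro G _ _ _ F hF
    have hd := fun p => hasFDerivAt_intervalIntegral_of_contDiff (hF.of_le (by simp)) p
    rw [show ((n + 1 : ℕ) : WithTop ℕ∞) = (n : WithTop ℕ∞) + 1 by norm_cast,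
      contDiff_succ_iff_fderiv]
    refine ⟨fun p => (hd p).differentiableAt, by simp, ?_⟩
    rw [funext fun p => (hd p).fderiv]
    exact ih ((hF.fderiv_right (by simp)).clm_comp contDiff_const)

theorem contDiff_intervalIntegral {P G : Type} [NormedAddCommGroup P] [NormedSpace ℝ P]
    [FiniteDimensional ℝ P] [NormedAddCommGroup G] [NormedSpace ℝ G] [CompleteSpace G]
    {F : P × ℝ → G} (hF : ContDiff ℝ ∞ F) :
    ContDiff ℝ ∞ (fun q => ∫ s in (0 : ℝ)..1, F (q, s)) :=
  contDiff_infty.2 fun n => contDiff_nat_intervalIntegral n hF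

/-! ### The functions `⟨x⟩ᵐ f(R x)` and their derivatives -/

section RadComp

variable {E : Type} [NormedAddCommGroup E] [InnerProductSpace ℝ E]

theorem jap_pos {E : Type*} [NormedAddCommGroup E] (x : E) : 0 < jap x :=
  Real.sqrt_pos.2 (by positivity)

theorem jap_sq {E : Type*} [NormedAddCommGroup E] (x : E) : jap x ^ 2 = 1 + ‖x‖ ^ 2 :=
  Real.sq_sqrt (by positivity)

theorem hasFDerivAt_jap (x : E) :
    HasFDerivAt (jap : E → ℝ) (innerSL ℝ ((jap x)⁻¹ • x)) x := by
  have h := (((hasStrictFDerivAt_norm_sq x).hasFDerivAt).const_add 1).sqrt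
    (by positivity : (1 + ‖x‖ ^ 2 : ℝ) ≠ 0)
  refine h.congr_fderiv ?_
  ext v
  have := (jap_pos x).ne'
  simp only [jap] at this ⊢
  simp
  field_simp

/-- `D R(x) v = ⟨x⟩⁻¹ · radCompDeriv (R x) v`. -/
def radCompDeriv (p : E × ℝ) : E →L[ℝ] E × ℝ :=
  (ContinuousLinearMap.inl ℝ E ℝ).comp
      (ContinuousLinearMap.id ℝ E - (innerSL ℝ p.1).smulRight p.1) -
    (ContinuousLinearMap.inr ℝ E ℝ).comp (p.2 • innerSL ℝ p.1)

theorem contDiff_innerSL_fst {B : Type} [NormedAddCommGroup B] [NormedSpace ℝ B] :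
    ContDiff ℝ ∞ fun p : E × B => innerSL ℝ p.1 :=
  (innerSL ℝ).contDiff.comp contDiff_fst

theorem contDiff_radCompDeriv : ContDiff ℝ ∞ (radCompDeriv : E × ℝ → E →L[ℝ] E × ℝ) :=
  (contDiff_const.clm_comp (contDiff_const.sub (contDiff_innerSL_fst.smulRight contDiff_fst))).sub
    (contDiff_const.clm_comp (contDiff_snd.smul contDiff_innerSL_fst))

theorem hasFDerivAt_radComp (x : E) :
    HasFDerivAt (radComp : E → E × ℝ) ((jap x)⁻¹ • radCompDeriv (radComp x)) x := by
  have hj := (jap_pos x).ne'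
  have h0 : HasFDerivAt (fun y : E => (jap y)⁻¹) _ x :=
    (hasDerivAt_inv hj).comp_hasFDerivAt x (hasFDerivAt_jap x)
  have h := (h0.smul (hasFDerivAt_id x)).prodMk h0
  refine h.congr_fderiv ?_
  ext v
  · simp only [radCompDeriv, radComp]
    simp
    match_scalars <;> field_simp
  · simp [radCompDeriv, radComp]
    field_simp

/-- Each derivative costs one power of ⟨x⟩ and leaves a smooth function of R x, because D⟨x⟩ is the
pairing with the first component of R x and DR is ⟨x⟩⁻¹ times a polynomial in R x. The parameter b
later holds the other variable. -/
theorem exists_hasFDerivAt_jap_smul {B G : Type} [NormedAddCommGroup B] [NormedSpace ℝ B]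
    [NormedAddCommGroup G] [NormedSpace ℝ G] (m : ℝ) {f : (E × ℝ) × B → G}
    (hf : ContDiff ℝ ∞ f) :
    ∃ g : (E × ℝ) × B → E →L[ℝ] G, ContDiff ℝ ∞ g ∧ ∀ (x : E) (b : B),
      HasFDerivAt (fun y => jap y ^ m • f (radComp y, b)) (jap x ^ (m - 1) • g (radComp x, b)) x := by
  refine ⟨fun p => (m • innerSL ℝ p.1.1).smulRight (f p) +
    ((fderiv ℝ f p).comp (ContinuousLinearMap.inl ℝ (E × ℝ) B)).comp (radCompDeriv p.1), ?_, ?_⟩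
  · refine ContDiff.add (ContDiff.smulRight ?_ hf) (ContDiff.clm_comp
      ((hf.fderiv_right (by simp)).clm_comp contDiff_const) (contDiff_radCompDeriv.comp contDiff_fst))
    exact contDiff_const.fun_smul
      ((innerSL ℝ (E := E)).contDiff.comp (contDiff_fst.comp contDiff_fst))
  · intro x b
    have hj := jap_pos x
    have h1 := (hasFDerivAt_jap x).rpow_const (p := m) (Or.inl hj.ne')
    have h2 : HasFDerivAt (fun y : E => f (radComp y, b)) _ x :=
      ((hf.differentiable (by simp) (radComp x, b)).hasFDerivAt).comp x
        ((hasFDerivAt_prodMk_left (radComp x) b).comp x (hasFDerivAt_radComp x))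
    refine (h1.smul h2).congr_fderiv ?_
    ext v
    have e : jap x ^ m * (jap x)⁻¹ = jap x ^ (m - 1) := by
      rw [Real.rpow_sub_one hj.ne', div_eq_mul_inv]
    simp [smul_smul, e, radComp]
    rw [add_comm]
    congr 2
    ring

theorem exists_iteratedFDeriv_jap_smul {B G : Type} [NormedAddCommGroup B] [NormedSpace ℝ B]
    [NormedAddCommGroup G] [NormedSpace ℝ G] (m : ℝ) {f : (E × ℝ) × B → G}
    (hf : ContDiff ℝ ∞ f) (i : ℕ) :
    ∃ g : (E × ℝ) × B → E [×i]→L[ℝ] G, ContDiff ℝ ∞ g ∧ ∀ (x : E) (b : B),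
      iteratedFDeriv ℝ i (fun y => jap y ^ m • f (radComp y, b)) x =
        jap x ^ (m - i) • g (radComp x, b) := by
  induction i with
  | zero =>
    refine ⟨fun p => (continuousMultilinearCurryFin0 ℝ E G).symm (f p),
      (continuousMultilinearCurryFin0 ℝ E G).symm.contDiff.comp hf, fun x b => ?_⟩
    rw [iteratedFDeriv_zero_eq_comp]
    simp
  | succ i ih =>
    obtain ⟨g, hg, h⟩ := ih
    obtain ⟨g', hg', h'⟩ := exists_hasFDerivAt_jap_smul (m - i) hg
    refine ⟨(continuousMultilinearCurryLeftEquiv ℝ (fun _ : Fin (i + 1) => E) G).symm ∘ g', (continuousMultilinearCurryLeftEquiv ℝ (fun _ : Fin (i + 1) => E) G).symm.contDiff.comp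
        hg', fun x b => ?_⟩
    rw [iteratedFDeriv_succ_eq_comp_left, Function.comp_apply, funext fun y => h y b,
      (h' x b).fderiv, map_smul]
    push_cast
    rw [sub_sub]
    rfl

/-- Functions `⟨x⟩ᵐ ⟨ξ⟩ˡ f(R x, R ξ)`. -/
def compactSymbol {F : Type} [NormedAddCommGroup F] [NormedSpace ℝ F] (m l : ℝ)
    (f : (E × ℝ) × (F × ℝ) → ℝ) (z : E × F) : ℝ :=
  jap z.1 ^ m * jap z.2 ^ l * f (radComp z.1, radComp z.2)

theorem norm_radComp_fst_lt {E : Type*} [NormedAddCommGroup E] [NormedSpace ℝ E] (x : E) :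
    ‖(radComp x).1‖ < 1 := by
  have hj := jap_pos x
  have := jap_sq x
  simp only [radComp, norm_smul, norm_inv, Real.norm_eq_abs, abs_of_pos hj]
  rw [inv_mul_lt_one₀ hj]
  nlinarith [norm_nonneg x]

theorem one_le_jap {E : Type*} [NormedAddCommGroup E] (x : E) : 1 ≤ jap x := by
  rw [jap, Real.one_le_sqrt]; nlinarith [norm_nonneg x]

theorem radComp_mem_closedBall {E : Type*} [NormedAddCommGroup E] [NormedSpace ℝ E] (x : E) :
    radComp x ∈ Metric.closedBall (0 : E × ℝ) 1 := by
  rw [mem_closedBall_zero_iff, Prod.norm_def, max_le_iff]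
  refine ⟨(norm_radComp_fst_lt x).le, ?_⟩
  have := one_le_jap x
  rw [radComp, Real.norm_eq_abs, abs_of_nonneg (by positivity)]
  exact inv_le_one_of_one_le₀ this

theorem contDiff_jap : ContDiff ℝ ∞ (jap : E → ℝ) :=
  (contDiff_const.add (contDiff_norm_sq ℝ)).sqrt fun x => by positivity

theorem contDiff_radComp : ContDiff ℝ ∞ (radComp : E → E × ℝ) := by
  have : ContDiff ℝ ∞ fun x : E => (jap x)⁻¹ := contDiff_jap.inv fun x => (jap_pos x).ne'
  exact (this.smul contDiff_id).prodMk this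

/-- R takes values in a compact ball, so the smooth coefficient produced by differentiating is
bounded. The ξ-derivatives are taken with R x as a parameter, then the x-derivatives of the result
with R ξ as a parameter. -/
theorem sg_compactSymbol {F : Type} [NormedAddCommGroup F] [InnerProductSpace ℝ F]
    [FiniteDimensional ℝ E] [FiniteDimensional ℝ F] (m l : ℝ) {f : (E × ℝ) × (F × ℝ) → ℝ}
    (hf : ContDiff ℝ ∞ f) : SG m l (compactSymbol m l f) := by
  refine ⟨?_, fun i j => ?_⟩
  · refine ContDiff.mul (ContDiff.mul ?_ ?_) (hf.comp ?_)
    · exact (contDiff_jap.comp contDiff_fst).rpow_const_of_ne fun x => (jap_pos _).ne'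
    · exact (contDiff_jap.comp contDiff_snd).rpow_const_of_ne fun x => (jap_pos _).ne'
    · exact (contDiff_radComp.comp contDiff_fst).prodMk (contDiff_radComp.comp contDiff_snd)
  · obtain ⟨g, hg, h⟩ := exists_iteratedFDeriv_jap_smul l
      (show ContDiff ℝ ∞ fun q : (F × ℝ) × (E × ℝ) => f (q.2, q.1) from
        hf.comp (contDiff_snd.prodMk contDiff_fst)) j
    obtain ⟨g', hg', h'⟩ := exists_iteratedFDeriv_jap_smul m
      (show ContDiff ℝ ∞ fun q : (E × ℝ) × (F × ℝ) => g (q.2, q.1) from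
        hg.comp (contDiff_snd.prodMk contDiff_fst)) i
    have hK := (isCompact_closedBall (0 : E × ℝ) 1).prod (isCompact_closedBall (0 : F × ℝ) 1)
    obtain ⟨c, hc⟩ := hK.exists_bound_of_continuousOn hg'.continuous.continuousOn
    refine ⟨c, fun x ξ => ?_⟩
    have e1 : ∀ y : E, iteratedFDeriv ℝ j (fun ξ' => compactSymbol m l f (y, ξ')) ξ =
        jap ξ ^ (l - j) • (jap y ^ m • g (radComp ξ, radComp y)) := by
      intro y
      have e2 : (fun ξ' => compactSymbol m l f (y, ξ')) =
          fun ξ' => jap y ^ m • (jap ξ' ^ l • f (radComp y, radComp ξ')) := by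
        ext ξ'; simp [compactSymbol, mul_assoc]
      have hs : ContDiff ℝ j fun ξ' : F => jap ξ' ^ l • f (radComp y, radComp ξ') := by
        refine ContDiff.of_le (n := ∞) (ContDiff.fun_smul ?_ (hf.fun_comp ?_)) (by exact_mod_cast le_top)
        · exact contDiff_jap.rpow_const_of_ne fun x => (jap_pos _).ne'
        · exact contDiff_const.prodMk contDiff_radComp
      rw [e2, iteratedFDeriv_const_smul_apply' hs.contDiffAt, h ξ (radComp y), smul_comm]
    have hs : ContDiff ℝ i fun y : E => jap y ^ m • g (radComp ξ, radComp y) := by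
      refine ContDiff.of_le (n := ∞) (ContDiff.fun_smul ?_ (hg.fun_comp ?_)) (by exact_mod_cast le_top)
      · exact contDiff_jap.rpow_const_of_ne fun x => (jap_pos _).ne'
      · exact contDiff_const.prodMk contDiff_radComp
    rw [funext e1, iteratedFDeriv_const_smul_apply' hs.contDiffAt, h' x (radComp ξ), norm_smul,
      norm_smul, Real.norm_of_nonneg (Real.rpow_nonneg (jap_pos _).le _),
      Real.norm_of_nonneg (Real.rpow_nonneg (jap_pos _).le _)]
    have := hc (radComp x, radComp ξ) ⟨radComp_mem_closedBall x, radComp_mem_closedBall ξ⟩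
    have h1 := Real.rpow_nonneg (jap_pos x).le (m - i)
    have h2 := Real.rpow_nonneg (jap_pos ξ).le (l - j)
    calc _ = ‖g' (radComp x, radComp ξ)‖ * (jap x ^ (m - i) * jap ξ ^ (l - j)) := by ring
      _ ≤ c * (jap x ^ (m - i) * jap ξ ^ (l - j)) := by gcongr
      _ = _ := by ring

end RadComp

/-! ### Homogeneous expansions at infinity -/

section Expansion

variable {E : Type} [NormedAddCommGroup E] [InnerProductSpace ℝ E] [FiniteDimensional ℝ E]
  {B : Type} [NormedAddCommGroup B] [NormedSpace ℝ B] [FiniteDimensional ℝ B]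

/-- A smooth bump function at the centre of the unit ball. -/
def centreBump (E : Type) [NormedAddCommGroup E] : ContDiffBump (0 : E) :=
  ⟨1 / 4, 1 / 2, by norm_num, by norm_num⟩

/-- A smooth function that vanishes near `0` and equals `1` outside the ball of radius `1/2`. -/
def cutInf (X : E) : ℝ := 1 - centreBump E X

theorem cutInf_eq_one {X : E} (h : 1 / 2 ≤ ‖X‖) : cutInf X = 1 := by
  rw [cutInf, (centreBump E).zero_of_le_dist (by simpa [centreBump] using h), sub_zero]

theorem contDiff_cutInf : ContDiff ℝ ∞ (cutInf : E → ℝ) :=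
  contDiff_const.sub (centreBump E).contDiff

theorem cutInf_eventuallyEq_zero : ∀ᶠ X in 𝓝 (0 : E), cutInf X = 0 := by
  filter_upwards [Metric.ball_mem_nhds (0 : E) (by norm_num : (0 : ℝ) < 1 / 4)] with X hX
  rw [cutInf, (centreBump E).one_of_mem_closedBall (Metric.ball_subset_closedBall hX), sub_self]

theorem contDiff_cutInf_mul {P : Type} [NormedAddCommGroup P] [NormedSpace ℝ P] {π : P → E}
    (hπ : ContDiff ℝ ∞ π) {h : P → ℝ} (hh : ∀ p, π p ≠ 0 → ContDiffAt ℝ ∞ h p) :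
    ContDiff ℝ ∞ fun p => cutInf (π p) * h p := by
  refine contDiff_iff_contDiffAt.2 fun p => ?_
  by_cases hp : π p = 0
  · have h0 : ∀ᶠ q in 𝓝 p, cutInf (π q) = 0 := by
      have h := cutInf_eventuallyEq_zero (E := E)
      rw [← hp] at h
      exact hπ.continuous.continuousAt.eventually h
    refine (contDiffAt_const (c := (0 : ℝ))).congr_of_eventuallyEq ?_
    filter_upwards [h0] with q hq
    rw [hq, zero_mul]
  · exact (contDiff_cutInf.comp hπ).contDiffAt.mul (hh p hp)

/-- The bump function vanishes for ‖π p‖ ≥ 1/2, well before the root degenerates at ‖π p‖ = 1. -/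
theorem contDiff_centreBump_div_mul {P : Type} [NormedAddCommGroup P] [NormedSpace ℝ P]
    {π : P → E} (hπ : ContDiff ℝ ∞ π) {h : P → ℝ} (hh : ContDiff ℝ ∞ h) :
    ContDiff ℝ ∞ fun p => centreBump E (π p) / Real.sqrt (1 - ‖π p‖ ^ 2) * h p := by
  refine contDiff_iff_contDiffAt.2 fun p => ?_
  by_cases hp : ‖π p‖ < 1
  · refine ContDiffAt.mul (ContDiffAt.div ?_ (ContDiffAt.sqrt ?_ ?_) ?_) hh.contDiffAt
    · exact ((centreBump E).contDiff.comp hπ).contDiffAt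
    · exact (contDiff_const.sub (hπ.norm_sq ℝ)).contDiffAt
    · nlinarith [norm_nonneg (π p)]
    · refine (Real.sqrt_pos.2 ?_).ne'
      nlinarith [norm_nonneg (π p)]
  · have h0 : ∀ᶠ q in 𝓝 p, 1 / 2 < ‖π q‖ :=
      hπ.continuous.norm.continuousAt.eventually (lt_mem_nhds (by linarith [not_lt.1 hp]))
    refine (contDiffAt_const (c := (0 : ℝ))).congr_of_eventuallyEq ?_
    filter_upwards [h0] with q hq
    rw [(centreBump E).zero_of_le_dist (by simpa [centreBump] using hq.le), zero_div, zero_mul]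

/-- The function `⟨x⟩ᵐ f(R x, b)` in the coordinates `w = x/|x|`, `r = 1/|x|`, divided by
`|x|ᵐ`. -/
def projForm (m : ℝ) (f : (E × ℝ) × B → ℝ) (p : (E × ℝ) × B) : ℝ :=
  (1 + p.1.2 ^ 2) ^ (m / 2) * f ((Real.sqrt (1 + p.1.2 ^ 2))⁻¹ • p.1, p.2)

theorem contDiff_projForm (m : ℝ) {f : (E × ℝ) × B → ℝ} (hf : ContDiff ℝ ∞ f) :
    ContDiff ℝ ∞ (projForm m f) := by
  have h1 : ContDiff ℝ ∞ fun p : (E × ℝ) × B => 1 + p.1.2 ^ 2 := by fun_prop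
  have h2 : ContDiff ℝ ∞ fun p : (E × ℝ) × B => (Real.sqrt (1 + p.1.2 ^ 2))⁻¹ :=
    (h1.sqrt fun p => by positivity).inv fun p => (Real.sqrt_pos.2 (by positivity)).ne'
  exact (h1.rpow_const_of_ne fun p => by positivity).mul
    (hf.comp ((h2.smul contDiff_fst).prodMk contDiff_snd))

/-- The difference quotient of `projForm` in `r` at `r = 0`. -/
def projRem (m : ℝ) (f : (E × ℝ) × B → ℝ) (p : (E × ℝ) × B) : ℝ :=
  ∫ s in (0 : ℝ)..1, fderiv ℝ (projForm m f) ((p.1.1, s * p.1.2), p.2) ((0, 1), 0)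

theorem contDiff_projRem (m : ℝ) {f : (E × ℝ) × B → ℝ} (hf : ContDiff ℝ ∞ f) :
    ContDiff ℝ ∞ (projRem m f) := by
  refine contDiff_intervalIntegral (F := fun q : ((E × ℝ) × B) × ℝ =>
    fderiv ℝ (projForm m f) ((q.1.1.1, q.2 * q.1.1.2), q.1.2) ((0, 1), 0)) ?_
  refine ContDiff.clm_apply (((contDiff_projForm m hf).fderiv_right (m := ∞) (by simp)).comp ?_)
    contDiff_const
  fun_prop

/-- First-order Taylor formula in r at the sphere at infinity, with the remainder in integral form,
so that the quotient by r is visibly smooth. -/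
theorem projForm_eq_add (m : ℝ) {f : (E × ℝ) × B → ℝ} (hf : ContDiff ℝ ∞ f) (w : E) (r : ℝ)
    (b : B) : projForm m f ((w, r), b) = f ((w, 0), b) + r * projRem m f ((w, r), b) := by
  have hF := contDiff_projForm m hf
  have hd : ∀ s : ℝ, HasDerivAt (fun s => projForm m f ((w, s * r), b))
      (r * fderiv ℝ (projForm m f) ((w, s * r), b) ((0, 1), 0)) s := by
    intro s
    have h1 : HasDerivAt (fun s : ℝ => (((w, s * r), b) : (E × ℝ) × B)) ((0, r), 0) s := by
      refine HasDerivAt.prodMk (HasDerivAt.prodMk (hasDerivAt_const _ _) ?_) (hasDerivAt_const _ _)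
      simpa using (hasDerivAt_id s).mul_const r
    have h2 := ((hF.differentiable (by simp) ((w, s * r), b)).hasFDerivAt).comp_hasDerivAt s h1
    refine h2.congr_deriv ?_
    rw [show (((0, r), 0) : (E × ℝ) × B) = r • ((0, 1), 0) by simp, map_smul, smul_eq_mul]
  have hc : Continuous fun s : ℝ => r * fderiv ℝ (projForm m f) ((w, s * r), b) ((0, 1), 0) :=
    continuous_const.mul (((hF.continuous_fderiv (by simp)).comp (by fun_prop)).clm_apply
      continuous_const)
  have h := intervalIntegral.integral_eq_sub_of_hasDerivAt (a := 0) (b := 1) (fun s _ => hd s)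
    (hc.intervalIntegrable _ _)
  rw [intervalIntegral.integral_const_mul] at h
  simp only [one_mul, zero_mul] at h
  have h0 : projForm m f ((w, 0), b) = f ((w, 0), b) := by simp [projForm]
  rw [projRem, h, h0]; ring

/-- The leading homogeneous term of `⟨x⟩ᵐ f(R x, b)`, cut off near the origin and divided by
`⟨x⟩ᵐ`. -/
def lead (m : ℝ) (f : (E × ℝ) × B → ℝ) (p : (E × ℝ) × B) : ℝ :=
  cutInf p.1.1 * (‖p.1.1‖ ^ m * f ((‖p.1.1‖⁻¹ • p.1.1, 0), p.2))

/-- The remainder after the leading term. -/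
def remn (m : ℝ) (f : (E × ℝ) × B → ℝ) (p : (E × ℝ) × B) : ℝ :=
  cutInf p.1.1 * (‖p.1.1‖ ^ (m - 1) *
      projRem m f ((‖p.1.1‖⁻¹ • p.1.1, ‖p.1.1‖⁻¹ * p.1.2), p.2)) +
    centreBump E p.1.1 / Real.sqrt (1 - ‖p.1.1‖ ^ 2) * f p

theorem contDiff_lead (m : ℝ) {f : (E × ℝ) × B → ℝ} (hf : ContDiff ℝ ∞ f) :
    ContDiff ℝ ∞ (lead m f) := by
  refine contDiff_cutInf_mul (π := fun p : (E × ℝ) × B => p.1.1) (by fun_prop) fun p hp => ?_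
  have hX : ContDiffAt ℝ ∞ (fun p : (E × ℝ) × B => p.1.1) p := by fun_prop
  have hn : ContDiffAt ℝ ∞ (fun p : (E × ℝ) × B => ‖p.1.1‖) p := hX.norm ℝ hp
  refine (hn.rpow_const_of_ne (norm_ne_zero_iff.2 hp)).mul (hf.contDiffAt.comp p ?_)
  exact (((hn.inv (norm_ne_zero_iff.2 hp)).smul hX).prodMk contDiffAt_const).prodMk contDiffAt_snd

theorem contDiff_remn (m : ℝ) {f : (E × ℝ) × B → ℝ} (hf : ContDiff ℝ ∞ f) :
    ContDiff ℝ ∞ (remn m f) := by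
  refine ContDiff.add (contDiff_cutInf_mul (π := fun p : (E × ℝ) × B => p.1.1) (by fun_prop)
    fun p hp => ?_) (contDiff_centreBump_div_mul (by fun_prop) hf)
  have hX : ContDiffAt ℝ ∞ (fun p : (E × ℝ) × B => p.1.1) p := by fun_prop
  have hn : ContDiffAt ℝ ∞ (fun p : (E × ℝ) × B => ‖p.1.1‖) p := hX.norm ℝ hp
  have hi := hn.inv (norm_ne_zero_iff.2 hp)
  refine (hn.rpow_const_of_ne (norm_ne_zero_iff.2 hp)).mul
    ((contDiff_projRem m hf).contDiffAt.comp p ?_)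
  exact ((hi.smul hX).prodMk (hi.mul (by fun_prop))).prodMk contDiffAt_snd

theorem radComp_sphere {E : Type*} [NormedAddCommGroup E] [NormedSpace ℝ E] (x : E) :
    ‖(radComp x).1‖ ^ 2 + (radComp x).2 ^ 2 = 1 := by
  have hj := jap_pos x
  have := jap_sq x
  simp only [radComp, norm_smul, norm_inv, Real.norm_eq_abs, abs_of_pos hj]
  field_simp
  linarith

/-- Away from X = 0 this is the Taylor formula in r = ρ/‖X‖. Near X = 0 nothing has to be expanded:
on the half-sphere ρ = √(1 - ‖X‖²) is bounded below there, so the cut-off piece of f can be divided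
by ρ = ⟨x⟩⁻¹ and counted as remainder. -/
theorem lead_add_remn (m : ℝ) {f : (E × ℝ) × B → ℝ} (hf : ContDiff ℝ ∞ f) (x : E) (b : B) :
    f (radComp x, b) = lead m f (radComp x, b) + (jap x)⁻¹ * remn m f (radComp x, b) := by
  have hs := radComp_sphere x
  have hl := norm_radComp_fst_lt x
  have hr : (radComp x).2 = (jap x)⁻¹ := rfl
  have hpos : 0 < (radComp x).2 := inv_pos.2 (jap_pos x)
  rw [← hr]
  generalize radComp x = p at *
  obtain ⟨X, ρ⟩ := p
  simp only at hs hl hpos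
  have hsq : Real.sqrt (1 - ‖X‖ ^ 2) = ρ := by
    rw [← hs, add_sub_cancel_left, Real.sqrt_sq hpos.le]
  have hF : X ≠ 0 → f ((X, ρ), b) = ‖X‖ ^ m * f ((‖X‖⁻¹ • X, 0), b) +
      ρ * (‖X‖ ^ (m - 1) * projRem m f ((‖X‖⁻¹ • X, ‖X‖⁻¹ * ρ), b)) := by
    intro hX
    have hn : 0 < ‖X‖ := norm_pos_iff.2 hX
    -- Because of this relation on the sphere, `projForm` at (X/‖X‖, ρ/‖X‖) evaluates f at (X, ρ)
    -- itself.
    have e1 : 1 + (‖X‖⁻¹ * ρ) ^ 2 = (‖X‖ ^ 2)⁻¹ := by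
      field_simp; exact hs
    have e2 : (1 + (‖X‖⁻¹ * ρ) ^ 2) ^ (m / 2) = (‖X‖ ^ m)⁻¹ := by
      rw [e1, Real.inv_rpow (by positivity), ← Real.rpow_natCast, ← Real.rpow_mul hn.le]
      congr 2; push_cast; ring
    have e3 : (Real.sqrt (1 + (‖X‖⁻¹ * ρ) ^ 2))⁻¹ = ‖X‖ := by
      rw [e1, Real.sqrt_inv, Real.sqrt_sq hn.le, inv_inv]
    have h := projForm_eq_add m hf (‖X‖⁻¹ • X) (‖X‖⁻¹ * ρ) b
    rw [projForm, e2, e3] at h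
    have e4 : ‖X‖ • (‖X‖⁻¹ • X, ‖X‖⁻¹ * ρ) = (X, ρ) := by
      ext <;> simp [smul_smul, hn.ne']
    simp only [e4] at h
    have hm : 0 < ‖X‖ ^ m := Real.rpow_pos_of_pos hn m
    rw [inv_mul_eq_iff_eq_mul₀ hm.ne'] at h
    rw [h, Real.rpow_sub_one hn.ne']
    field_simp
  simp only [lead, remn, hsq]
  by_cases hX : X = 0
  · have h0 := (cutInf_eventuallyEq_zero (E := E)).self_of_nhds
    have h1 : centreBump E 0 = (1 : ℝ) := by rw [cutInf] at h0; linarith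
    subst hX
    rw [h0, h1]; field_simp; ring
  · rw [hF hX, cutInf]
    field_simp
    ring

theorem lead_homog (m : ℝ) (f : (E × ℝ) × B → ℝ) (x : E) (b : B) (s : ℝ) (hx : 1 < ‖x‖)
    (hs : 1 ≤ s) : jap (s • x) ^ m * lead m f (radComp (s • x), b) =
      s ^ m * (jap x ^ m * lead m f (radComp x, b)) := by
  have key : ∀ y : E, 1 < ‖y‖ →
      jap y ^ m * lead m f (radComp y, b) = ‖y‖ ^ m * f ((‖y‖⁻¹ • y, 0), b) := by
    intro y hy
    have hj := jap_pos y
    have hn : ‖(radComp y).1‖ = (jap y)⁻¹ * ‖y‖ := by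
      simp [radComp, norm_smul, abs_of_pos hj]
    have hy0 : 0 < ‖y‖ := by linarith
    -- For ‖y‖ > 1 the first component of R y has norm ‖y‖/⟨y⟩ > 1/√2, outside the region where the
    -- cut-off acts.
    have hc : cutInf (radComp y).1 = 1 := by
      apply cutInf_eq_one
      rw [hn, inv_mul_eq_div, le_div_iff₀ hj]
      have := jap_sq y
      nlinarith
    rw [lead, hc, one_mul, hn, Real.mul_rpow (by positivity) hy0.le, Real.inv_rpow hj.le]
    have : ((jap y)⁻¹ * ‖y‖)⁻¹ • (radComp y).1 = ‖y‖⁻¹ • y := by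
      simp only [radComp, smul_smul]
      congr 1; field_simp
    simp only [this]
    have := (Real.rpow_pos_of_pos hj m).ne'
    field_simp
  have hs0 : 0 < s := by linarith
  have hsx : ‖s • x‖ = s * ‖x‖ := by rw [norm_smul, Real.norm_of_nonneg hs0.le]
  rw [key x hx, key (s • x) (by rw [hsx]; nlinarith), hsx, Real.mul_rpow hs0.le (norm_nonneg _),
    smul_smul]
  rw [show (s * ‖x‖)⁻¹ * s = ‖x‖⁻¹ by field_simp]
  ring

theorem lead_smul {m : ℝ} {f : (E × ℝ) × B → ℝ} {b b' : B} {c : ℝ}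
    (h : ∀ p, f (p, b') = c * f (p, b)) (p : E × ℝ) :
    lead m f (p, b') = c * lead m f (p, b) := by
  simp only [lead, h]; ring

/-- Taking remainders is linear in f and differentiates only in the first variable, so a
proportionality between two values of the parameter survives. This keeps homogeneity in the second
variable intact while expanding in the first. -/
theorem remn_smul {m : ℝ} {f : (E × ℝ) × B → ℝ} (hf : ContDiff ℝ ∞ f) {b b' : B} {c : ℝ}
    (h : ∀ p, f (p, b') = c * f (p, b)) (p : E × ℝ) :
    remn m f (p, b') = c * remn m f (p, b) := by
  have hF := contDiff_projForm m hf
  have h1 : ∀ p, projForm m f (p, b') = c * projForm m f (p, b) := fun p => by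
    simp only [projForm, h]; ring
  have h2 : ∀ (q : E × ℝ) (b : B) v, fderiv ℝ (projForm m f) (q, b) (v, 0) =
      fderiv ℝ (fun q => projForm m f (q, b)) q v := by
    intro q b v
    have h : HasFDerivAt (fun q => projForm m f (q, b)) _ q :=
      HasFDerivAt.comp (g := projForm m f) (f := fun q => (q, b)) q
        (hF.differentiable (by simp) (q, b)).hasFDerivAt (hasFDerivAt_prodMk_left q b)
    rw [h.fderiv]; simp
  have h3 : ∀ p, projRem m f (p, b') = c * projRem m f (p, b) := fun p => by
    simp only [projRem]
    rw [← intervalIntegral.integral_const_mul]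
    congr 1; ext s
    rw [h2, h2, funext h1, fderiv_const_mul]
    · simp
    · exact ((hF.comp (contDiff_id.prodMk contDiff_const)).differentiable (by simp) _)
  simp only [remn, h, h3]; ring

/-- The iterated remainders. -/
def remnSeq (m : ℝ) (f : (E × ℝ) × B → ℝ) : ℕ → (E × ℝ) × B → ℝ
  | 0 => f
  | k + 1 => remn (m - k) (remnSeq m f k)

theorem contDiff_remnSeq (m : ℝ) {f : (E × ℝ) × B → ℝ} (hf : ContDiff ℝ ∞ f) (k : ℕ) :
    ContDiff ℝ ∞ (remnSeq m f k) := by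
  induction k with
  | zero => exact hf
  | succ k ih => exact contDiff_remn _ ih

/-- The homogeneous terms of the expansion at infinity. -/
def leadSeq (m : ℝ) (f : (E × ℝ) × B → ℝ) (k : ℕ) : (E × ℝ) × B → ℝ :=
  lead (m - k) (remnSeq m f k)

theorem contDiff_leadSeq (m : ℝ) {f : (E × ℝ) × B → ℝ} (hf : ContDiff ℝ ∞ f) (k : ℕ) :
    ContDiff ℝ ∞ (leadSeq m f k) :=
  contDiff_lead _ (contDiff_remnSeq m hf k)

theorem remnSeq_smul {m : ℝ} {f : (E × ℝ) × B → ℝ} (hf : ContDiff ℝ ∞ f) {b b' : B} {c : ℝ}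
    (h : ∀ p, f (p, b') = c * f (p, b)) (k : ℕ) (p : E × ℝ) :
    remnSeq m f k (p, b') = c * remnSeq m f k (p, b) := by
  induction k generalizing p with
  | zero => exact h p
  | succ k ih => exact remn_smul (contDiff_remnSeq m hf k) ih p

theorem leadSeq_smul {m : ℝ} {f : (E × ℝ) × B → ℝ} (hf : ContDiff ℝ ∞ f) {b b' : B} {c : ℝ}
    (h : ∀ p, f (p, b') = c * f (p, b)) (k : ℕ) (p : E × ℝ) :
    leadSeq m f k (p, b') = c * leadSeq m f k (p, b) :=
  lead_smul (remnSeq_smul hf h k) p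

theorem sub_sum_leadSeq (m : ℝ) {f : (E × ℝ) × B → ℝ} (hf : ContDiff ℝ ∞ f) (N : ℕ) (x : E)
    (b : B) : jap x ^ m * f (radComp x, b) -
      ∑ k ∈ Finset.range N, jap x ^ (m - k) * leadSeq m f k (radComp x, b) =
        jap x ^ (m - N) * remnSeq m f N (radComp x, b) := by
  induction N with
  | zero => simp [remnSeq]
  | succ N ih =>
    rw [Finset.sum_range_succ, ← sub_sub, ih,
      lead_add_remn (m - N) (contDiff_remnSeq m hf N) x b, leadSeq, remnSeq]
    have : jap x ^ (m - (N + 1 : ℕ)) = jap x ^ (m - N) * (jap x)⁻¹ := by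
      push_cast
      rw [← sub_sub, Real.rpow_sub_one (jap_pos x).ne', div_eq_mul_inv]
    rw [this]; ring

end Expansion

/-! ### Smooth functions on the compactification are classical symbols -/

section Classical

variable {E : Type} [NormedAddCommGroup E] [InnerProductSpace ℝ E] [FiniteDimensional ℝ E]
  {F : Type} [NormedAddCommGroup F] [InnerProductSpace ℝ F] [FiniteDimensional ℝ F]

/-- `⟨ξ⟩ˡ f(p, R ξ)` is homogeneous of degree `l` in `ξ` for `|ξ| > 1`. -/
def CompHom {A : Type} (l : ℝ) (f : A × (F × ℝ) → ℝ) : Prop :=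
  ∀ (p : A) (ξ : F) (t : ℝ), 1 < ‖ξ‖ → 1 ≤ t →
    jap (t • ξ) ^ l * f (p, radComp (t • ξ)) = t ^ l * (jap ξ ^ l * f (p, radComp ξ))

/-- Homogeneity compares f at the parameters R ξ and R(tξ) by a factor independent of the first
variable, which is what `leadSeq_smul` transports. -/
theorem CompHom.leadSeq {m l : ℝ} {f : (E × ℝ) × (F × ℝ) → ℝ} (hf : ContDiff ℝ ∞ f)
    (h : CompHom l f) (k : ℕ) : CompHom l (leadSeq m f k) := by
  intro p ξ t hξ ht
  have h1 := Real.rpow_pos_of_pos (jap_pos (t • ξ)) l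
  have := leadSeq_smul (m := m) hf (b := radComp ξ) (b' := radComp (t • ξ))
    (c := t ^ l * jap ξ ^ l / jap (t • ξ) ^ l) (fun p => by
      have := h p ξ t hξ ht
      field_simp
      linarith) k p
  rw [this]; field_simp

theorem compHom_leadSeq_swap (m : ℝ) (f : (F × ℝ) × (E × ℝ) → ℝ) (k : ℕ) :
    CompHom (m - k) fun q : (E × ℝ) × (F × ℝ) => leadSeq m f k q.swap :=
  fun p ξ t hξ ht => lead_homog _ _ ξ p t hξ ht

theorem contDiff_comp_swap {A B : Type} [NormedAddCommGroup A] [NormedSpace ℝ A]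
    [NormedAddCommGroup B] [NormedSpace ℝ B] {f : A × B → ℝ} (hf : ContDiff ℝ ∞ f) :
    ContDiff ℝ ∞ fun q : B × A => f q.swap :=
  hf.comp (contDiff_snd.prodMk contDiff_fst)

theorem compactSymbol_sub_sum_fst (m l : ℝ) {f : (E × ℝ) × (F × ℝ) → ℝ} (hf : ContDiff ℝ ∞ f)
    (N : ℕ) : (fun z => compactSymbol m l f z -
      ∑ k ∈ Finset.range (N + 1), compactSymbol (m - k) l (leadSeq m f k) z) =
        compactSymbol (m - N - 1) l (remnSeq m f (N + 1)) := by
  ext z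
  have h := sub_sum_leadSeq m hf (N + 1) z.1 (radComp z.2)
  simp only [compactSymbol]
  push_cast at h
  rw [← sub_sub] at h
  calc _ = jap z.2 ^ l * (jap z.1 ^ m * f (radComp z.1, radComp z.2) -
        ∑ k ∈ Finset.range (N + 1),
          jap z.1 ^ (m - k) * leadSeq m f k (radComp z.1, radComp z.2)) := by
        rw [mul_sub, Finset.mul_sum]
        congr 1
        · ring
        · exact Finset.sum_congr rfl fun k _ => by ring
    _ = _ := by rw [h]; ring

theorem compactSymbol_sub_sum_snd (m l : ℝ) {f : (E × ℝ) × (F × ℝ) → ℝ} (hf : ContDiff ℝ ∞ f)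
    (N : ℕ) : (fun z => compactSymbol m l f z -
      ∑ k ∈ Finset.range (N + 1),
        compactSymbol m (l - k) (fun q => leadSeq l (fun r => f r.swap) k q.swap) z) =
        compactSymbol m (l - N - 1) (fun q => remnSeq l (fun r => f r.swap) (N + 1) q.swap) := by
  have h := compactSymbol_sub_sum_fst l m (contDiff_comp_swap hf) N
  have e : ∀ (a b : ℝ) (g : (F × ℝ) × (E × ℝ) → ℝ) (z : E × F),
      compactSymbol a b (fun q => g q.swap) z = compactSymbol b a g z.swap := by
    intro a b g z
    simp only [compactSymbol, Prod.fst_swap, Prod.snd_swap, Prod.swap_prod_mk]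
    ring
  ext z
  have h' := congrFun h z.swap
  simp only [e]
  rw [← h', ← e]
  rfl

theorem evHomE_compactSymbol (m l : ℝ) (f : (E × ℝ) × (F × ℝ) → ℝ) (k : ℕ) :
    EvHomE (m - k) (compactSymbol (m - k) l (leadSeq m f k)) := by
  refine ⟨1, one_pos, fun x ξ s hx hs => ?_⟩
  have := lead_homog (m - k) (remnSeq m f k) x (radComp ξ) s hx hs
  simp only [compactSymbol, leadSeq]
  linear_combination jap ξ ^ l * this

theorem evHomPsi_compactSymbol (m l : ℝ) {f : (E × ℝ) × (F × ℝ) → ℝ} (h : CompHom l f) :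
    EvHomPsi l (compactSymbol m l f) := by
  refine ⟨1, one_pos, fun x ξ s hx hs => ?_⟩
  have := h (radComp x) ξ s hx hs
  simp only [compactSymbol]
  linear_combination jap x ^ m * this

theorem evHomBi_of_homog {m l : ℝ} {a : E × F → ℝ} (h1 : EvHomE m a) (h2 : EvHomPsi l a) :
    EvHomBi m l a := by
  obtain ⟨c, hc, h⟩ := h1
  obtain ⟨c', hc', h'⟩ := h2
  refine ⟨max c c', lt_max_of_lt_left hc, fun x ξ s t hx hξ hs ht => ?_⟩
  rw [h x _ s ((le_max_left _ _).trans_lt hx) hs, h' x ξ t ((le_max_right _ _).trans_lt hξ) ht,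
    mul_assoc]

theorem sgClE_compactSymbol (m l : ℝ) {f : (E × ℝ) × (F × ℝ) → ℝ} (hf : ContDiff ℝ ∞ f) :
    SGClE m l (compactSymbol m l f) := by
  refine ⟨sg_compactSymbol m l hf, fun k => compactSymbol (m - k) l (leadSeq m f k),
    fun k => ⟨sg_compactSymbol _ _ (contDiff_leadSeq m hf k), evHomE_compactSymbol m l f k⟩,
    fun N => ?_⟩
  rw [compactSymbol_sub_sum_fst m l hf]
  exact sg_compactSymbol _ _ (contDiff_remnSeq m hf _)

theorem sgHomPsiClE_compactSymbol (m l : ℝ) {f : (E × ℝ) × (F × ℝ) → ℝ} (hf : ContDiff ℝ ∞ f)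
    (h : CompHom l f) : SGHomPsiClE m l (compactSymbol m l f) := by
  refine ⟨sg_compactSymbol m l hf, evHomPsi_compactSymbol m l h,
    fun k => compactSymbol (m - k) l (leadSeq m f k),
    fun k => ⟨sg_compactSymbol _ _ (contDiff_leadSeq m hf k),
      evHomBi_of_homog (evHomE_compactSymbol m l f k)
        (evHomPsi_compactSymbol _ l (h.leadSeq hf k))⟩,
    fun N => ?_⟩
  rw [compactSymbol_sub_sum_fst m l hf]
  exact sg_compactSymbol _ _ (contDiff_remnSeq m hf _)

/-- The same statements with the roles of the variables exchanged. -/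
theorem evHomPsi_compactSymbol_swap (m l : ℝ) (f : (F × ℝ) × (E × ℝ) → ℝ) (k : ℕ) :
    EvHomPsi (l - k) (compactSymbol m (l - k)
      fun q : (E × ℝ) × (F × ℝ) => leadSeq l f k q.swap) :=
  evHomPsi_compactSymbol m _ (compHom_leadSeq_swap l f k)

theorem evHomE_compactSymbol_of_swap (m l : ℝ) {f : (E × ℝ) × (F × ℝ) → ℝ}
    (h : CompHom m fun q : (F × ℝ) × (E × ℝ) => f q.swap) :
    EvHomE m (compactSymbol m l f) := by
  refine ⟨1, one_pos, fun x ξ s hx hs => ?_⟩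
  have := h (radComp ξ) x s hx hs
  simp only [Prod.swap_prod_mk] at this
  simp only [compactSymbol]
  linear_combination jap ξ ^ l * this

theorem sgClPsi_compactSymbol (m l : ℝ) {f : (E × ℝ) × (F × ℝ) → ℝ} (hf : ContDiff ℝ ∞ f) :
    SGClPsi m l (compactSymbol m l f) := by
  have hf' := contDiff_comp_swap hf
  refine ⟨sg_compactSymbol m l hf, _,
    fun k => ⟨sg_compactSymbol m (l - k) (contDiff_comp_swap (contDiff_leadSeq l hf' k)),
      evHomPsi_compactSymbol_swap m l _ k⟩, fun N => ?_⟩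
  rw [compactSymbol_sub_sum_snd m l hf]
  exact sg_compactSymbol _ _ (contDiff_comp_swap (contDiff_remnSeq l hf' _))

theorem sgHomEClPsi_compactSymbol (m l : ℝ) {f : (E × ℝ) × (F × ℝ) → ℝ} (hf : ContDiff ℝ ∞ f)
    (h : CompHom m fun q : (F × ℝ) × (E × ℝ) => f q.swap) :
    SGHomEClPsi m l (compactSymbol m l f) := by
  have hf' := contDiff_comp_swap hf
  refine ⟨sg_compactSymbol m l hf, evHomE_compactSymbol_of_swap m l h, _,
    fun k => ⟨sg_compactSymbol m (l - k) (contDiff_comp_swap (contDiff_leadSeq l hf' k)),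
      evHomBi_of_homog (evHomE_compactSymbol_of_swap m _
        (f := fun q => leadSeq l (fun r => f r.swap) k q.swap) (h.leadSeq hf' k))
        (evHomPsi_compactSymbol_swap m l _ k)⟩, fun N => ?_⟩
  rw [compactSymbol_sub_sum_snd m l hf]
  exact sg_compactSymbol _ _ (contDiff_comp_swap (contDiff_remnSeq l hf' _))

/-- The class of compact symbols is closed under taking homogeneous terms and remainders in either
variable. The terms of one expansion are homogeneous in that variable, and expanding them in the
other variable preserves this, which gives the bi-homogeneous corner terms. -/
theorem sgCl_compactSymbol (m l : ℝ) {f : (E × ℝ) × (F × ℝ) → ℝ} (hf : ContDiff ℝ ∞ f) :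
    SGCl m l (compactSymbol m l f) := by
  have hf' := contDiff_comp_swap hf
  refine ⟨sg_compactSymbol m l hf, ⟨_, fun k => sgHomPsiClE_compactSymbol m (l - k)
    (contDiff_comp_swap (contDiff_leadSeq l hf' k)) (compHom_leadSeq_swap l _ k), fun N => ?_⟩,
    ⟨_, fun k => sgHomEClPsi_compactSymbol (m - k) l (contDiff_leadSeq m hf k)
      (compHom_leadSeq_swap m f k), fun N => ?_⟩⟩
  · rw [compactSymbol_sub_sum_snd m l hf]
    exact sgClE_compactSymbol _ _ (contDiff_comp_swap (contDiff_remnSeq l hf' _))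
  · rw [compactSymbol_sub_sum_fst m l hf]
    exact sgClPsi_compactSymbol _ _ (contDiff_remnSeq m hf _)

/-! ### Principal symbols -/

theorem tendsto_inv_mul_jap_smul {E : Type} [NormedAddCommGroup E] [NormedSpace ℝ E] (x : E) :
    Tendsto (fun s : ℝ => s⁻¹ * jap (s • x)) atTop (𝓝 ‖x‖) := by
  have h : Tendsto (fun s : ℝ => Real.sqrt ((s ^ 2)⁻¹ + ‖x‖ ^ 2)) atTop (𝓝 ‖x‖) := by
    have h0 : Tendsto (fun s : ℝ => (s ^ 2)⁻¹) atTop (𝓝 0) :=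
      (tendsto_pow_atTop two_ne_zero).inv_tendsto_atTop
    have := (h0.add_const (‖x‖ ^ 2)).sqrt
    simpa [Real.sqrt_sq (norm_nonneg x)] using this
  refine h.congr' ?_
  filter_upwards [eventually_gt_atTop 0] with s hs
  rw [jap, norm_smul, Real.norm_of_nonneg hs.le, ← Real.sqrt_sq (inv_nonneg.2 hs.le),
    ← Real.sqrt_mul (by positivity)]
  congr 1; field_simp

theorem tendsto_radComp_smul {E : Type} [NormedAddCommGroup E] [NormedSpace ℝ E] {x : E}
    (hx : x ≠ 0) : Tendsto (fun s : ℝ => radComp (s • x)) atTop (𝓝 (atInf x)) := by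
  have h := (tendsto_inv_mul_jap_smul x).inv₀ (norm_ne_zero_iff.2 hx)
  refine Tendsto.prodMk_nhds ?_ ?_
  · refine (h.smul_const x).congr' ?_
    filter_upwards [eventually_gt_atTop 0] with s hs
    simp [smul_smul]
  · have := h.mul (tendsto_inv_atTop_zero (𝕜 := ℝ))
    rw [mul_zero] at this
    refine this.congr' ?_
    filter_upwards [eventually_gt_atTop 0] with s hs
    have := jap_pos (s • x)
    field_simp

/-- As s → ∞, s⁻¹⟨s x⟩ tends to |x| and R(s x) to the point at infinity in the direction of x;
continuity of f does the rest. -/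
theorem isPrincipalSymbol_compactSymbol {f : (E × ℝ) × (F × ℝ) → ℝ} (hf : Continuous f) :
    IsPrincipalSymbol 1 1 (compactSymbol 1 1 f)
      (fun z => ‖z.1‖ * jap z.2 * f (projE z)) (fun z => jap z.1 * ‖z.2‖ * f (projPsi z))
      (fun z => ‖z.1‖ * ‖z.2‖ * f (projC z)) := by
  refine ⟨fun x ξ hx => ?_, fun x ξ hξ => ?_, fun x ξ hx hξ => ⟨?_, ?_⟩⟩
  · have h1 := (tendsto_inv_mul_jap_smul x).mul_const (jap ξ)
    have h2 := (hf.tendsto (atInf x, radComp ξ)).comp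
      ((tendsto_radComp_smul hx).prodMk_nhds tendsto_const_nhds)
    refine (h1.mul h2).congr fun s => ?_
    simp [compactSymbol, Real.rpow_neg_one, mul_assoc]
  · have h1 := (tendsto_inv_mul_jap_smul ξ).const_mul (jap x)
    have h2 := (hf.tendsto (radComp x, atInf ξ)).comp
      (tendsto_const_nhds.prodMk_nhds (tendsto_radComp_smul hξ))
    refine (h1.mul h2).congr fun s => ?_
    simp [compactSymbol, Real.rpow_neg_one]; ring
  · have h1 := (tendsto_inv_mul_jap_smul ξ).const_mul ‖x‖
    have h2 := (hf.tendsto (atInf x, atInf ξ)).comp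
      (tendsto_const_nhds.prodMk_nhds (tendsto_radComp_smul hξ))
    refine (h1.mul h2).congr fun s => ?_
    simp [projE, Real.rpow_neg_one]; ring
  · have h1 := (tendsto_inv_mul_jap_smul x).mul_const ‖ξ‖
    have h2 := (hf.tendsto (atInf x, atInf ξ)).comp
      ((tendsto_radComp_smul hx).prodMk_nhds tendsto_const_nhds)
    refine (h1.mul h2).congr fun s => ?_
    simp [projPsi, Real.rpow_neg_one]; ring

end Classical

/-! ### Linear symplectic algebra -/

/-- The standard symplectic form `∑ dξⱼ ∧ dxʲ` on `ℝⁿ × ℝⁿ`. -/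
def symp {n : ℕ} (v w : Eu n × Eu n) : ℝ := inner ℝ v.2 w.1 - inner ℝ v.1 w.2

/-- The coordinates of a point of `ℝⁿ × ℝⁿ`. -/
def sumCoord {n : ℕ} (v : Eu n × Eu n) : Fin n ⊕ Fin n → ℝ := Sum.elim v.1 v.2

/-- The standard basis of `ℝⁿ × ℝⁿ`. -/
def sumBasis {n : ℕ} : Fin n ⊕ Fin n → Eu n × Eu n :=
  Sum.elim (fun j => (EuclideanSpace.single j 1, 0)) fun j => (0, EuclideanSpace.single j 1)

theorem sum_sumCoord_smul {n : ℕ} (v : Eu n × Eu n) :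
    ∑ j, sumCoord v j • (sumBasis j : Eu n × Eu n) = v := by
  rw [Fintype.sum_sum_type]
  ext i
  · simp [sumCoord, sumBasis, Prod.fst_sum, Finset.sum_apply, Pi.single_apply]
  · simp [sumCoord, sumBasis, Prod.snd_sum, Finset.sum_apply, Pi.single_apply]

theorem dotProduct_J_mulVec {n : ℕ} (v w : Eu n × Eu n) :
    dotProduct (sumCoord v) ((Matrix.J (Fin n) ℝ).mulVec (sumCoord w)) = symp v w := by
  simp [Matrix.J, sumCoord, symp, Matrix.fromBlocks_mulVec, dotProduct, PiLp.inner_apply,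
    Matrix.neg_mulVec, Finset.sum_neg_distrib]
  simp [mul_comm]; ring

/-- The matrix of a linear map of `ℝⁿ × ℝⁿ`. -/
def sumMatrix {n : ℕ} (L : Eu n × Eu n →L[ℝ] Eu n × Eu n) :
    Matrix (Fin n ⊕ Fin n) (Fin n ⊕ Fin n) ℝ :=
  Matrix.of fun i j => sumCoord (L (sumBasis j)) i

theorem sumMatrix_mulVec {n : ℕ} (L : Eu n × Eu n →L[ℝ] Eu n × Eu n) (v : Eu n × Eu n) :
    (sumMatrix L).mulVec (sumCoord v) = sumCoord (L v) := by
  have hlin : ∀ i, sumCoord (L v) i = ∑ j, sumCoord v j * sumCoord (L (sumBasis j)) i := by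
    intro i
    conv_lhs => rw [← sum_sumCoord_smul v, map_sum]
    cases i <;> simp [sumCoord, Prod.fst_sum, Prod.snd_sum]
  ext i
  rw [hlin i]
  simp [Matrix.mulVec, dotProduct, sumMatrix, mul_comm]

/-- The Poisson bracket of two linear functionals. -/
theorem sumMatrix_mul_J_mul_transpose {n : ℕ} (L : Eu n × Eu n →L[ℝ] Eu n × Eu n)
    (a b : Fin n ⊕ Fin n) :
    (sumMatrix L * Matrix.J (Fin n) ℝ * (sumMatrix L).transpose) a b =
      ∑ j : Fin n, (sumMatrix L a (Sum.inr j) * sumMatrix L b (Sum.inl j) -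
        sumMatrix L a (Sum.inl j) * sumMatrix L b (Sum.inr j)) := by
  simp [Matrix.mul_apply, Fintype.sum_sum_type, Matrix.J, Matrix.one_apply,
    Finset.sum_sub_distrib]
  ring

/-- The hypothesis is A J Aᵀ = J, a statement on covectors. The symplectic group is closed under
transposition, so Aᵀ J A = J, the statement on vectors. -/
theorem symp_map_of_brackets {n : ℕ} (L : Eu n × Eu n →L[ℝ] Eu n × Eu n)
    (h : ∀ a b : Fin n ⊕ Fin n,
      ∑ j : Fin n, (sumMatrix L a (Sum.inr j) * sumMatrix L b (Sum.inl j) -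
        sumMatrix L a (Sum.inl j) * sumMatrix L b (Sum.inr j)) = Matrix.J (Fin n) ℝ a b)
    (v w : Eu n × Eu n) : symp (L v) (L w) = symp v w := by
  have hA : sumMatrix L ∈ Matrix.symplecticGroup (Fin n) ℝ := by
    rw [SymplecticGroup.mem_iff]
    ext a b
    rw [sumMatrix_mul_J_mul_transpose, h]
  rw [SymplecticGroup.mem_iff'] at hA
  have key : dotProduct ((sumMatrix L).mulVec (sumCoord v))
      ((Matrix.J (Fin n) ℝ).mulVec ((sumMatrix L).mulVec (sumCoord w))) =
        dotProduct (sumCoord v) (((sumMatrix L).transpose * Matrix.J (Fin n) ℝ *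
          sumMatrix L).mulVec (sumCoord w)) := by
    rw [← Matrix.mulVec_mulVec, ← Matrix.mulVec_mulVec, Matrix.dotProduct_mulVec (sumCoord v),
      Matrix.vecMul_transpose]
  rw [← dotProduct_J_mulVec, ← dotProduct_J_mulVec, ← sumMatrix_mulVec, ← sumMatrix_mulVec, key, hA]

/-- If the determinant vanished for all real τ, it would be the zero polynomial and vanish at τ = i.
The real and imaginary parts of a complex kernel vector of C + iD are then a non-zero pair excluded
by the hypothesis. -/
theorem exists_det_add_smul_ne_zero {n : ℕ} (C D : Matrix (Fin n) (Fin n) ℝ)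
    (h : ∀ v w : Fin n → ℝ, C.mulVec v = D.mulVec w → C.mulVec w = -D.mulVec v → v = 0 ∧ w = 0) :
    ∃ τ : ℝ, (C + τ • D).det ≠ 0 := by
  by_contra! hdet
  let P : Matrix (Fin n) (Fin n) (Polynomial ℝ) :=
    C.map Polynomial.C + (Polynomial.X : Polynomial ℝ) • D.map Polynomial.C
  have hev : ∀ {R : Type} [CommRing R] [Algebra ℝ R] (r : R), Polynomial.aeval r P.det =
      (C.map (algebraMap ℝ R) + r • D.map (algebraMap ℝ R)).det := by
    intro R _ _ r
    rw [AlgHom.map_det]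
    congr 1
    ext i j
    simp [P]
    ring
  have hP : P.det = 0 := by
    refine Polynomial.funext fun τ => ?_
    have := hev (R := ℝ) τ
    rw [Polynomial.coe_aeval_eq_eval] at this
    rw [this, Polynomial.eval_zero, ← hdet τ]
    congr 1
  have hI := hev (R := ℂ) Complex.I
  rw [hP, map_zero] at hI
  obtain ⟨v, hv0, hv⟩ := Matrix.exists_mulVec_eq_zero_iff.2 hI.symm
  have hre : ∀ i, C.mulVec (fun j => (v j).re) i = D.mulVec (fun j => (v j).im) i := by
    intro i
    have := congrArg Complex.re (congrFun hv i)
    simp [Matrix.mulVec, dotProduct, Complex.re_sum, add_mul, mul_assoc] at this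
    simp only [Matrix.mulVec, dotProduct]
    rw [Finset.sum_add_distrib] at this
    simp at this
    linarith
  have him : ∀ i, C.mulVec (fun j => (v j).im) i = -D.mulVec (fun j => (v j).re) i := by
    intro i
    have := congrArg Complex.im (congrFun hv i)
    simp [Matrix.mulVec, dotProduct, Complex.im_sum, add_mul, mul_assoc] at this
    simp only [Matrix.mulVec, dotProduct]
    rw [Finset.sum_add_distrib] at this
    linarith
  obtain ⟨h1, h2⟩ := h _ _ (funext hre) (funext him)
  exact hv0 (funext fun j => Complex.ext (congrFun h1 j) (congrFun h2 j))

/-- A symplectic map is transversal to the graph of almost every multiple of the identity. -/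
theorem exists_transversal {n : ℕ} {L : Eu n × Eu n →L[ℝ] Eu n × Eu n}
    (hL : ∀ v w, symp (L v) (L w) = symp v w) {a : ℝ} (ha : 0 < a) :
    ∃ τ : ℝ, ∀ v : Eu n, ∃ w : Eu n, a • (L (w, 0)).2 + τ • (L (0, w)).2 = v := by
  let S : Eu n →ₗ[ℝ] Eu n := a • (LinearMap.snd ℝ _ _ ∘ₗ L.toLinearMap ∘ₗ LinearMap.inl ℝ _ _)
  let T : Eu n →ₗ[ℝ] Eu n := LinearMap.snd ℝ _ _ ∘ₗ L.toLinearMap ∘ₗ LinearMap.inr ℝ _ _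
  let b := (EuclideanSpace.basisFun (Fin n) ℝ).toBasis
  let C := LinearMap.toMatrix b b S
  let D := LinearMap.toMatrix b b T
  have hmul : ∀ (A : Eu n →ₗ[ℝ] Eu n) (v : Eu n),
      (LinearMap.toMatrix b b A).mulVec (b.repr v) = b.repr (A v) := fun A v =>
    LinearMap.toMatrix_mulVec_repr b b A v
  obtain ⟨τ, hτ⟩ := exists_det_add_smul_ne_zero C D (by
    intro v w h1 h2
    obtain ⟨v, rfl⟩ : ∃ v' : Eu n, (b.repr v' : Fin n → ℝ) = v := ⟨WithLp.toLp 2 v, by ext i; simp [b]⟩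
    obtain ⟨w, rfl⟩ : ∃ v' : Eu n, (b.repr v' : Fin n → ℝ) = w := ⟨WithLp.toLp 2 w, by ext i; simp [b]⟩
    rw [hmul, hmul] at h1 h2
    have h1' : S v = T w := b.repr.injective (DFunLike.coe_injective h1)
    have h2' : S w = -T v := b.repr.injective (DFunLike.coe_injective (by
      rw [h2, map_neg]; rfl))
    -- L maps both (a v, -w) and (a w, v) into the Lagrangian subspace of vanishing second
    -- component, so the images pair to 0, whereas the vectors themselves pair to -a(‖v‖² + ‖w‖²).
    have e1 : (L (a • v, -w)).2 = 0 := by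
      have : ((a • v, -w) : Eu n × Eu n) = a • (v, 0) - (0, w) := by simp
      rw [this, map_sub, map_smul]
      simpa [S, T, sub_eq_zero] using h1'
    have e2 : (L (a • w, v)).2 = 0 := by
      have : ((a • w, v) : Eu n × Eu n) = a • (w, 0) + (0, v) := by simp
      rw [this, map_add, map_smul]
      simpa [S, T, eq_neg_iff_add_eq_zero] using h2'
    have h := hL (a • v, -w) (a • w, v)
    simp only [symp, e1, e2, inner_zero_left, inner_zero_right, inner_smul_left, inner_smul_right,
      inner_neg_left, real_inner_self_eq_norm_sq] at h
    simp at h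
    have hv : ‖v‖ = 0 := by
      have h0 : a * ‖v‖ ^ 2 = 0 := by
        nlinarith [mul_nonneg ha.le (sq_nonneg ‖v‖), mul_nonneg ha.le (sq_nonneg ‖w‖)]
      simpa [ha.ne'] using h0
    have hw : ‖w‖ = 0 := by
      have h0 : a * ‖w‖ ^ 2 = 0 := by
        nlinarith [mul_nonneg ha.le (sq_nonneg ‖v‖), mul_nonneg ha.le (sq_nonneg ‖w‖)]
      simpa [ha.ne'] using h0
    rw [norm_eq_zero.1 hv, norm_eq_zero.1 hw]
    simp)
  refine ⟨τ, fun v => ?_⟩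
  have hu : IsUnit (S + τ • T) := by
    have : LinearMap.toMatrix b b (S + τ • T) = C + τ • D := by simp [C, D]
    rw [← LinearMap.isUnit_toMatrix_iff b, this, Matrix.isUnit_iff_isUnit_det]
    exact hτ.isUnit
  have hs := ((Module.End.isUnit_iff _).1 hu).2
  obtain ⟨w, hw⟩ := hs v
  exact ⟨w, by simpa [S, T] using hw⟩

/-! ### Homogeneous maps, one-forms and symplectic maps -/

/-- Euler's identity. The factor 1 + k(t - 1) covers degree one (k = 1) and degree zero (k = 0)
together. -/
theorem fderiv_radial_fst {n : ℕ} {C : Eu n × Eu n → Eu n × Eu n} {z : Eu n × Eu n} {k : ℝ}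
    (hd : DifferentiableAt ℝ C z)
    (h : ∀ t : ℝ, 0 < t → C (t • z.1, z.2) = ((1 + k * (t - 1)) • (C z).1, (C z).2)) :
    fderiv ℝ C z (z.1, 0) = (k • (C z).1, 0) := by
  have h1 : HasDerivAt (fun t : ℝ => ((t • z.1, z.2) : Eu n × Eu n)) (z.1, 0) 1 := by
    simpa using ((hasDerivAt_id (1 : ℝ)).smul_const z.1).prodMk (hasDerivAt_const (1 : ℝ) z.2)
  have h2 : HasDerivAt (fun t : ℝ => C (t • z.1, z.2)) (fderiv ℝ C z (z.1, 0)) 1 := by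
    have hd' : HasFDerivAt C (fderiv ℝ C z) ((1 : ℝ) • z.1, z.2) := by
      simpa using hd.hasFDerivAt
    exact hd'.comp_hasDerivAt (1 : ℝ) h1
  have h4 : HasDerivAt (fun t : ℝ => 1 + k * (t - 1)) k 1 := by
    simpa using (((hasDerivAt_id (1 : ℝ)).sub_const 1).const_mul k).const_add 1
  have h3 : HasDerivAt (fun t : ℝ => ((1 + k * (t - 1)) • (C z).1, (C z).2)) (k • (C z).1, 0) 1 :=
    (h4.smul_const (C z).1).prodMk (hasDerivAt_const (1 : ℝ) (C z).2)
  refine h2.unique (h3.congr_of_eventuallyEq ?_)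
  filter_upwards [lt_mem_nhds (zero_lt_one (α := ℝ))] with t ht
  exact h t ht

theorem fderiv_radial_snd {n : ℕ} {C : Eu n × Eu n → Eu n × Eu n} {z : Eu n × Eu n}
    (hd : DifferentiableAt ℝ C z)
    (h : ∀ t : ℝ, 0 < t → C (z.1, t • z.2) = ((C z).1, t • (C z).2)) :
    fderiv ℝ C z (0, z.2) = (0, (C z).2) := by
  have h1 : HasDerivAt (fun t : ℝ => ((z.1, t • z.2) : Eu n × Eu n)) (0, z.2) 1 := by
    simpa using (hasDerivAt_const (1 : ℝ) z.1).prodMk ((hasDerivAt_id (1 : ℝ)).smul_const z.2)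
  have h2 : HasDerivAt (fun t : ℝ => C (z.1, t • z.2)) (fderiv ℝ C z (0, z.2)) 1 := by
    have hd' : HasFDerivAt C (fderiv ℝ C z) (z.1, (1 : ℝ) • z.2) := by
      simpa using hd.hasFDerivAt
    exact hd'.comp_hasDerivAt (1 : ℝ) h1
  have h3 : HasDerivAt (fun t : ℝ => ((C z).1, t • (C z).2)) (0, (C z).2) 1 := by
    simpa using (hasDerivAt_const (1 : ℝ) (C z).1).prodMk
      ((hasDerivAt_id (1 : ℝ)).smul_const (C z).2)
  refine h2.unique (h3.congr_of_eventuallyEq ?_)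
  filter_upwards [lt_mem_nhds (zero_lt_one (α := ℝ))] with t ht
  exact h t ht

/-- Insert the Euler field (x, 0), which is mapped to the Euler field of the target, into the
symplectic identity: a homogeneous symplectic map preserves the one-form ⟨x, dξ⟩. -/
theorem inner_fst_fderiv_snd {n : ℕ} {C : Eu n × Eu n → Eu n × Eu n} {S : Set (Eu n × Eu n)}
    (hC : IsSymplecticOn C S) {z : Eu n × Eu n} (hz : z ∈ S) (hd : DifferentiableAt ℝ C z)
    (h : ∀ t : ℝ, 0 < t → C (t • z.1, z.2) = (t • (C z).1, (C z).2)) (w : Eu n × Eu n) :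
    inner ℝ (C z).1 (fderiv ℝ C z w).2 = inner ℝ z.1 w.2 := by
  have h1 := hC z hz (z.1, 0) w
  rw [fderiv_radial_fst (k := 1) hd (by simpa using h)] at h1
  simpa using h1

theorem inner_snd_fderiv_fst {n : ℕ} {C : Eu n × Eu n → Eu n × Eu n} {S : Set (Eu n × Eu n)}
    (hC : IsSymplecticOn C S) {z : Eu n × Eu n} (hz : z ∈ S) (hd : DifferentiableAt ℝ C z)
    (h : ∀ t : ℝ, 0 < t → C (z.1, t • z.2) = ((C z).1, t • (C z).2)) (w : Eu n × Eu n) :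
    inner ℝ (C z).2 (fderiv ℝ C z w).1 = inner ℝ z.2 w.1 := by
  have h1 := hC z hz (0, z.2) w
  rw [fderiv_radial_snd hd h] at h1
  simpa using h1

/-- The symplectic form is an exterior derivative of ⟨x, dξ⟩ up to sign. Differentiating the
identity along w and antisymmetrising removes the second derivatives of C, which are symmetric. -/
theorem isSymplecticOn_of_one_form {n : ℕ} {C : Eu n × Eu n → Eu n × Eu n}
    {S : Set (Eu n × Eu n)} (hS : IsOpen S) (hC : ContDiffOn ℝ ∞ C S)
    (h : ∀ z ∈ S, ∀ v, inner ℝ (C z).1 (fderiv ℝ C z v).2 = inner ℝ z.1 v.2) :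
    IsSymplecticOn C S := by
  intro z hz v w
  have hCz : ContDiffAt ℝ ∞ C z := hC.contDiffAt (hS.mem_nhds hz)
  have hd : HasFDerivAt C (fderiv ℝ C z) z := (hCz.differentiableAt (by simp)).hasFDerivAt
  have hd2 : HasFDerivAt (fderiv ℝ C) (fderiv ℝ (fderiv ℝ C) z) z :=
    ((hCz.fderiv_right (m := 1) (by norm_cast)).differentiableAt (by simp)).hasFDerivAt
  have hsymm : ∀ v w, fderiv ℝ (fderiv ℝ C) z v w = fderiv ℝ (fderiv ℝ C) z w v :=
    (hCz.isSymmSndFDerivAt (by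
      simpa using (WithTop.coe_le_coe.2 le_top : ((2 : ℕ∞) : WithTop ℕ∞) ≤ ∞))).eq
  have key : ∀ v w : Eu n × Eu n, inner ℝ (fderiv ℝ C z w).1 (fderiv ℝ C z v).2 +
      inner ℝ (C z).1 (fderiv ℝ (fderiv ℝ C) z w v).2 = inner ℝ w.1 v.2 := by
    intro v w
    have e1 : HasFDerivAt (fun z' => (C z').1) _ z := hd.fst
    have e2 : HasFDerivAt (fun z' => (fderiv ℝ C z' v).2) _ z :=
      (hd2.clm_apply (hasFDerivAt_const v z)).snd
    have e3 := e1.inner ℝ e2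
    have e4 : HasFDerivAt (fun z' : Eu n × Eu n => inner ℝ z'.1 v.2) _ z :=
      (hasFDerivAt_fst).inner ℝ (hasFDerivAt_const v.2 z)
    have e5 : (fun z' : Eu n × Eu n => inner ℝ z'.1 v.2) =ᶠ[𝓝 z]
        fun z' => inner ℝ (C z').1 (fderiv ℝ C z' v).2 := by
      filter_upwards [hS.mem_nhds hz] with z' hz'
      exact (h z' hz' v).symm
    have e6 := DFunLike.congr_fun (e3.unique (e4.congr_of_eventuallyEq e5.symm)) w
    simp [fderivInnerCLM_apply] at e6
    linarith
  have h1 := key v w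
  have h2 := key w v
  rw [hsymm w v] at h1
  have c1 := real_inner_comm (fderiv ℝ C z w).1 (fderiv ℝ C z v).2
  have c2 := real_inner_comm v.2 w.1
  linarith

/-- The symplectic extension of a contact map, homogeneous in the first variable. -/
theorem exists_symplectic_of_contact {n : ℕ} {K : Eu n × Eu n → Eu n × Eu n}
    {S : Set (Eu n × Eu n)} (hS : IsOpen S) (hK : ContDiffOn ℝ ∞ K S) (h0 : ∀ z ∈ S, z.1 ≠ 0)
    (hcone : ∀ z ∈ S, ∀ t : ℝ, 0 < t → (t • z.1, z.2) ∈ S)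
    (hhom : ∀ z ∈ S, ∀ t : ℝ, 0 < t → K (t • z.1, z.2) = K z)
    (hcont : ∀ z ∈ S, ‖z.1‖ = 1 → ∃ g : ℝ, 0 < g ∧ ∀ v : Eu n × Eu n, inner ℝ z.1 v.1 = 0 →
      inner ℝ (K z).1 (fderiv ℝ K z v).2 = g * inner ℝ z.1 v.2) :
    ∃ a : Eu n × Eu n → ℝ, ContDiffOn ℝ ∞ a S ∧ (∀ z ∈ S, 0 < a z) ∧
      (∀ z ∈ S, ∀ t : ℝ, 0 < t → a (t • z.1, z.2) = t * a z) ∧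
      IsSymplecticOn (fun z => (a z • (K z).1, (K z).2)) S := by
  have hKd : ∀ z ∈ S, DifferentiableAt ℝ K z := fun z hz =>
    (hK.contDiffAt (hS.mem_nhds hz)).differentiableAt (by simp)
  have hscale : ∀ z ∈ S, ∀ t : ℝ, 0 < t → ∀ v : Eu n × Eu n,
      fderiv ℝ K (t • z.1, z.2) (t • v.1, v.2) = fderiv ℝ K z v := by
    intro z hz t ht v
    let δ : Eu n × Eu n →L[ℝ] Eu n × Eu n :=
      (t • ContinuousLinearMap.fst ℝ _ _).prod (ContinuousLinearMap.snd ℝ _ _)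
    have h1 : HasFDerivAt (K ∘ δ) ((fderiv ℝ K (δ z)).comp δ) z :=
      ((hKd _ (hcone z hz t ht)).hasFDerivAt).comp z δ.hasFDerivAt
    have h2 : K =ᶠ[𝓝 z] K ∘ δ := by
      filter_upwards [hS.mem_nhds hz] with y hy
      exact (hhom y hy t ht).symm
    have h3 := (h1.congr_of_eventuallyEq h2).fderiv
    rw [h3]
    rfl
  -- Evaluating the contact identity on the vector (0, x) recovers the conformal factor by a formula
  -- that is evidently smooth.
  let g : Eu n × Eu n → ℝ := fun z => ‖z.1‖⁻¹ * inner ℝ (K z).1 (fderiv ℝ K z (0, z.1)).2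
  have hg : ∀ z ∈ S, 0 < g z ∧ ∀ v : Eu n × Eu n,
      inner ℝ (K z).1 (fderiv ℝ K z v).2 = g z * ‖z.1‖⁻¹ * inner ℝ z.1 v.2 := by
    intro z hz
    have hn : 0 < ‖z.1‖ := norm_pos_iff.2 (h0 z hz)
    have hz1 := hcone z hz _ (inv_pos.2 hn)
    have hu : ‖(‖z.1‖⁻¹ • z.1, z.2).1‖ = 1 := norm_smul_inv_norm (𝕜 := ℝ) (h0 z hz)
    obtain ⟨g0, hg0, hc⟩ := hcont _ hz1 hu
    -- The derivative of K kills the radial direction, so the contact identity, assumed only for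
    -- vectors tangent to the sphere, extends to all vectors.
    have hrad := fderiv_radial_fst (k := 0) (hKd _ hz1) (by
      intro t ht
      have := hhom _ hz1 t ht
      simpa using this)
    have e1 : ∀ v : Eu n × Eu n,
        inner ℝ (K z).1 (fderiv ℝ K z v).2 = g0 * ‖z.1‖⁻¹ * inner ℝ z.1 v.2 := by
      intro v
      rw [← hscale z hz _ (inv_pos.2 hn) v, ← hhom z hz _ (inv_pos.2 hn)]
      set x := ‖z.1‖⁻¹ • z.1 with hx
      set c := inner ℝ x (‖z.1‖⁻¹ • v.1) with hcdef
      have e2 : ((‖z.1‖⁻¹ • v.1, v.2) : Eu n × Eu n) =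
          c • (x, 0) + (‖z.1‖⁻¹ • v.1 - c • x, v.2) := by simp
      have e3 := hc (‖z.1‖⁻¹ • v.1 - c • x, v.2) (by
        change inner ℝ x (‖z.1‖⁻¹ • v.1 - c • x) = 0
        rw [inner_sub_right, ← hcdef, inner_smul_right, real_inner_self_eq_norm_sq,
          show ‖x‖ = 1 from hu]
        ring)
      rw [e2, map_add, map_smul, hrad]
      simp only [zero_smul, Prod.smul_mk, smul_zero, Prod.snd_add, zero_add]
      rw [e3, hx, inner_smul_left]
      simp
      ring
    have e4 : g z = g0 := by
      simp only [g, e1, real_inner_self_eq_norm_sq]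
      field_simp
    rw [e4]
    exact ⟨hg0, e1⟩
  have hfst : ContDiffOn ℝ ∞ (fun z : Eu n × Eu n => z.1) S := contDiffOn_fst
  have hnorm : ContDiffOn ℝ ∞ (fun z : Eu n × Eu n => ‖z.1‖) S := hfst.norm ℝ h0
  have hgs : ContDiffOn ℝ ∞ g S := by
    refine (hnorm.inv fun z hz => norm_ne_zero_iff.2 (h0 z hz)).mul (ContDiffOn.inner ℝ hK.fst ?_)
    exact ((hK.fderiv_of_isOpen hS (by simp)).clm_apply (contDiffOn_const.prodMk hfst)).snd
  -- Since ⟨K₁, dK₂⟩ = (g/|x|)⟨x, dξ⟩, multiplying K₁ by |x|/g yields a map that preserves ⟨x, dξ⟩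
  -- exactly.
  have has : ContDiffOn ℝ ∞ (fun z => ‖z.1‖ / g z) S := hnorm.div hgs fun z hz => (hg z hz).1.ne'
  refine ⟨fun z => ‖z.1‖ / g z, has, fun z hz =>
    div_pos (norm_pos_iff.2 (h0 z hz)) (hg z hz).1, fun z hz t ht => ?_, ?_⟩
  · have e : g (t • z.1, z.2) = g z := by
      simp only [g]
      have h1 := hscale z hz t ht (0, t • z.1)
      rw [smul_zero] at h1
      rw [hhom z hz t ht, h1, show ((0, t • z.1) : Eu n × Eu n) = t • (0, z.1) by simp, map_smul,
        Prod.smul_snd, inner_smul_right, norm_smul, Real.norm_of_nonneg ht.le]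
      field_simp
    simp only [e, norm_smul, Real.norm_of_nonneg ht.le]
    ring
  · refine isSymplecticOn_of_one_form hS ((has.smul hK.fst).prodMk hK.snd) fun z hz v => ?_
    have hd : HasFDerivAt (fun z => ((‖z.1‖ / g z) • (K z).1, (K z).2)) _ z :=
      ((((has.smul hK.fst).contDiffAt (hS.mem_nhds hz)).differentiableAt
        (by simp)).hasFDerivAt).prodMk ((hKd z hz).hasFDerivAt.snd)
    rw [hd.fderiv]
    simp only [ContinuousLinearMap.prod_apply, ContinuousLinearMap.comp_apply,
      ContinuousLinearMap.coe_snd', inner_smul_left, (hg z hz).2]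
    have := (hg z hz).1.ne'
    have := norm_ne_zero_iff.2 (h0 z hz)
    simp
    field_simp

/-! ### Smooth functions on the boundary extend to the ambient space -/

theorem isClosed_facePsi (E F : Type) [NormedAddCommGroup E] [NormedAddCommGroup F] :
    IsClosed (facePsi E F) := by
  have h1 : IsClosed (hemi E) := (isClosed_eq (by fun_prop) continuous_const).inter
    (isClosed_le continuous_const continuous_snd)
  have h2 : IsClosed (hemi F) := (isClosed_eq (by fun_prop) continuous_const).inter
    (isClosed_le continuous_const continuous_snd)
  exact (h1.preimage continuous_fst).inter ((h2.preimage continuous_snd).inter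
    (isClosed_eq (by fun_prop) continuous_const))

theorem isClosed_faceE (E F : Type) [NormedAddCommGroup E] [NormedAddCommGroup F] :
    IsClosed (faceE E F) := by
  have h1 : IsClosed (hemi E) := (isClosed_eq (by fun_prop) continuous_const).inter
    (isClosed_le continuous_const continuous_snd)
  have h2 : IsClosed (hemi F) := (isClosed_eq (by fun_prop) continuous_const).inter
    (isClosed_le continuous_const continuous_snd)
  exact (h1.preimage continuous_fst).inter ((h2.preimage continuous_snd).inter
    (isClosed_eq (by fun_prop) continuous_const))

/-- Near the corner the extension is G₁∘r₁ + G₂∘r₂ - G₁∘r₃, where r₁, r₂, r₃ flatten onto the first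
sphere at infinity, the second one, and both. On the exit face r₁ is the identity and r₃ = r₂, so
the last two terms cancel, because G₁ and G₂ agree on the corner; the ψ-face is similar. -/
theorem smoothOn_of_faces {E F G : Type} [NormedAddCommGroup E] [InnerProductSpace ℝ E]
    [NormedAddCommGroup F] [InnerProductSpace ℝ F] [NormedAddCommGroup G] [NormedSpace ℝ G]
    {V : (E × ℝ) × (F × ℝ) → G} {U : Set ((E × ℝ) × (F × ℝ))} (hU : IsRelOpen U (bdry E F))
    (h1 : SmoothOn V (U ∩ faceE E F)) (h2 : SmoothOn V (U ∩ facePsi E F)) : SmoothOn V U := by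
  obtain ⟨OU, hOU, rfl⟩ := hU
  intro p hp
  by_cases hψ : p ∈ facePsi E F
  swap
  · have he : p ∈ faceE E F := hp.2.resolve_right hψ
    obtain ⟨O, G, hO, hpO, hG, hVG⟩ := h1 p ⟨hp, he⟩
    refine ⟨O ∩ (facePsi E F)ᶜ, G, hO.inter (isClosed_facePsi E F).isOpen_compl, ⟨hpO, hψ⟩,
      hG.mono inter_subset_left, fun q hq => hVG ⟨hq.1.1, hq.2, hq.2.2.resolve_right hq.1.2⟩⟩
  by_cases he : p ∈ faceE E F
  swap
  · obtain ⟨O, G, hO, hpO, hG, hVG⟩ := h2 p ⟨hp, hψ⟩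
    refine ⟨O ∩ (faceE E F)ᶜ, G, hO.inter (isClosed_faceE E F).isOpen_compl, ⟨hpO, he⟩,
      hG.mono inter_subset_left, fun q hq => hVG ⟨hq.1.1, hq.2, hq.2.2.resolve_left hq.1.2⟩⟩
  obtain ⟨O1, G1, hO1, hpO1, hG1, hV1⟩ := h1 p ⟨hp, he⟩
  obtain ⟨O2, G2, hO2, hpO2, hG2, hV2⟩ := h2 p ⟨hp, hψ⟩
  let r1 : (E × ℝ) × (F × ℝ) → (E × ℝ) × (F × ℝ) := fun q => ((‖q.1.1‖⁻¹ • q.1.1, 0), q.2)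
  let r2 : (E × ℝ) × (F × ℝ) → (E × ℝ) × (F × ℝ) := fun q => (q.1, (‖q.2.1‖⁻¹ • q.2.1, 0))
  let r3 : (E × ℝ) × (F × ℝ) → (E × ℝ) × (F × ℝ) := fun q =>
    ((‖q.1.1‖⁻¹ • q.1.1, 0), (‖q.2.1‖⁻¹ • q.2.1, 0))
  let W : Set ((E × ℝ) × (F × ℝ)) := {q | q.1.1 ≠ 0} ∩ {q | q.2.1 ≠ 0}
  have hW : IsOpen W := (isOpen_ne_fun (by fun_prop) continuous_const).inter
    (isOpen_ne_fun (by fun_prop) continuous_const)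
  have ha : ContDiffOn ℝ ∞ (fun q : (E × ℝ) × (F × ℝ) => ‖q.1.1‖⁻¹ • q.1.1) W := by
    have h : ContDiffOn ℝ ∞ (fun q : (E × ℝ) × (F × ℝ) => q.1.1) W := by fun_prop
    exact ((h.norm ℝ fun q hq => hq.1).inv fun q hq => norm_ne_zero_iff.2 hq.1).smul h
  have hb : ContDiffOn ℝ ∞ (fun q : (E × ℝ) × (F × ℝ) => ‖q.2.1‖⁻¹ • q.2.1) W := by
    have h : ContDiffOn ℝ ∞ (fun q : (E × ℝ) × (F × ℝ) => q.2.1) W := by fun_prop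
    exact ((h.norm ℝ fun q hq => hq.2).inv fun q hq => norm_ne_zero_iff.2 hq.2).smul h
  have hr1 : ContDiffOn ℝ ∞ r1 W := (ha.prodMk contDiffOn_const).prodMk contDiffOn_snd
  have hr2 : ContDiffOn ℝ ∞ r2 W := contDiffOn_fst.prodMk (hb.prodMk contDiffOn_const)
  have hr3 : ContDiffOn ℝ ∞ r3 W :=
    (ha.prodMk contDiffOn_const).prodMk (hb.prodMk contDiffOn_const)
  have n1 : ∀ q ∈ faceE E F, ‖q.1.1‖ = 1 := fun q hq => by
    have := hq.1.1
    rw [hq.2.2] at this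
    have h0 := norm_nonneg q.1.1
    nlinarith
  have n2 : ∀ q ∈ facePsi E F, ‖q.2.1‖ = 1 := fun q hq => by
    have := hq.2.1.1
    rw [hq.2.2] at this
    have h0 := norm_nonneg q.2.1
    nlinarith
  have f1 : ∀ q ∈ faceE E F, r1 q = q := fun q hq => by
    refine Prod.ext (Prod.ext ?_ ?_) rfl
    · simp [r1, n1 q hq]
    · simp [r1, hq.2.2]
  have f2 : ∀ q ∈ facePsi E F, r2 q = q := fun q hq => by
    refine Prod.ext rfl (Prod.ext ?_ ?_)
    · simp [r2, n2 q hq]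
    · simp [r2, hq.2.2]
  have f3 : ∀ q ∈ W, r3 q ∈ faceE E F ∩ facePsi E F := fun q hq => by
    have e1 : ‖‖q.1.1‖⁻¹ • q.1.1‖ = 1 := norm_smul_inv_norm (𝕜 := ℝ) hq.1
    have e2 : ‖‖q.2.1‖⁻¹ • q.2.1‖ = 1 := norm_smul_inv_norm (𝕜 := ℝ) hq.2
    have e3 : (r3 q).1 ∈ hemi E := ⟨by simp [r3, e1], le_refl _⟩
    have e4 : (r3 q).2 ∈ hemi F := ⟨by simp [r3, e2], le_refl _⟩
    exact ⟨⟨e3, e4, rfl⟩, ⟨e3, e4, rfl⟩⟩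
  have g1 : ∀ q ∈ facePsi E F, r3 q = r1 q := fun q hq => congrArg r1 (f2 q hq)
  have g2 : ∀ q ∈ faceE E F, r3 q = r2 q := fun q hq => congrArg r2 (f1 q hq)
  have hpW : p ∈ W := ⟨norm_ne_zero_iff.1 (by rw [n1 p he]; exact one_ne_zero),
    norm_ne_zero_iff.1 (by rw [n2 p hψ]; exact one_ne_zero)⟩
  have p3 : r3 p = p := (g1 p hψ).trans (f1 p he)
  refine ⟨(W ∩ r1 ⁻¹' O1) ∩ (W ∩ r2 ⁻¹' O2) ∩ (W ∩ r3 ⁻¹' (O1 ∩ O2 ∩ OU)),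
    fun q => G1 (r1 q) + G2 (r2 q) - G1 (r3 q), ?_, ?_, ?_, ?_⟩
  · exact ((hr1.continuousOn.isOpen_inter_preimage hW hO1).inter
      (hr2.continuousOn.isOpen_inter_preimage hW hO2)).inter
      (hr3.continuousOn.isOpen_inter_preimage hW ((hO1.inter hO2).inter hOU))
  · refine ⟨⟨⟨hpW, ?_⟩, ⟨hpW, ?_⟩⟩, ⟨hpW, ?_⟩⟩
    · rwa [mem_preimage, f1 p he]
    · rwa [mem_preimage, f2 p hψ]
    · rw [mem_preimage, p3]; exact ⟨⟨hpO1, hpO2⟩, hp.1⟩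
  · refine ((hG1.comp (hr1.mono fun q hq => hq.2.1) fun q hq => hq.1.1.2).add
      (hG2.comp (hr2.mono fun q hq => hq.2.1) fun q hq => hq.1.2.2)).sub
      (hG1.comp (hr3.mono fun q hq => hq.2.1) fun q hq => hq.2.2.1.1)
  · rintro q ⟨⟨⟨hq1, hq2⟩, hq3⟩, hq4⟩
    have hc := f3 q hq1.1
    have e1 : V (r3 q) = G1 (r3 q) := hV1 ⟨hq3.2.1.1, ⟨hq3.2.2, Or.inl hc.1⟩, hc.1⟩
    have e2 : V (r3 q) = G2 (r3 q) := hV2 ⟨hq3.2.1.2, ⟨hq3.2.2, Or.inl hc.1⟩, hc.2⟩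
    rcases hq4.2 with hq5 | hq5
    · have e3 : V q = G1 q := hV1 ⟨by have := hq1.2; rwa [mem_preimage, f1 q hq5] at this, hq4, hq5⟩
      show V q = G1 (r1 q) + G2 (r2 q) - G1 (r3 q)
      rw [f1 q hq5, ← g2 q hq5, ← e1, ← e2, e3]; simp
    · have e3 : V q = G2 q := hV2 ⟨by have := hq2.2; rwa [mem_preimage, f2 q hq5] at this, hq4, hq5⟩
      show V q = G1 (r1 q) + G2 (r2 q) - G1 (r3 q)
      rw [f2 q hq5, ← g1 q hq5, e3]; simp

/-! ### A uniform description of the three boundary faces -/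

section Uniform

variable {E F : Type} [NormedAddCommGroup E] [InnerProductSpace ℝ E] [NormedAddCommGroup F]
  [InnerProductSpace ℝ F]

/-- The Euclidean norm of `(x, c) ∈ E × ℝ`. -/
def nn (q : E × ℝ) : ℝ := Real.sqrt (‖q.1‖ ^ 2 + q.2 ^ 2)

/-- Projection to the unit sphere of `E × ℝ`. -/
def un (q : E × ℝ) : E × ℝ := (nn q)⁻¹ • q

/-- Projection to the product of the unit spheres. -/
def un2 (q : (E × ℝ) × (F × ℝ)) : (E × ℝ) × (F × ℝ) := (un q.1, un q.2)

/-- The lift of `(x, ξ)` to heights `c₁`, `c₂`. -/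
def lft (c₁ c₂ : ℝ) (z : E × F) : (E × ℝ) × (F × ℝ) := ((z.1, c₁), (z.2, c₂))

/-- The common form of `coneE` (`c = (0, 1)`), `conePsi` (`c = (1, 0)`) and `coneC`
(`c = (0, 0)`). -/
def gcone (c₁ c₂ : ℝ) (U : Set ((E × ℝ) × (F × ℝ))) : Set (E × F) :=
  {z | 0 < nn (z.1, c₁) ∧ 0 < nn (z.2, c₂) ∧ un2 (lft c₁ c₂ z) ∈ U}

theorem nn_sq (q : E × ℝ) : nn q ^ 2 = ‖q.1‖ ^ 2 + q.2 ^ 2 := Real.sq_sqrt (by positivity)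

theorem nn_nonneg (q : E × ℝ) : 0 ≤ nn q := Real.sqrt_nonneg _

theorem nn_smul {s : ℝ} (hs : 0 ≤ s) (q : E × ℝ) : nn (s • q) = s * nn q := by
  rw [nn, nn, ← Real.sqrt_sq hs, ← Real.sqrt_mul (by positivity), Real.sqrt_sq hs]
  congr 1
  simp [norm_smul, abs_of_nonneg hs]
  ring

theorem nn_zero_right (x : E) : nn (x, 0) = ‖x‖ := by simp [nn]

theorem nn_one_right (x : E) : nn (x, 1) = jap x := by simp [nn, jap, add_comm]

theorem continuous_nn : Continuous (nn : E × ℝ → ℝ) := by unfold nn; fun_prop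

theorem nn_un {q : E × ℝ} (hq : 0 < nn q) : nn (un q) = 1 := by
  rw [un, nn_smul (inv_nonneg.2 hq.le), inv_mul_cancel₀ hq.ne']

theorem un_smul {s : ℝ} (hs : 0 < s) (q : E × ℝ) : un (s • q) = un q := by
  rw [un, un, nn_smul hs.le, smul_smul, mul_inv, mul_assoc, mul_comm, mul_assoc,
    mul_inv_cancel₀ hs.ne', mul_one]

theorem un_eq_self {q : E × ℝ} (hq : nn q = 1) : un q = q := by rw [un, hq]; simp

theorem contDiffAt_nn {q : E × ℝ} (hq : 0 < nn q) : ContDiffAt ℝ ∞ (nn : E × ℝ → ℝ) q := by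
  refine ContDiffAt.sqrt ?_ (by rw [← nn_sq]; positivity)
  exact ((contDiff_fst.norm_sq ℝ).add (contDiff_snd.pow 2)).contDiffAt

theorem contDiffAt_nn_comp {P : Type} [NormedAddCommGroup P] [NormedSpace ℝ P] {f : P → E × ℝ}
    {p : P} (hf : ContDiffAt ℝ ∞ f p) (hp : 0 < nn (f p)) :
    ContDiffAt ℝ ∞ (fun p => nn (f p)) p :=
  (contDiffAt_nn hp).comp p hf

theorem contDiffAt_un {q : E × ℝ} (hq : 0 < nn q) : ContDiffAt ℝ ∞ (un : E × ℝ → E × ℝ) q :=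
  ((contDiffAt_nn hq).inv hq.ne').smul contDiffAt_id

theorem contDiffAt_un2 {q : (E × ℝ) × (F × ℝ)} (h1 : 0 < nn q.1) (h2 : 0 < nn q.2) :
    ContDiffAt ℝ ∞ (un2 : (E × ℝ) × (F × ℝ) → (E × ℝ) × (F × ℝ)) q :=
  ((contDiffAt_un h1).comp q contDiffAt_fst).prodMk ((contDiffAt_un h2).comp q contDiffAt_snd)

theorem un_zero_right (x : E) : un (x, 0) = atInf x := by
  simp [un, nn_zero_right, atInf]

theorem un_one_right (x : E) : un (x, 1) = radComp x := by
  simp [un, nn_one_right, radComp]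

theorem un2_lft_E (z : E × F) : un2 (lft 0 1 z) = projE z := by
  simp [un2, lft, un_zero_right, un_one_right, projE]

theorem un2_lft_Psi (z : E × F) : un2 (lft 1 0 z) = projPsi z := by
  simp [un2, lft, un_zero_right, un_one_right, projPsi]

theorem un2_lft_C (z : E × F) : un2 (lft 0 0 z) = projC z := by
  simp [un2, lft, un_zero_right, projC]

theorem coneE_eq_gcone (U : Set ((E × ℝ) × (F × ℝ))) : coneE U = gcone 0 1 U := by
  ext z
  simp [coneE, gcone, un2_lft_E, nn_zero_right, nn_one_right, jap_pos]

theorem conePsi_eq_gcone (U : Set ((E × ℝ) × (F × ℝ))) : conePsi U = gcone 1 0 U := by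
  ext z
  simp [conePsi, gcone, un2_lft_Psi, nn_zero_right, nn_one_right, jap_pos]

theorem coneC_eq_gcone (U : Set ((E × ℝ) × (F × ℝ))) : coneC U = gcone 0 0 U := by
  ext z
  simp [coneC, gcone, un2_lft_C, nn_zero_right]

theorem un_mem_hemi {q : E × ℝ} (hq : 0 < nn q) (h0 : 0 ≤ q.2) : un q ∈ hemi E := by
  refine ⟨?_, mul_nonneg (inv_nonneg.2 hq.le) h0⟩
  rw [← nn_sq, nn_un hq, one_pow]

theorem nn_of_mem_hemi {q : E × ℝ} (hq : q ∈ hemi E) : nn q = 1 := by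
  rw [nn, hq.1, Real.sqrt_one]

theorem un2_mem_faceE {q : (E × ℝ) × (F × ℝ)} (h1 : 0 < nn q.1) (h2 : 0 < nn q.2)
    (hq1 : q.1.2 = 0) (hq2 : 0 ≤ q.2.2) : un2 q ∈ faceE E F :=
  ⟨un_mem_hemi h1 hq1.ge, un_mem_hemi h2 hq2, by simp [un2, un, hq1]⟩

theorem un2_mem_facePsi {q : (E × ℝ) × (F × ℝ)} (h1 : 0 < nn q.1) (h2 : 0 < nn q.2)
    (hq1 : 0 ≤ q.1.2) (hq2 : q.2.2 = 0) : un2 q ∈ facePsi E F :=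
  ⟨un_mem_hemi h1 hq1, un_mem_hemi h2 hq2.ge, by simp [un2, un, hq2]⟩

theorem un2_mem_bdry {q : (E × ℝ) × (F × ℝ)} (h1 : 0 < nn q.1) (h2 : 0 < nn q.2)
    (hq1 : 0 ≤ q.1.2) (hq2 : 0 ≤ q.2.2) (h : q.1.2 = 0 ∨ q.2.2 = 0) : un2 q ∈ bdry E F :=
  h.elim (fun h => Or.inl (un2_mem_faceE h1 h2 h hq2)) fun h => Or.inr (un2_mem_facePsi h1 h2 hq1 h)

theorem mem_hemi_of_mem_bdry {p : (E × ℝ) × (F × ℝ)} (hp : p ∈ bdry E F) :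
    p.1 ∈ hemi E ∧ p.2 ∈ hemi F :=
  hp.elim (fun h => ⟨h.1, h.2.1⟩) fun h => ⟨h.1, h.2.1⟩

/-- A pair of heights belonging to one of the three kinds of boundary points. -/
def IsHeights (c₁ c₂ : ℝ) : Prop := 0 ≤ c₁ ∧ 0 ≤ c₂ ∧ (c₁ = 0 ∨ c₂ = 0)

theorem IsHeights.mem_bdry {c₁ c₂ : ℝ} (hc : IsHeights c₁ c₂) {z : E × F}
    (h1 : 0 < nn (z.1, c₁)) (h2 : 0 < nn (z.2, c₂)) : un2 (lft c₁ c₂ z) ∈ bdry E F :=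
  un2_mem_bdry h1 h2 hc.1 hc.2.1 hc.2.2

/-- The open subset of `(E × ℝ) × (F × ℝ)` over a set of directions. -/
def coneOver (O : Set ((E × ℝ) × (F × ℝ))) : Set ((E × ℝ) × (F × ℝ)) :=
  {q | 0 < nn q.1 ∧ 0 < nn q.2 ∧ un2 q ∈ O}

theorem isOpen_coneOver {O : Set ((E × ℝ) × (F × ℝ))} (hO : IsOpen O) : IsOpen (coneOver O) := by
  have hW : IsOpen {q : (E × ℝ) × (F × ℝ) | 0 < nn q.1 ∧ 0 < nn q.2} :=
    (isOpen_lt continuous_const (continuous_nn.comp continuous_fst)).inter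
      (isOpen_lt continuous_const (continuous_nn.comp continuous_snd))
  have hc : ContinuousOn (un2 : (E × ℝ) × (F × ℝ) → _) {q | 0 < nn q.1 ∧ 0 < nn q.2} :=
    fun q hq => (contDiffAt_un2 hq.1 hq.2).continuousAt.continuousWithinAt
  convert hc.isOpen_inter_preimage hW hO using 1
  ext q
  simp [coneOver, and_assoc]

theorem contDiff_lft (c₁ c₂ : ℝ) : ContDiff ℝ ∞ (lft c₁ c₂ : E × F → (E × ℝ) × (F × ℝ)) := by
  unfold lft; fun_prop

theorem gcone_eq_preimage {c₁ c₂ : ℝ} (hc : IsHeights c₁ c₂) (O : Set ((E × ℝ) × (F × ℝ))) :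
    gcone c₁ c₂ (O ∩ bdry E F) = lft c₁ c₂ ⁻¹' coneOver O := by
  ext z
  simp only [gcone, coneOver, mem_ofPred_eq, mem_preimage]
  exact ⟨fun h => ⟨h.1, h.2.1, h.2.2.1⟩, fun h => ⟨h.1, h.2.1, h.2.2, hc.mem_bdry h.1 h.2.1⟩⟩

theorem isOpen_gcone {c₁ c₂ : ℝ} (hc : IsHeights c₁ c₂) {U : Set ((E × ℝ) × (F × ℝ))}
    (hU : IsRelOpen U (bdry E F)) : IsOpen (gcone c₁ c₂ U) := by
  obtain ⟨O, hO, rfl⟩ := hU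
  rw [gcone_eq_preimage hc]
  exact (isOpen_coneOver hO).preimage (contDiff_lft c₁ c₂).continuous

/-- A smooth function on the boundary extends to a conic neighbourhood, as a function homogeneous
of degree `0`. -/
theorem exists_hat {G : Type} [NormedAddCommGroup G] [NormedSpace ℝ G]
    {U : Set ((E × ℝ) × (F × ℝ))} (hU : IsRelOpen U (bdry E F)) {V : (E × ℝ) × (F × ℝ) → G}
    (hV : SmoothOn V U) {p : (E × ℝ) × (F × ℝ)} (hp : p ∈ U) :
    ∃ (O : Set ((E × ℝ) × (F × ℝ))) (Vh : (E × ℝ) × (F × ℝ) → G), IsOpen O ∧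
      ContDiffOn ℝ ∞ Vh O ∧ (∀ s t : ℝ, 0 < s → 0 < t → (s • p.1, t • p.2) ∈ O) ∧
      (∀ q ∈ O, 0 < nn q.1 ∧ 0 < nn q.2) ∧
      ∀ q ∈ O, 0 ≤ q.1.2 → 0 ≤ q.2.2 → (q.1.2 = 0 ∨ q.2.2 = 0) →
        un2 q ∈ U ∧ Vh q = V (un2 q) := by
  obtain ⟨OU, hOU, rfl⟩ := hU
  obtain ⟨O, G, hO, hpO, hG, hVG⟩ := hV p hp
  -- The local ambient extension is made constant along rays of both factors.
  refine ⟨coneOver (O ∩ OU), fun q => G (un2 q), isOpen_coneOver (hO.inter hOU), ?_, ?_,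
    fun q hq => ⟨hq.1, hq.2.1⟩, ?_⟩
  · exact hG.comp (fun q hq => (contDiffAt_un2 hq.1 hq.2.1).contDiffWithinAt)
      fun q hq => hq.2.2.1
  · intro s t hs ht
    have h1 := nn_of_mem_hemi (mem_hemi_of_mem_bdry hp.2).1
    have h2 := nn_of_mem_hemi (mem_hemi_of_mem_bdry hp.2).2
    refine ⟨?_, ?_, ?_⟩
    · rw [nn_smul hs.le, h1, mul_one]; exact hs
    · rw [nn_smul ht.le, h2, mul_one]; exact ht
    · have : un2 (s • p.1, t • p.2) = p := by
        simp only [un2, un_smul hs, un_smul ht, un_eq_self h1, un_eq_self h2]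
      rw [this]; exact ⟨hpO, hp.1⟩
  · intro q hq h1 h2 h3
    have hm : un2 q ∈ OU ∩ bdry E F := ⟨hq.2.2.2, un2_mem_bdry hq.1 hq.2.1 h1 h2 h3⟩
    exact ⟨hm, (hVG ⟨hq.2.2.1, hm⟩).symm⟩

end Uniform

/-- The map `(x, ξ) ↦ (|(x, c₁)| Y, |(ξ, c₂)| Z)`. -/
def gmap {n : ℕ} (Y Z : Amb n → Eu n) (c₁ c₂ : ℝ) (z : Eu n × Eu n) : Eu n × Eu n :=
  (nn (z.1, c₁) • Y (un2 (lft c₁ c₂ z)), nn (z.2, c₂) • Z (un2 (lft c₁ c₂ z)))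

/-- `Y` and `Z` are the coefficients of the homogeneous extensions of `χ` on the three kinds of
boundary points. -/
structure HomData {n : ℕ} (χ : PartialEquiv (Amb n) (Amb n)) (Y Z : Amb n → Eu n) : Prop where
  source_open : IsRelOpen χ.source (bdry (Eu n) (Eu n))
  smoothY : SmoothOn Y χ.source
  smoothZ : SmoothOn Z χ.source
  pos : ∀ p ∈ χ.source, 0 < nn (Y p, p.1.2) ∧ 0 < nn (Z p, p.2.2)
  proj : ∀ p ∈ χ.source, χ p = un2 ((Y p, p.1.2), (Z p, p.2.2))
  sympE : IsSymplecticOn (gmap Y Z 0 1) (gcone 0 1 χ.source)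
  sympPsi : IsSymplecticOn (gmap Y Z 1 0) (gcone 1 0 χ.source)
  sympC : IsSymplecticOn (gmap Y Z 0 0) (gcone 0 0 χ.source)

/-! ### Scaling of the extensions and passage to the corner -/

section GMap

variable {n : ℕ} {χ : PartialEquiv (Amb n) (Amb n)} {Y Z : Amb n → Eu n}

theorem contDiffOn_gmap (hU : IsRelOpen χ.source (bdry (Eu n) (Eu n)))
    (hY : SmoothOn Y χ.source) (hZ : SmoothOn Z χ.source) {c₁ c₂ : ℝ} (hc : IsHeights c₁ c₂) :
    ContDiffOn ℝ ∞ (gmap Y Z c₁ c₂) (gcone c₁ c₂ χ.source) := by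
  intro z hz
  have hl := (contDiff_lft (E := Eu n) (F := Eu n) c₁ c₂)
  have hu : ContDiffAt ℝ ∞ (fun z : Eu n × Eu n => un2 (lft c₁ c₂ z)) z :=
    (contDiffAt_un2 hz.1 hz.2.1).comp z hl.contDiffAt
  have key : ∀ V : Amb n → Eu n, SmoothOn V χ.source →
      ContDiffAt ℝ ∞ (fun z => V (un2 (lft c₁ c₂ z))) z := by
    intro V hV
    obtain ⟨O, G, hO, hzO, hG, hVG⟩ := hV _ hz.2.2
    have h1 : ContDiffAt ℝ ∞ (fun z => G (un2 (lft c₁ c₂ z))) z :=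
      (hG.contDiffAt (hO.mem_nhds hzO)).comp z hu
    refine h1.congr_of_eventuallyEq ?_
    filter_upwards [(isOpen_gcone hc hU).mem_nhds hz, hu.continuousAt.preimage_mem_nhds
      (hO.mem_nhds hzO)] with y hy hyO
    exact hVG ⟨hyO, hy.2.2⟩
  have n1 : ContDiffAt ℝ ∞ (fun z : Eu n × Eu n => nn (z.1, c₁)) z :=
    contDiffAt_nn_comp (by fun_prop) hz.1
  have n2 : ContDiffAt ℝ ∞ (fun z : Eu n × Eu n => nn (z.2, c₂)) z :=
    contDiffAt_nn_comp (by fun_prop) hz.2.1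
  exact ((n1.smul (key Y hY)).prodMk (n2.smul (key Z hZ))).contDiffWithinAt

/-- The height is scaled along with x. For c₁ = 0 this is homogeneity in x; for c₁ > 0 it relates
the maps of different positive heights. -/
theorem gmap_smul_fst (Y Z : Amb n → Eu n) {c₁ c₂ : ℝ} (z : Eu n × Eu n) {t : ℝ} (ht : 0 < t) :
    gmap Y Z (t * c₁) c₂ (t • z.1, z.2) = (t • (gmap Y Z c₁ c₂ z).1, (gmap Y Z c₁ c₂ z).2) := by
  have h1 : ((t • z.1, t * c₁) : Eu n × ℝ) = t • (z.1, c₁) := rfl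
  have h2 : un2 (lft (t * c₁) c₂ (t • z.1, z.2)) = un2 (lft c₁ c₂ z) := by
    simp only [un2, lft, h1, un_smul ht]
  simp only [gmap, h2, h1, nn_smul ht.le, smul_smul]

theorem gmap_smul_snd (Y Z : Amb n → Eu n) {c₁ c₂ : ℝ} (z : Eu n × Eu n) {t : ℝ} (ht : 0 < t) :
    gmap Y Z c₁ (t * c₂) (z.1, t • z.2) = ((gmap Y Z c₁ c₂ z).1, t • (gmap Y Z c₁ c₂ z).2) := by
  have h1 : ((t • z.2, t * c₂) : Eu n × ℝ) = t • (z.2, c₂) := rfl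
  have h2 : un2 (lft c₁ (t * c₂) (z.1, t • z.2)) = un2 (lft c₁ c₂ z) := by
    simp only [un2, lft, h1, un_smul ht]
  simp only [gmap, h2, h1, nn_smul ht.le, smul_smul]

theorem mem_gcone_smul_fst {U : Set (Amb n)} {c₁ c₂ : ℝ} {z : Eu n × Eu n}
    (hz : z ∈ gcone c₁ c₂ U) {t : ℝ} (ht : 0 < t) : (t • z.1, z.2) ∈ gcone (t * c₁) c₂ U := by
  have h1 : ((t • z.1, t * c₁) : Eu n × ℝ) = t • (z.1, c₁) := rfl
  refine ⟨?_, hz.2.1, ?_⟩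
  · simp only [h1, nn_smul ht.le]; exact mul_pos ht hz.1
  · simp only [un2, lft, h1, un_smul ht]; exact hz.2.2

theorem mem_gcone_smul_snd {U : Set (Amb n)} {c₁ c₂ : ℝ} {z : Eu n × Eu n}
    (hz : z ∈ gcone c₁ c₂ U) {t : ℝ} (ht : 0 < t) : (z.1, t • z.2) ∈ gcone c₁ (t * c₂) U := by
  have h1 : ((t • z.2, t * c₂) : Eu n × ℝ) = t • (z.2, c₂) := rfl
  refine ⟨hz.1, ?_, ?_⟩
  · simp only [h1, nn_smul ht.le]; exact mul_pos ht hz.2.1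
  · simp only [un2, lft, h1, un_smul ht]; exact hz.2.2

/-- The corner map is symplectic, as a limit of rescalings of the exit map. -/
theorem isSymplecticOn_corner (hU : IsRelOpen χ.source (bdry (Eu n) (Eu n)))
    (hY : SmoothOn Y χ.source) (hZ : SmoothOn Z χ.source)
    (hs : IsSymplecticOn (gmap Y Z 0 1) (gcone 0 1 χ.source)) :
    IsSymplecticOn (gmap Y Z 0 0) (gcone 0 0 χ.source) := by
  intro z0 hz0 v w
  have hE : ContDiffOn ℝ ∞ (gmap Y Z 0 1) (gcone 0 1 χ.source) :=
    contDiffOn_gmap hU hY hZ ⟨le_rfl, zero_le_one, Or.inl rfl⟩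
  have hEo : IsOpen (gcone 0 1 χ.source) := isOpen_gcone ⟨le_rfl, zero_le_one, Or.inl rfl⟩ hU
  obtain ⟨OY, Yh, hOY, hYh, hmY, hpY, heY⟩ := exists_hat hU hY hz0.2.2
  obtain ⟨OZ, Zh, hOZ, hZh, hmZ, hpZ, heZ⟩ := exists_hat hU hZ hz0.2.2
  let B : (Eu n × Eu n) × ℝ → Amb n := fun q => lft 0 q.2 q.1
  have hB : ContDiff ℝ ∞ B := by simp only [B, lft]; fun_prop
  let W : Set ((Eu n × Eu n) × ℝ) := B ⁻¹' (OY ∩ OZ)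
  have hW : IsOpen W := (hOY.inter hOZ).preimage hB.continuous
  -- Φ(z, ε) agrees with `gmap Y Z 0 ε` for ε ≥ 0 and is smooth across ε = 0, so derivatives in z
  -- may be passed to the limit ε → 0.
  let Φ : (Eu n × Eu n) × ℝ → Eu n × Eu n := fun q =>
    (nn (q.1.1, (0 : ℝ)) • Yh (B q), nn (q.1.2, q.2) • Zh (B q))
  have hΦ : ContDiffOn ℝ ∞ Φ W := by
    intro q hq
    have h1 := hpY _ hq.1
    have a1 : ContDiffAt ℝ ∞ (fun q : (Eu n × Eu n) × ℝ => nn (q.1.1, (0 : ℝ))) q :=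
      contDiffAt_nn_comp (by fun_prop) h1.1
    have a2 : ContDiffAt ℝ ∞ (fun q : (Eu n × Eu n) × ℝ => nn (q.1.2, q.2)) q :=
      contDiffAt_nn_comp (by fun_prop) h1.2
    have b1 := (hYh.contDiffAt (hOY.mem_nhds hq.1)).comp q hB.contDiffAt
    have b2 := (hZh.contDiffAt (hOZ.mem_nhds hq.2)).comp q hB.contDiffAt
    exact ((a1.smul b1).prodMk (a2.smul b2)).contDiffWithinAt
  have hz0W : (z0, (0 : ℝ)) ∈ W := by
    have e : B (z0, 0) = (‖z0.1‖ • (un2 (lft 0 0 z0)).1, ‖z0.2‖ • (un2 (lft 0 0 z0)).2) := by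
      have h1 := hz0.1
      have h2 := hz0.2.1
      rw [nn_zero_right] at h1 h2
      simp [B, lft, un2, un, nn_zero_right, smul_smul, h1.ne', h2.ne']
    have h1 := hz0.1
    have h2 := hz0.2.1
    rw [nn_zero_right] at h1 h2
    constructor
    · rw [e]; exact hmY _ _ h1 h2
    · rw [e]; exact hmZ _ _ h1 h2
  have hval : ∀ q ∈ W, 0 ≤ q.2 → Φ q = gmap Y Z 0 q.2 q.1 ∧ q.1 ∈ gcone 0 q.2 χ.source := by
    intro q hq h0
    have h1 := heY _ hq.1 le_rfl h0 (Or.inl rfl)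
    have h2 := heZ _ hq.2 le_rfl h0 (Or.inl rfl)
    exact ⟨Prod.ext (congrArg (fun y => nn (q.1.1, (0 : ℝ)) • y) h1.2)
      (congrArg (fun y => nn (q.1.2, q.2) • y) h2.2), (hpY _ hq.1).1, (hpY _ hq.1).2, h1.1⟩
  have hder : ∀ ε : ℝ, (z0, ε) ∈ W → HasFDerivAt (fun z => Φ (z, ε))
      ((fderiv ℝ Φ (z0, ε)).comp (ContinuousLinearMap.inl ℝ _ ℝ)) z0 := by
    intro ε hε
    exact HasFDerivAt.comp (g := Φ) (f := fun z => (z, ε)) z0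
      ((hΦ.contDiffAt (hW.mem_nhds hε)).differentiableAt (by simp)).hasFDerivAt
      (hasFDerivAt_prodMk_left z0 ε)
  have hnear : ∀ ε : ℝ, (z0, ε) ∈ W → ∀ᶠ z in 𝓝 z0, (z, ε) ∈ W := fun ε hε =>
    (by fun_prop : Continuous fun z : Eu n × Eu n => (z, ε)).continuousAt.preimage_mem_nhds
      (hW.mem_nhds hε)
  let g : ℝ → ℝ := fun ε =>
    symp (fderiv ℝ Φ (z0, ε) (v, 0)) (fderiv ℝ Φ (z0, ε) (w, 0))
  have hg : ContinuousAt g 0 := by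
    have h1 : ContinuousAt (fderiv ℝ Φ) (z0, 0) :=
      (hΦ.continuousOn_fderiv_of_isOpen hW (by simp)).continuousAt (hW.mem_nhds hz0W)
    have h2 : ContinuousAt (fun ε : ℝ => fderiv ℝ Φ (z0, ε)) 0 :=
      ContinuousAt.comp (g := fderiv ℝ Φ) (f := fun ε : ℝ => (z0, ε)) h1 (by fun_prop)
    have h3 := h2.clm_apply (continuousAt_const (y := (v, (0 : ℝ))))
    have h4 := h2.clm_apply (continuousAt_const (y := (w, (0 : ℝ))))
    exact (h3.snd.inner (𝕜 := ℝ) h4.fst).sub (h3.fst.inner (𝕜 := ℝ) h4.snd)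
  -- For ε > 0 the map at height ε is the exit map conjugated by ξ ↦ ε⁻¹ξ; the factors ε⁻¹ and ε of
  -- the form cancel.
  have hpos : ∀ᶠ ε in 𝓝[>] (0 : ℝ), g ε = symp v w := by
    have hmem : ∀ᶠ ε in 𝓝 (0 : ℝ), (z0, ε) ∈ W :=
      (by fun_prop : Continuous fun ε : ℝ => (z0, ε)).continuousAt.preimage_mem_nhds
        (hW.mem_nhds hz0W)
    filter_upwards [hmem.filter_mono nhdsWithin_le_nhds, self_mem_nhdsWithin] with ε hε h0
    have h0 : 0 < ε := h0
    let δ : Eu n × Eu n →L[ℝ] Eu n × Eu n :=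
      (ContinuousLinearMap.fst ℝ _ _).prod (ε⁻¹ • ContinuousLinearMap.snd ℝ _ _)
    let M : Eu n × Eu n →L[ℝ] Eu n × Eu n :=
      (ContinuousLinearMap.fst ℝ _ _).prod (ε • ContinuousLinearMap.snd ℝ _ _)
    have e1 : ∀ z, (z, ε) ∈ W → δ z ∈ gcone 0 1 χ.source ∧ Φ (z, ε) = M (gmap Y Z 0 1 (δ z)) := by
      intro z hz
      obtain ⟨h1, h2⟩ := hval _ hz h0.le
      have h3 := mem_gcone_smul_snd h2 (inv_pos.2 h0)
      have h4 := gmap_smul_snd Y Z (c₁ := 0) (c₂ := 1) (δ z) h0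
      simp only [inv_mul_cancel₀ h0.ne'] at h3
      refine ⟨h3, ?_⟩
      rw [h1]
      simp only [mul_one, δ, ContinuousLinearMap.prod_apply, ContinuousLinearMap.coe_fst',
        smul_apply, ContinuousLinearMap.coe_snd', smul_smul,
        mul_inv_cancel₀ h0.ne', one_smul] at h4
      simpa [M, δ] using h4
    have e2 : HasFDerivAt (fun z => M (gmap Y Z 0 1 (δ z)))
        (M.comp ((fderiv ℝ (gmap Y Z 0 1) (δ z0)).comp δ)) z0 := by
      have hd : HasFDerivAt (gmap Y Z 0 1) (fderiv ℝ (gmap Y Z 0 1) (δ z0)) (δ z0) :=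
        ((hE.contDiffAt (hEo.mem_nhds (e1 z0 hε).1)).differentiableAt (by simp)).hasFDerivAt
      exact M.hasFDerivAt.comp z0 (hd.comp z0 δ.hasFDerivAt)
    have e3 := (hder ε hε).unique (e2.congr_of_eventuallyEq
      ((hnear ε hε).mono fun z hz => (e1 z hz).2))
    have e4 : ∀ u, fderiv ℝ Φ (z0, ε) (u, 0) = M (fderiv ℝ (gmap Y Z 0 1) (δ z0) (δ u)) :=
      fun u => DFunLike.congr_fun e3 u
    have e5 := hs (δ z0) (e1 z0 hε).1 (δ v) (δ w)
    simp only [g, e4]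
    simp only [symp, M, δ, ContinuousLinearMap.prod_apply, ContinuousLinearMap.coe_fst',
      smul_apply, ContinuousLinearMap.coe_snd', inner_smul_left,
      inner_smul_right, conj_trivial] at e5 ⊢
    rw [← mul_sub, e5, ← mul_sub, ← mul_assoc, mul_inv_cancel₀ h0.ne', one_mul]
  have hlim : g 0 = symp v w :=
    tendsto_nhds_unique (hg.tendsto.mono_left nhdsWithin_le_nhds)
      (tendsto_const_nhds.congr' (hpos.mono fun ε h => h.symm))
  have hC : HasFDerivAt (gmap Y Z 0 0)
      ((fderiv ℝ Φ (z0, 0)).comp (ContinuousLinearMap.inl ℝ _ ℝ)) z0 :=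
    (hder 0 hz0W).congr_of_eventuallyEq ((hnear 0 hz0W).mono fun z hz => (hval _ hz le_rfl).1.symm)
  rw [hC.fderiv]
  exact hlim

end GMap

/-! ### Preliminaries on smooth maps on the boundary -/

theorem SmoothOn.continuousOn {X Y : Type} [NormedAddCommGroup X] [NormedSpace ℝ X]
    [NormedAddCommGroup Y] [NormedSpace ℝ Y] {f : X → Y} {S : Set X} (hf : SmoothOn f S) :
    ContinuousOn f S := by
  intro p hp
  obtain ⟨O, F, hO, hpO, hF, he⟩ := hf p hp
  have h : ContinuousWithinAt F S p :=
    (hF.continuousOn.continuousAt (hO.mem_nhds hpO)).continuousWithinAt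
  refine h.congr_of_eventuallyEq ?_ (he ⟨hpO, hp⟩)
  filter_upwards [self_mem_nhdsWithin, mem_nhdsWithin_of_mem_nhds (hO.mem_nhds hpO)] with q h1 h2
  exact he ⟨h2, h1⟩

theorem smoothOn_of_contDiff {X Y : Type} [NormedAddCommGroup X] [NormedSpace ℝ X]
    [NormedAddCommGroup Y] [NormedSpace ℝ Y] {f : X → Y} (hf : ContDiff ℝ ∞ f) (S : Set X) :
    SmoothOn f S :=
  fun _ _ => ⟨univ, f, isOpen_univ, mem_univ _, hf.contDiffOn, fun _ _ => rfl⟩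

theorem smoothOn_toLp {X : Type} [NormedAddCommGroup X] [NormedSpace ℝ X] {n : ℕ}
    {f : Fin n → X → ℝ} {S : Set X} (hf : ∀ j, SmoothOn (f j) S) :
    SmoothOn (fun p => (WithLp.toLp 2 fun j => f j p : Eu n)) S := by
  intro p hp
  choose O F hO hpO hF he using fun j => hf j p hp
  refine ⟨⋂ j, O j, fun p => WithLp.toLp 2 fun j => F j p, isOpen_iInter_of_finite hO,
    mem_iInter.2 hpO, ?_, fun q hq => ?_⟩
  · rw [contDiffOn_euclidean]
    exact fun j => (hF j).mono (iInter_subset _ j)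
  · ext j
    exact he j ⟨mem_iInter.1 hq.1 j, hq.2⟩

theorem projE_chartE {n : ℕ} {p : Amb n} (hp : p ∈ faceE (Eu n) (Eu n)) (h : p.2.2 ≠ 0) :
    (chartE p).1 ≠ 0 ∧ projE (chartE p) = p := by
  have h1 := nn_of_mem_hemi hp.1
  have h2 := nn_of_mem_hemi hp.2.1
  have h3 : ‖p.1.1‖ = 1 := by rw [← nn_zero_right, ← hp.2.2]; exact h1
  have h4 : 0 < p.2.2 := lt_of_le_of_ne hp.2.1.2 h.symm
  refine ⟨norm_ne_zero_iff.1 (by rw [chartE, h3]; exact one_ne_zero), Prod.ext ?_ ?_⟩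
  · simp [projE, chartE, atInf, h3, ← hp.2.2]
  · have : ((p.2.2⁻¹ • p.2.1, 1) : Eu n × ℝ) = p.2.2⁻¹ • p.2 := by
      ext <;> simp [h]
    rw [projE, chartE, ← un_one_right, this, un_smul (inv_pos.2 h4), un_eq_self h2]

theorem projPsi_chartPsi {n : ℕ} {p : Amb n} (hp : p ∈ facePsi (Eu n) (Eu n)) (h : p.1.2 ≠ 0) :
    (chartPsi p).2 ≠ 0 ∧ projPsi (chartPsi p) = p := by
  have h1 := nn_of_mem_hemi hp.1
  have h2 := nn_of_mem_hemi hp.2.1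
  have h3 : ‖p.2.1‖ = 1 := by rw [← nn_zero_right, ← hp.2.2]; exact h2
  have h4 : 0 < p.1.2 := lt_of_le_of_ne hp.1.2 h.symm
  refine ⟨norm_ne_zero_iff.1 (by rw [chartPsi, h3]; exact one_ne_zero), Prod.ext ?_ ?_⟩
  · have : ((p.1.2⁻¹ • p.1.1, 1) : Eu n × ℝ) = p.1.2⁻¹ • p.1 := by
      ext <;> simp [h]
    rw [projPsi, chartPsi, ← un_one_right, this, un_smul (inv_pos.2 h4), un_eq_self h1]
  · simp [projPsi, chartPsi, atInf, h3, ← hp.2.2]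

/-- Identities on the open exit face extend to the corner. -/
theorem eq_of_eqOn_open_faceE {n : ℕ} {T : Type} [TopologicalSpace T] [T2Space T]
    {U : Set (Amb n)} (hU : IsRelOpen U (bdry (Eu n) (Eu n))) {f g : Amb n → T}
    (hf : ContinuousOn f (U ∩ faceE (Eu n) (Eu n))) (hg : ContinuousOn g (U ∩ faceE (Eu n) (Eu n)))
    (h : ∀ q ∈ U ∩ faceE (Eu n) (Eu n), q.2.2 ≠ 0 → f q = g q) {p : Amb n}
    (hp : p ∈ U ∩ faceE (Eu n) (Eu n)) : f p = g p := by
  by_cases hp2 : p.2.2 ≠ 0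
  · exact h p hp hp2
  push Not at hp2
  obtain ⟨O, hO, rfl⟩ := hU
  have n1 := nn_of_mem_hemi hp.2.1
  have n2 := nn_of_mem_hemi hp.2.2.1
  -- A path in the exit face that leaves the corner point p by raising the second height.
  let γ : ℝ → Amb n := fun ε => (p.1, un (p.2.1, ε))
  have h00 : ((p.2.1, 0) : Eu n × ℝ) = p.2 := Prod.ext rfl hp2.symm
  have hγ0 : γ 0 = p := by
    simp only [γ, h00, un_eq_self n2]
  have hγ : ContinuousAt γ 0 := by
    have h1 : ContinuousAt (un : Eu n × ℝ → _) (p.2.1, 0) :=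
      (contDiffAt_un (by rw [h00, n2]; exact one_pos)).continuousAt
    exact continuousAt_const.prodMk
      (ContinuousAt.comp (g := un) (f := fun ε : ℝ => (p.2.1, ε)) h1 (by fun_prop))
  have hpos : ∀ ε : ℝ, 0 < ε → 0 < nn (p.2.1, ε) := fun ε hε =>
    Real.sqrt_pos.2 (by positivity)
  have hmem : ∀ᶠ ε in 𝓝[>] (0 : ℝ), γ ε ∈ (O ∩ bdry (Eu n) (Eu n)) ∩ faceE (Eu n) (Eu n) ∧
      (γ ε).2.2 ≠ 0 := by
    have hO' : ∀ᶠ ε in 𝓝 (0 : ℝ), γ ε ∈ O :=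
      hγ.preimage_mem_nhds (by rw [hγ0]; exact hO.mem_nhds hp.1.1)
    filter_upwards [hO'.filter_mono nhdsWithin_le_nhds, self_mem_nhdsWithin] with ε h1 h2
    have h2 : 0 < ε := h2
    have hF : γ ε ∈ faceE (Eu n) (Eu n) := ⟨hp.2.1, un_mem_hemi (hpos ε h2) h2.le, hp.2.2.2⟩
    exact ⟨⟨⟨h1, Or.inl hF⟩, hF⟩, mul_ne_zero (inv_ne_zero (hpos ε h2).ne') h2.ne'⟩
  have hlim : Tendsto γ (𝓝[>] 0) (𝓝[(O ∩ bdry (Eu n) (Eu n)) ∩ faceE (Eu n) (Eu n)] p) := by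
    refine tendsto_nhdsWithin_iff.2 ⟨?_, hmem.mono fun ε h => h.1⟩
    have := hγ.tendsto.mono_left (nhdsWithin_le_nhds (s := Ioi 0))
    rwa [hγ0] at this
  have t1 := (hf p hp).tendsto.comp hlim
  have t2 := (hg p hp).tendsto.comp hlim
  exact tendsto_nhds_unique t1 (t2.congr' (hmem.mono fun ε hε => (h _ hε.1 hε.2).symm))

theorem IsSymplecticOn.congr {n : ℕ} {C C' : Eu n × Eu n → Eu n × Eu n} {S : Set (Eu n × Eu n)}
    (hS : IsOpen S) (h : IsSymplecticOn C S) (he : EqOn C' C S) : IsSymplecticOn C' S := by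
  intro z hz v w
  have : C' =ᶠ[𝓝 z] C := he.eventuallyEq_of_mem (hS.mem_nhds hz)
  rw [this.fderiv_eq]
  exact h z hz v w

theorem nn_smul_inv {n : ℕ} (y : Eu n) {a c : ℝ} (ha : 0 < a) :
    ((a • y, c) : Eu n × ℝ) = a • (y, a⁻¹ * c) := by
  simp [ha.ne']

theorem nn_pos {E : Type} [NormedAddCommGroup E] [InnerProductSpace ℝ E] {q : E × ℝ}
    (h : q.1 ≠ 0 ∨ q.2 ≠ 0) : 0 < nn q := by
  refine Real.sqrt_pos.2 ?_
  rcases h with h | h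
  · have := norm_pos_iff.2 h
    positivity
  · positivity

theorem continuousOn_un2_heights {n : ℕ} {S : Set (Amb n)} {Y Z : Amb n → Eu n}
    (hY : ContinuousOn Y S) (hZ : ContinuousOn Z S)
    (hpos : ∀ p ∈ S, 0 < nn (Y p, p.1.2) ∧ 0 < nn (Z p, p.2.2)) :
    ContinuousOn (fun p => un2 ((Y p, p.1.2), (Z p, p.2.2))) S := by
  intro p hp
  have h1 : ContinuousWithinAt (fun p : Amb n => ((Y p, p.1.2), (Z p, p.2.2))) S p :=
    ((hY p hp).prodMk (by fun_prop)).prodMk ((hZ p hp).prodMk (by fun_prop))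
  exact ContinuousAt.comp_continuousWithinAt (g := un2)
    (f := fun p : Amb n => ((Y p, p.1.2), (Z p, p.2.2)))
    (contDiffAt_un2 (hpos p hp).1 (hpos p hp).2).continuousAt h1

/-- Homogeneous symplectic extensions with matching coefficients form a `HomData`. -/
theorem homData_of_extensions {n : ℕ} {χ : PartialEquiv (Amb n) (Amb n)} (hχ : IsBdryDiffeo χ)
    {Y Z : Amb n → Eu n} (hYE : SmoothOn Y (χ.source ∩ faceE (Eu n) (Eu n)))
    (hYP : SmoothOn Y (χ.source ∩ facePsi (Eu n) (Eu n)))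
    (hZE : SmoothOn Z (χ.source ∩ faceE (Eu n) (Eu n)))
    (hZP : SmoothOn Z (χ.source ∩ facePsi (Eu n) (Eu n)))
    {Ce Cpsi : Eu n × Eu n → Eu n × Eu n} (hE : IsHomExtE χ Ce) (hPsi : IsHomExtPsi χ Cpsi)
    (sE : IsSymplecticOn Ce (coneE χ.source)) (sPsi : IsSymplecticOn Cpsi (conePsi χ.source))
    (eE : EqOn (gmap Y Z 0 1) Ce (coneE χ.source))
    (ePsi : EqOn (gmap Y Z 1 0) Cpsi (conePsi χ.source))
    (hc : ∀ p ∈ χ.source ∩ corner (Eu n) (Eu n), Y p ≠ 0 ∧ Z p ≠ 0) : HomData χ Y Z := by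
  have hU := hχ.source_open
  have hY := smoothOn_of_faces hU hYE hYP
  have hZ := smoothOn_of_faces hU hZE hZP
  have memE : ∀ p ∈ χ.source ∩ faceE (Eu n) (Eu n), p.2.2 ≠ 0 → ∃ z ∈ coneE χ.source,
      projE z = p := fun p hp h => by
    obtain ⟨h1, h2⟩ := projE_chartE hp.2 h
    exact ⟨chartE p, ⟨h1, by rw [h2]; exact hp.1⟩, h2⟩
  have memP : ∀ p ∈ χ.source ∩ facePsi (Eu n) (Eu n), p.1.2 ≠ 0 → ∃ z ∈ conePsi χ.source,
      projPsi z = p := fun p hp h => by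
    obtain ⟨h1, h2⟩ := projPsi_chartPsi hp.2 h
    exact ⟨chartPsi p, ⟨h1, by rw [h2]; exact hp.1⟩, h2⟩
  -- A positive height suffices by itself. Where a height vanishes off the corner, the extension
  -- does not vanish; at the corner `hc` is needed.
  have hpos : ∀ p ∈ χ.source, 0 < nn (Y p, p.1.2) ∧ 0 < nn (Z p, p.2.2) := by
    intro p hp
    by_cases h1 : p.1.2 = 0
    · by_cases h2 : p.2.2 = 0
      · have hm := mem_hemi_of_mem_bdry (hU.choose_spec.2.subset hp).2
        obtain ⟨h3, h4⟩ := hc p ⟨hp, ⟨hm.1, hm.2, h1⟩, ⟨hm.1, hm.2, h2⟩⟩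
        exact ⟨nn_pos (Or.inl h3), nn_pos (Or.inl h4)⟩
      · refine ⟨nn_pos (Or.inl ?_), nn_pos (Or.inr h2)⟩
        have hm := mem_hemi_of_mem_bdry (hU.choose_spec.2.subset hp).2
        obtain ⟨z, hz, rfl⟩ := memE p ⟨hp, hm.1, hm.2, h1⟩ h2
        have := hE.ne_zero z hz
        rw [← eE hz, gmap, un2_lft_E] at this
        exact (smul_ne_zero_iff.1 this).2
    · refine ⟨nn_pos (Or.inr h1), nn_pos ?_⟩
      by_cases h2 : p.2.2 = 0
      · left
        have hm := mem_hemi_of_mem_bdry (hU.choose_spec.2.subset hp).2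
        obtain ⟨z, hz, rfl⟩ := memP p ⟨hp, hm.1, hm.2, h2⟩ h1
        have := hPsi.ne_zero z hz
        rw [← ePsi hz, gmap, un2_lft_Psi] at this
        exact (smul_ne_zero_iff.1 this).2
      · exact Or.inr h2
  have hcont := continuousOn_un2_heights (hYE.continuousOn) (hZE.continuousOn)
    fun p hp => hpos p hp.1
  have h01 : IsHeights 0 1 := ⟨le_rfl, zero_le_one, Or.inl rfl⟩
  have h10 : IsHeights 1 0 := ⟨zero_le_one, le_rfl, Or.inr rfl⟩
  have gE : IsSymplecticOn (gmap Y Z 0 1) (gcone 0 1 χ.source) := by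
    rw [coneE_eq_gcone] at sE eE
    exact sE.congr (isOpen_gcone h01 hU) eE
  -- Computed on the open exit face, where p lies under a point of the cone, and carried to the
  -- corner by continuity of both sides.
  have projE_eq : ∀ p ∈ χ.source ∩ faceE (Eu n) (Eu n), χ p = un2 ((Y p, p.1.2), (Z p, p.2.2)) := by
    refine fun p hp => eq_of_eqOn_open_faceE hU hχ.smoothE.continuousOn hcont (fun q hq hq2 => ?_) hp
    obtain ⟨z, hz, rfl⟩ := memE q hq hq2
    have hj := jap_pos z.2
    have hx := norm_pos_iff.2 hz.1
    rw [← hE.proj z hz, ← eE hz, ← un2_lft_E (gmap Y Z 0 1 z)]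
    simp only [un2, lft, gmap, nn_smul_inv _ (show 0 < nn (z.1, (0 : ℝ)) by rwa [nn_zero_right]),
      nn_smul_inv _ (show 0 < nn (z.2, (1 : ℝ)) by rwa [nn_one_right])]
    rw [un_smul (by rwa [nn_zero_right]), un_smul (by rwa [nn_one_right]), ← un2_lft_E]
    rfl
  refine ⟨hU, hY, hZ, hpos, fun p hp => ?_, gE, ?_, isSymplecticOn_corner hU hY hZ gE⟩
  · rcases (hU.choose_spec.2.subset hp).2 with hF | hF
    · exact projE_eq p ⟨hp, hF⟩
    · by_cases h1 : p.1.2 = 0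
      · exact projE_eq p ⟨hp, hF.1, hF.2.1, h1⟩
      · obtain ⟨z, hz, rfl⟩ := memP p ⟨hp, hF⟩ h1
        have hj := jap_pos z.1
        have hx := norm_pos_iff.2 hz.1
        rw [← hPsi.proj z hz, ← ePsi hz, ← un2_lft_Psi (gmap Y Z 1 0 z)]
        simp only [un2, lft, gmap,
          nn_smul_inv _ (show 0 < nn (z.2, (0 : ℝ)) by rwa [nn_zero_right]),
          nn_smul_inv _ (show 0 < nn (z.1, (1 : ℝ)) by rwa [nn_one_right])]
        rw [un_smul (by rwa [nn_one_right]), un_smul (by rwa [nn_zero_right]), ← un2_lft_Psi]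
        rfl
  · rw [conePsi_eq_gcone] at sPsi ePsi
    exact sPsi.congr (isOpen_gcone h10 hU) ePsi

/-! ### The extensions at the corner -/

/-- The coordinates of `ℝⁿ × ℝⁿ` as sections of `S^{1,0}` and `S^{0,1}`. -/
def coordSec {n : ℕ} : Fin n ⊕ Fin n → Amb n → ℝ :=
  Sum.elim (fun j p => p.1.1 j) fun j p => p.2.1 j

/-- The orders of the coordinates. -/
def coordOrd {n : ℕ} : Fin n ⊕ Fin n → ℝ × ℝ := Sum.elim (fun _ => (1, 0)) fun _ => (0, 1)

theorem contDiff_coordSec {n : ℕ} (a : Fin n ⊕ Fin n) : ContDiff ℝ ∞ (coordSec (n := n) a) := by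
  cases a
  · exact ((EuclideanSpace.proj _ : Eu n →L[ℝ] ℝ).contDiff).comp (contDiff_fst.comp contDiff_fst)
  · exact ((EuclideanSpace.proj _ : Eu n →L[ℝ] ℝ).contDiff).comp (contDiff_fst.comp contDiff_snd)

theorem isSmoothFun_of_contDiff {n : ℕ} {u : Amb n → ℝ} (hu : ContDiff ℝ ∞ u) (U : Set (Amb n)) :
    IsSmoothFun u U := ⟨smoothOn_of_contDiff hu _, smoothOn_of_contDiff hu _⟩

theorem secE_coordSec {n : ℕ} (a : Fin n ⊕ Fin n) :
    secE (coordOrd a).1 (coordOrd a).2 (coordSec a) = fun z : Eu n × Eu n => sumCoord z a := by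
  ext z
  cases a with
  | inl j =>
    by_cases h : z.1 = 0
    · simp [secE, coordOrd, coordSec, sumCoord, projE, atInf, h]
    · have := norm_ne_zero_iff.2 h
      simp [secE, coordOrd, coordSec, sumCoord, projE, atInf]
      field_simp
  | inr j =>
    have := (jap_pos z.2).ne'
    simp [secE, coordOrd, coordSec, sumCoord, projE, radComp]
    field_simp

theorem secPsi_coordSec {n : ℕ} (a : Fin n ⊕ Fin n) :
    secPsi (coordOrd a).1 (coordOrd a).2 (coordSec a) = fun z : Eu n × Eu n => sumCoord z a := by
  ext z
  cases a with
  | inl j =>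
    have := (jap_pos z.1).ne'
    simp [secPsi, coordOrd, coordSec, sumCoord, projPsi, radComp]
    field_simp
  | inr j =>
    by_cases h : z.2 = 0
    · simp [secPsi, coordOrd, coordSec, sumCoord, projPsi, atInf, h]
    · have := norm_ne_zero_iff.2 h
      simp [secPsi, coordOrd, coordSec, sumCoord, projPsi, atInf]
      field_simp

theorem poisson_sumCoord_comp {n : ℕ} {C : Eu n × Eu n → Eu n × Eu n} {z : Eu n × Eu n}
    (hC : DifferentiableAt ℝ C z) (a b : Fin n ⊕ Fin n) :
    poisson (fun y => sumCoord (C y) a) (fun y => sumCoord (C y) b) z =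
      ∑ j : Fin n, (sumMatrix (fderiv ℝ C z) a (Sum.inr j) * sumMatrix (fderiv ℝ C z) b (Sum.inl j)
        - sumMatrix (fderiv ℝ C z) a (Sum.inl j) * sumMatrix (fderiv ℝ C z) b (Sum.inr j)) := by
  have key : ∀ (a : Fin n ⊕ Fin n) v, fderiv ℝ (fun y => sumCoord (C y) a) z v =
      sumCoord (fderiv ℝ C z v) a := by
    intro a v
    cases a with
    | inl j =>
      have h : HasFDerivAt (fun y => sumCoord (C y) (Sum.inl j)) _ z :=
        (EuclideanSpace.proj j : Eu n →L[ℝ] ℝ).hasFDerivAt.comp z hC.hasFDerivAt.fst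
      rw [h.fderiv]; rfl
    | inr j =>
      have h : HasFDerivAt (fun y => sumCoord (C y) (Sum.inr j)) _ z :=
        (EuclideanSpace.proj j : Eu n →L[ℝ] ℝ).hasFDerivAt.comp z hC.hasFDerivAt.snd
      rw [h.fderiv]; rfl
  simp only [poisson, key]
  rfl

theorem poisson_sumCoord {n : ℕ} (z : Eu n × Eu n) (a b : Fin n ⊕ Fin n) :
    poisson (fun y => sumCoord y a) (fun y => sumCoord y b) z = Matrix.J (Fin n) ℝ a b := by
  have h := poisson_sumCoord_comp (C := id) (z := z) differentiableAt_id a b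
  have h1 : sumMatrix (fderiv ℝ (id : Eu n × Eu n → Eu n × Eu n) z) = 1 := by
    rw [fderiv_id]
    ext i j
    cases i <;> cases j <;>
      simp [sumMatrix, sumCoord, sumBasis, Matrix.one_apply, Pi.single_apply]
  rw [← sumMatrix_mul_J_mul_transpose, h1] at h
  simpa using h

/-- Brackets of the components of C are the entries of A J Aᵀ, and brackets of the coordinates those
of J. -/
theorem isSymplecticOn_of_poisson {n : ℕ} {C : Eu n × Eu n → Eu n × Eu n} {S : Set (Eu n × Eu n)}
    (hd : ∀ z ∈ S, DifferentiableAt ℝ C z)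
    (h : ∀ z ∈ S, ∀ a b : Fin n ⊕ Fin n,
      poisson ((fun y => sumCoord y a) ∘ C) ((fun y => sumCoord y b) ∘ C) z =
        poisson (fun y => sumCoord y a) (fun y => sumCoord y b) (C z)) : IsSymplecticOn C S := by
  intro z hz v w
  refine symp_map_of_brackets (fderiv ℝ C z) (fun a b => ?_) v w
  rw [← poisson_sumCoord_comp (hd z hz), ← poisson_sumCoord (C z)]
  exact h z hz a b

/-- The coordinates are sections of S^{1,0} and S^{0,1}, so their pull-backs are too. The functions
representing these pull-backs are the components of Y and Z: a single function serves both faces, so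
the coefficients of C_e and C_ψ match at the corner. -/
theorem exists_homData_of_preservesPoisson {n : ℕ} {χ : PartialEquiv (Amb n) (Amb n)}
    (hχ : IsBdryDiffeo χ) (h : PreservesPoisson χ) : ∃ Y Z : Amb n → Eu n, HomData χ Y Z := by
  obtain ⟨Ce, Cpsi, hE, hPsi, hsec, hbr⟩ := h
  have hU := hχ.source_open
  have h01 : IsHeights 0 1 := ⟨le_rfl, zero_le_one, Or.inl rfl⟩
  have h10 : IsHeights 1 0 := ⟨zero_le_one, le_rfl, Or.inr rfl⟩
  have oE : IsOpen (coneE χ.source) := by rw [coneE_eq_gcone]; exact isOpen_gcone h01 hU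
  have oP : IsOpen (conePsi χ.source) := by rw [conePsi_eq_gcone]; exact isOpen_gcone h10 hU
  have sm := fun a => isSmoothFun_of_contDiff (contDiff_coordSec (n := n) a) χ.target
  have sE : IsSymplecticOn Ce (coneE χ.source) := by
    refine isSymplecticOn_of_poisson (fun z hz =>
      (hE.smooth.contDiffAt (oE.mem_nhds hz)).differentiableAt (by simp)) fun z hz a b => ?_
    have := (hbr (coordOrd a).1 (coordOrd a).2 (coordOrd b).1 (coordOrd b).2 _ _ (sm a) (sm b)).1 z hz
    rwa [secE_coordSec, secE_coordSec] at this
  have sP : IsSymplecticOn Cpsi (conePsi χ.source) := by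
    refine isSymplecticOn_of_poisson (fun z hz =>
      (hPsi.smooth.contDiffAt (oP.mem_nhds hz)).differentiableAt (by simp)) fun z hz a b => ?_
    have := (hbr (coordOrd a).1 (coordOrd a).2 (coordOrd b).1 (coordOrd b).2 _ _ (sm a) (sm b)).2 z hz
    rwa [secPsi_coordSec, secPsi_coordSec] at this
  choose u hu huE huP using fun a : Fin n ⊕ Fin n =>
    hsec (coordOrd a).1 (coordOrd a).2 (coordSec a) (sm a)
  simp only [secE_coordSec, secPsi_coordSec] at huE huP
  let Y : Amb n → Eu n := fun p => WithLp.toLp 2 fun j => u (Sum.inl j) p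
  let Z : Amb n → Eu n := fun p => WithLp.toLp 2 fun j => u (Sum.inr j) p
  have eE : EqOn (gmap Y Z 0 1) Ce (coneE χ.source) := by
    intro z hz
    ext j
    · have := huE (Sum.inl j) z hz
      simp only [sumCoord, Sum.elim_inl] at this
      simp [gmap, Y, un2_lft_E, nn_zero_right, this, secE, coordOrd]
    · have := huE (Sum.inr j) z hz
      simp only [sumCoord, Sum.elim_inr] at this
      simp [gmap, Z, un2_lft_E, nn_one_right, this, secE, coordOrd]
  have eP : EqOn (gmap Y Z 1 0) Cpsi (conePsi χ.source) := by
    intro z hz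
    ext j
    · have := huP (Sum.inl j) z hz
      simp only [sumCoord, Sum.elim_inl] at this
      simp [gmap, Y, un2_lft_Psi, nn_one_right, this, secPsi, coordOrd]
    · have := huP (Sum.inr j) z hz
      simp only [sumCoord, Sum.elim_inr] at this
      simp [gmap, Z, un2_lft_Psi, nn_zero_right, this, secPsi, coordOrd]
  have YE : SmoothOn Y (χ.source ∩ faceE (Eu n) (Eu n)) := smoothOn_toLp fun j => (hu _).1
  have ZE : SmoothOn Z (χ.source ∩ faceE (Eu n) (Eu n)) := smoothOn_toLp fun j => (hu _).1
  -- Pulling back the constant 1 in orders (-1, 0) and (0, -1) yields continuous inverses of |Y| and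
  -- |(Z, p.2.2)| on the open exit face. The relations extend to the corner and force Y and Z to be
  -- non-zero there.
  have one := isSmoothFun_of_contDiff (contDiff_const (c := (1 : ℝ))) χ.target
  obtain ⟨a, ha, haE, -⟩ := hsec (-1) 0 _ one
  obtain ⟨b, hb, hbE, -⟩ := hsec 0 (-1) _ one
  refine ⟨Y, Z, homData_of_extensions hχ YE (smoothOn_toLp fun j => (hu _).2) ZE
    (smoothOn_toLp fun j => (hu _).2) hE hPsi sE sP eE eP fun p hp => ?_⟩
  have hpE : p ∈ χ.source ∩ faceE (Eu n) (Eu n) := ⟨hp.1, hp.2.1⟩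
  have h1 : ‖Y p‖ * a p = 1 := by
    refine eq_of_eqOn_open_faceE hU (YE.continuousOn.norm.mul ha.1.continuousOn)
      continuousOn_const (fun q hq hq2 => ?_) hpE
    obtain ⟨c1, c2⟩ := projE_chartE hq.2 hq2
    have hz : chartE q ∈ coneE χ.source := ⟨c1, by rw [c2]; exact hq.1⟩
    have h3 := haE _ hz
    have h4 := hE.ne_zero _ hz
    rw [← eE hz] at h3 h4
    simp only [secE, gmap, un2_lft_E, c2, nn_zero_right, norm_smul, Real.rpow_neg_one,
      Real.rpow_zero, mul_one, norm_norm, mul_inv] at h3 h4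
    have h5 := norm_ne_zero_iff.2 c1
    have h6 := norm_ne_zero_iff.2 (smul_ne_zero_iff.1 h4).2
    field_simp at h3
    exact h3.symm
  have h2 : nn (Z p, p.2.2) * b p = 1 := by
    have hnn : ContinuousOn (fun p : Amb n => nn (Z p, p.2.2)) (χ.source ∩ faceE (Eu n) (Eu n)) :=
      continuous_nn.comp_continuousOn (ZE.continuousOn.prodMk (by fun_prop))
    refine eq_of_eqOn_open_faceE hU (hnn.mul hb.1.continuousOn)
      continuousOn_const (fun q hq hq2 => ?_) hpE
    obtain ⟨c1, c2⟩ := projE_chartE hq.2 hq2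
    have hz : chartE q ∈ coneE χ.source := ⟨c1, by rw [c2]; exact hq.1⟩
    have h3 := hbE _ hz
    rw [← eE hz] at h3
    have hj := jap_pos (chartE q).2
    have h7 : q.2.2 = (jap (chartE q).2)⁻¹ := by
      conv_lhs => rw [← c2]
      rfl
    have h8 : jap (nn ((chartE q).2, (1 : ℝ)) • Z q) = jap (chartE q).2 * nn (Z q, q.2.2) := by
      rw [nn_one_right, ← nn_one_right, nn_smul_inv _ hj, nn_smul hj.le, h7, mul_one]
    simp only [secE, gmap, un2_lft_E, c2, Real.rpow_neg_one, Real.rpow_zero, mul_one, one_mul,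
      h8, mul_inv] at h3
    have h6 : 0 < nn (Z q, q.2.2) := nn_pos (Or.inr hq2)
    field_simp at h3
    exact h3.symm
  constructor
  · intro h0
    rw [h0, norm_zero, zero_mul] at h1
    exact zero_ne_one h1
  · intro h0
    rw [h0, hp.2.2.2.2, nn_zero_right, norm_zero, zero_mul] at h2
    exact zero_ne_one h2

/-! ### The extensions away from the corner -/

/-- Since χ respects both faces and the source misses the corner, the image of the open exit face
stays in the open exit face. There `chartE` is smooth, and the contact extension applies to χ read
in this chart. -/
theorem exists_extE_of_contact {n : ℕ} {χ : PartialEquiv (Amb n) (Amb n)} (hχ : IsBdryDiffeo χ)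
    (hc : IsContactE χ) (hne : ∀ p ∈ χ.source, p ∉ corner (Eu n) (Eu n)) :
    ∃ Ce, IsHomExtE χ Ce ∧ IsSymplecticOn Ce (coneE χ.source) := by
  have h01 : IsHeights 0 1 := ⟨le_rfl, zero_le_one, Or.inl rfl⟩
  have oE : IsOpen (coneE χ.source) := by
    rw [coneE_eq_gcone]; exact isOpen_gcone h01 hχ.source_open
  have hmem : ∀ z ∈ coneE χ.source, projE z ∈ χ.source ∩ faceE (Eu n) (Eu n) := by
    intro z hz
    refine ⟨hz.2, ?_⟩
    rw [← un2_lft_E]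
    have h1 : 0 < nn (z.1, (0 : ℝ)) := by rw [nn_zero_right]; exact norm_pos_iff.2 hz.1
    have h2 : 0 < nn (z.2, (1 : ℝ)) := by rw [nn_one_right]; exact jap_pos _
    exact un2_mem_faceE h1 h2 rfl zero_le_one
  have himg : ∀ z ∈ coneE χ.source, χ (projE z) ∈ faceE (Eu n) (Eu n) ∧ (χ (projE z)).2.2 ≠ 0 := by
    intro z hz
    have h1 := hmem z hz
    have h2 := (hχ.faceE_iff _ h1.1).2 h1.2
    refine ⟨h2, fun h0 => hne _ h1.1 ⟨h1.2, (hχ.facePsi_iff _ h1.1).1 ⟨h2.1, h2.2.1, h0⟩⟩⟩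
  let K : Eu n × Eu n → Eu n × Eu n := fun z => chartE (χ (projE z))
  have hproj : ContDiffOn ℝ ∞ (projE : Eu n × Eu n → Amb n) (coneE χ.source) := by
    intro z hz
    have h1 : 0 < nn (z.1, (0 : ℝ)) := by rw [nn_zero_right]; exact norm_pos_iff.2 hz.1
    have h2 : 0 < nn (z.2, (1 : ℝ)) := by rw [nn_one_right]; exact jap_pos _
    rw [show (projE : Eu n × Eu n → Amb n) = fun z => un2 (lft 0 1 z) from
      (funext un2_lft_E).symm]
    exact ((contDiffAt_un2 h1 h2).comp z (contDiff_lft 0 1).contDiffAt).contDiffWithinAt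
  have hK : ContDiffOn ℝ ∞ K (coneE χ.source) := by
    intro z hz
    obtain ⟨O, F, hO, hpO, hF, he⟩ := hχ.smoothE _ (hmem z hz)
    have hp := hproj.contDiffAt (oE.mem_nhds hz)
    have hval : F (projE z) = χ (projE z) := (he ⟨hpO, hmem z hz⟩).symm
    have hchart : ContDiffAt ℝ ∞ (chartE : Amb n → _) (F (projE z)) := by
      have h0 : (F (projE z)).2.2 ≠ 0 := by rw [hval]; exact (himg z hz).2
      have h1 : ContDiffAt ℝ ∞ (fun p : Amb n => p.2.2) (F (projE z)) := by fun_prop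
      exact (by fun_prop : ContDiffAt ℝ ∞ (fun p : Amb n => p.1.1) _).prodMk
        ((h1.inv h0).smul (by fun_prop : ContDiffAt ℝ ∞ (fun p : Amb n => p.2.1) _))
    have hc : ContDiffAt ℝ ∞ (fun z => chartE (F (projE z))) z :=
      hchart.fun_comp z ((hF.contDiffAt (hO.mem_nhds hpO)).fun_comp z hp)
    refine (hc.congr_of_eventuallyEq ?_).contDiffWithinAt
    filter_upwards [oE.mem_nhds hz, hp.continuousAt.preimage_mem_nhds (hO.mem_nhds hpO)]
      with y hy hyO
    exact congrArg chartE (he ⟨hyO, hmem y hy⟩)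
  have hhom : ∀ (z : Eu n × Eu n) (t : ℝ), 0 < t →
      projE (t • z.1, z.2) = (projE z : Amb n) := by
    intro z t ht
    rw [← un2_lft_E, ← un2_lft_E]
    have h1 : ((t • z.1, 0) : Eu n × ℝ) = t • (z.1, 0) := by simp
    simp only [un2, lft, h1, un_smul ht]
  have hcone : ∀ z ∈ coneE χ.source, ∀ t : ℝ, 0 < t → (t • z.1, z.2) ∈ coneE χ.source :=
    fun z hz t ht => ⟨smul_ne_zero ht.ne' hz.1, by rw [hhom z t ht]; exact hz.2⟩
  obtain ⟨a, ha, hpos, hah, hs⟩ := exists_symplectic_of_contact oE hK (fun z hz => hz.1) hcone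
    (fun z hz t ht => congrArg (fun p => chartE (χ p)) (hhom z t ht)) fun z hz h1 => hc z hz h1
  refine ⟨fun z => (a z • (K z).1, (K z).2), ⟨(ha.smul hK.fst).prodMk hK.snd, fun z hz => ?_,
    fun z hz => ?_, fun z hz t ht => ?_⟩, hs⟩
  · exact smul_ne_zero (hpos z hz).ne' (projE_chartE (himg z hz).1 (himg z hz).2).1
  · have h1 := hhom (K z) (a z) (hpos z hz)
    exact h1.trans (projE_chartE (himg z hz).1 (himg z hz).2).2
  · have h1 : K (t • z.1, z.2) = K z := congrArg (fun p => chartE (χ p)) (hhom z t ht)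
    simp only [h1, hah z hz t ht, smul_smul]

/-- Exchanging x and ξ changes the sign of the form on both sides of the identity. -/
theorem isSymplecticOn_swap {n : ℕ} {C : Eu n × Eu n → Eu n × Eu n} {S : Set (Eu n × Eu n)}
    (hC : IsSymplecticOn C S) :
    IsSymplecticOn (fun z => (C z.swap).swap) (Prod.swap ⁻¹' S) := by
  intro z hz v w
  let e : (Eu n × Eu n) ≃L[ℝ] Eu n × Eu n := ContinuousLinearEquiv.prodComm ℝ (Eu n) (Eu n)
  have h : ∀ v, fderiv ℝ (fun z => (C z.swap).swap) z v = (fderiv ℝ C z.swap v.swap).swap := by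
    intro v
    have h1 : (fun z => (C z.swap).swap) = e ∘ (C ∘ e) := rfl
    rw [h1, e.comp_fderiv, e.comp_right_fderiv]
    rfl
  have h2 := hC z.swap hz v.swap w.swap
  simp only [h, Prod.fst_swap, Prod.snd_swap] at h2 ⊢
  linarith

/-- The mirror image of the exit case: the contact extension is applied after exchanging x and ξ,
and the result is exchanged back. -/
theorem exists_extPsi_of_contact {n : ℕ} {χ : PartialEquiv (Amb n) (Amb n)} (hχ : IsBdryDiffeo χ)
    (hc : IsContactPsi χ) (hne : ∀ p ∈ χ.source, p ∉ corner (Eu n) (Eu n)) :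
    ∃ Cpsi, IsHomExtPsi χ Cpsi ∧ IsSymplecticOn Cpsi (conePsi χ.source) := by
  have h10 : IsHeights 1 0 := ⟨zero_le_one, le_rfl, Or.inr rfl⟩
  have oP : IsOpen (conePsi χ.source) := by
    rw [conePsi_eq_gcone]; exact isOpen_gcone h10 hχ.source_open
  have hmem : ∀ z ∈ conePsi χ.source, projPsi z ∈ χ.source ∩ facePsi (Eu n) (Eu n) := by
    intro z hz
    refine ⟨hz.2, ?_⟩
    rw [← un2_lft_Psi]
    have h1 : 0 < nn (z.1, (1 : ℝ)) := by rw [nn_one_right]; exact jap_pos _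
    have h2 : 0 < nn (z.2, (0 : ℝ)) := by rw [nn_zero_right]; exact norm_pos_iff.2 hz.1
    exact un2_mem_facePsi h1 h2 zero_le_one rfl
  have himg : ∀ z ∈ conePsi χ.source,
      χ (projPsi z) ∈ facePsi (Eu n) (Eu n) ∧ (χ (projPsi z)).1.2 ≠ 0 := by
    intro z hz
    have h1 := hmem z hz
    have h2 := (hχ.facePsi_iff _ h1.1).2 h1.2
    refine ⟨h2, fun h0 => hne _ h1.1 ⟨(hχ.faceE_iff _ h1.1).1 ⟨h2.1, h2.2.1, h0⟩, h1.2⟩⟩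
  let K : Eu n × Eu n → Eu n × Eu n := fun z => chartPsi (χ (projPsi z))
  have hproj : ContDiffOn ℝ ∞ (projPsi : Eu n × Eu n → Amb n) (conePsi χ.source) := by
    intro z hz
    have h1 : 0 < nn (z.1, (1 : ℝ)) := by rw [nn_one_right]; exact jap_pos _
    have h2 : 0 < nn (z.2, (0 : ℝ)) := by rw [nn_zero_right]; exact norm_pos_iff.2 hz.1
    rw [show (projPsi : Eu n × Eu n → Amb n) = fun z => un2 (lft 1 0 z) from
      (funext un2_lft_Psi).symm]
    exact ((contDiffAt_un2 h1 h2).comp z (contDiff_lft 1 0).contDiffAt).contDiffWithinAt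
  have hK : ContDiffOn ℝ ∞ K (conePsi χ.source) := by
    intro z hz
    obtain ⟨O, F, hO, hpO, hF, he⟩ := hχ.smoothPsi _ (hmem z hz)
    have hp := hproj.contDiffAt (oP.mem_nhds hz)
    have hval : F (projPsi z) = χ (projPsi z) := (he ⟨hpO, hmem z hz⟩).symm
    have hchart : ContDiffAt ℝ ∞ (chartPsi : Amb n → _) (F (projPsi z)) := by
      have h0 : (F (projPsi z)).1.2 ≠ 0 := by rw [hval]; exact (himg z hz).2
      have h1 : ContDiffAt ℝ ∞ (fun p : Amb n => p.1.2) (F (projPsi z)) := by fun_prop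
      exact ((h1.inv h0).smul (by fun_prop : ContDiffAt ℝ ∞ (fun p : Amb n => p.1.1) _)).prodMk
        (by fun_prop : ContDiffAt ℝ ∞ (fun p : Amb n => p.2.1) _)
    have hc : ContDiffAt ℝ ∞ (fun z => chartPsi (F (projPsi z))) z :=
      hchart.fun_comp z ((hF.contDiffAt (hO.mem_nhds hpO)).fun_comp z hp)
    refine (hc.congr_of_eventuallyEq ?_).contDiffWithinAt
    filter_upwards [oP.mem_nhds hz, hp.continuousAt.preimage_mem_nhds (hO.mem_nhds hpO)]
      with y hy hyO
    exact congrArg chartPsi (he ⟨hyO, hmem y hy⟩)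
  have hhom : ∀ (z : Eu n × Eu n) (t : ℝ), 0 < t →
      projPsi (z.1, t • z.2) = (projPsi z : Amb n) := by
    intro z t ht
    rw [← un2_lft_Psi, ← un2_lft_Psi]
    have h1 : ((t • z.2, 0) : Eu n × ℝ) = t • (z.2, 0) := by simp
    simp only [un2, lft, h1, un_smul ht]
  have hcone : ∀ z ∈ conePsi χ.source, ∀ t : ℝ, 0 < t → (z.1, t • z.2) ∈ conePsi χ.source :=
    fun z hz t ht => ⟨smul_ne_zero ht.ne' hz.1, by rw [hhom z t ht]; exact hz.2⟩
  let e : (Eu n × Eu n) ≃L[ℝ] Eu n × Eu n := ContinuousLinearEquiv.prodComm ℝ (Eu n) (Eu n)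
  have oP' : IsOpen (Prod.swap ⁻¹' conePsi χ.source) := oP.preimage continuous_swap
  have hK' : ContDiffOn ℝ ∞ (fun z => (K z.swap).swap) (Prod.swap ⁻¹' conePsi χ.source) := by
    have h1 : ContDiffOn ℝ ∞ (fun z => K z.swap) (Prod.swap ⁻¹' conePsi χ.source) :=
      hK.comp e.contDiff.contDiffOn fun z hz => hz
    exact h1.snd.prodMk h1.fst
  obtain ⟨a, ha, hpos, hah, hs⟩ := exists_symplectic_of_contact oP' hK' (fun z hz => hz.1)
    (fun z hz t ht => hcone z.swap hz t ht)
    (fun z hz t ht => congrArg (fun p => (chartPsi (χ p)).swap) (hhom z.swap t ht))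
    fun z hz h1 => by
      obtain ⟨g, hg, h⟩ := hc z.swap hz h1
      refine ⟨g, hg, fun v hv => ?_⟩
      have h2 : (fun z => (K z.swap).swap) = e ∘ (K ∘ e) := rfl
      have h3 : fderiv ℝ (fun z => (K z.swap).swap) z v = (fderiv ℝ K z.swap v.swap).swap := by
        rw [h2, e.comp_fderiv, e.comp_right_fderiv]
        rfl
      rw [h3]
      exact h v.swap hv
  have hs' := isSymplecticOn_swap hs
  refine ⟨fun z => ((K z).1, a z.swap • (K z).2), ⟨?_, fun z hz => ?_, fun z hz => ?_,
    fun z hz t ht => ?_⟩, hs'⟩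
  · exact hK.fst.prodMk ((ha.comp e.contDiff.contDiffOn fun z hz => hz).smul hK.snd)
  · exact smul_ne_zero (hpos z.swap hz).ne' (projPsi_chartPsi (himg z hz).1 (himg z hz).2).1
  · have h1 := hhom (K z) (a z.swap) (hpos z.swap hz)
    exact h1.trans (projPsi_chartPsi (himg z hz).1 (himg z hz).2).2
  · have h1 : K (z.1, t • z.2) = K z := congrArg (fun p => chartPsi (χ p)) (hhom z t ht)
    have h2 := hah z.swap hz t ht
    simp only [Prod.fst_swap, Prod.snd_swap] at h2
    simp only [h1, Prod.swap_prod_mk, h2, smul_smul]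

-- Without corner points the two faces are separated in the source, so Y and Z may be prescribed on
-- each independently. The factors `p.1.2` and `p.2.2` equal ⟨x⟩⁻¹ and ⟨ξ⟩⁻¹ and undo the brackets
-- in `gmap`.
open Classical in
theorem exists_homData_of_no_corner {n : ℕ} {χ : PartialEquiv (Amb n) (Amb n)}
    (hχ : IsSCT χ) (hne : ∀ p ∈ χ.source, p ∉ corner (Eu n) (Eu n)) :
    ∃ Y Z : Amb n → Eu n, HomData χ Y Z := by
  obtain ⟨Ce, hE, sE⟩ := exists_extE_of_contact hχ.diffeo hχ.contactE hne
  obtain ⟨Cpsi, hP, sP⟩ := exists_extPsi_of_contact hχ.diffeo hχ.contactPsi hne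
  have h01 : IsHeights 0 1 := ⟨le_rfl, zero_le_one, Or.inl rfl⟩
  have h10 : IsHeights 1 0 := ⟨zero_le_one, le_rfl, Or.inr rfl⟩
  have oE : IsOpen (coneE χ.source) := by
    rw [coneE_eq_gcone]; exact isOpen_gcone h01 hχ.diffeo.source_open
  have oP : IsOpen (conePsi χ.source) := by
    rw [conePsi_eq_gcone]; exact isOpen_gcone h10 hχ.diffeo.source_open
  let Y : Amb n → Eu n := fun p =>
    if p ∈ faceE (Eu n) (Eu n) then (Ce (chartE p)).1 else p.1.2 • (Cpsi (chartPsi p)).1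
  let Z : Amb n → Eu n := fun p =>
    if p ∈ faceE (Eu n) (Eu n) then p.2.2 • (Ce (chartE p)).2 else (Cpsi (chartPsi p)).2
  let OE : Set (Amb n) := {p | p.2.2 ≠ 0} ∩ chartE ⁻¹' coneE χ.source
  let OP : Set (Amb n) := {p | p.1.2 ≠ 0} ∩ chartPsi ⁻¹' conePsi χ.source
  have cE : ContDiffOn ℝ ∞ (chartE : Amb n → _) {p | p.2.2 ≠ 0} := by
    have h1 : ContDiffOn ℝ ∞ (fun p : Amb n => p.2.2) {p | p.2.2 ≠ 0} := by fun_prop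
    exact (by fun_prop : ContDiffOn ℝ ∞ (fun p : Amb n => p.1.1) _).prodMk
      ((h1.inv fun p hp => hp).smul (by fun_prop : ContDiffOn ℝ ∞ (fun p : Amb n => p.2.1) _))
  have cP : ContDiffOn ℝ ∞ (chartPsi : Amb n → _) {p | p.1.2 ≠ 0} := by
    have h1 : ContDiffOn ℝ ∞ (fun p : Amb n => p.1.2) {p | p.1.2 ≠ 0} := by fun_prop
    exact ((h1.inv fun p hp => hp).smul (by fun_prop : ContDiffOn ℝ ∞ (fun p : Amb n => p.1.1) _)).prodMk
      (by fun_prop : ContDiffOn ℝ ∞ (fun p : Amb n => p.2.1) _)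
  have hOE : IsOpen OE := cE.continuousOn.isOpen_inter_preimage
    (isOpen_ne_fun (by fun_prop) continuous_const) oE
  have hOP : IsOpen OP := cP.continuousOn.isOpen_inter_preimage
    (isOpen_ne_fun (by fun_prop) continuous_const) oP
  have memE : ∀ p ∈ χ.source ∩ faceE (Eu n) (Eu n), p ∈ OE := fun p hp => by
    have h2 : p.2.2 ≠ 0 := fun h0 => hne p hp.1 ⟨hp.2, hp.2.1, hp.2.2.1, h0⟩
    obtain ⟨h3, h4⟩ := projE_chartE hp.2 h2
    exact ⟨h2, h3, by rw [h4]; exact hp.1⟩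
  have notE : ∀ p ∈ χ.source ∩ facePsi (Eu n) (Eu n), p ∉ faceE (Eu n) (Eu n) :=
    fun p hp h => hne p hp.1 ⟨h, hp.2⟩
  have memP : ∀ p ∈ χ.source ∩ facePsi (Eu n) (Eu n), p ∈ OP := fun p hp => by
    have h2 : p.1.2 ≠ 0 := fun h0 => notE p hp ⟨hp.2.1, hp.2.2.1, h0⟩
    obtain ⟨h3, h4⟩ := projPsi_chartPsi hp.2 h2
    exact ⟨h2, h3, by rw [h4]; exact hp.1⟩
  have sCE : ContDiffOn ℝ ∞ (fun p : Amb n => Ce (chartE p)) OE :=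
    hE.smooth.comp (cE.mono inter_subset_left) fun p hp => hp.2
  have sCP : ContDiffOn ℝ ∞ (fun p : Amb n => Cpsi (chartPsi p)) OP :=
    hP.smooth.comp (cP.mono inter_subset_left) fun p hp => hp.2
  have fE : ∀ z ∈ coneE χ.source, projE z ∈ faceE (Eu n) (Eu n) := fun z hz => by
    rw [← un2_lft_E]
    have h1 : 0 < nn (z.1, (0 : ℝ)) := by rw [nn_zero_right]; exact norm_pos_iff.2 hz.1
    have h2 : 0 < nn (z.2, (1 : ℝ)) := by rw [nn_one_right]; exact jap_pos _
    exact un2_mem_faceE h1 h2 rfl zero_le_one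
  refine ⟨Y, Z, homData_of_extensions hχ.diffeo ?_ ?_ ?_ ?_ hE hP sE sP ?_ ?_ ?_⟩
  · exact fun p hp => ⟨OE, _, hOE, memE p hp, sCE.fst, fun q hq => if_pos hq.2.2⟩
  · exact fun p hp => ⟨OP, fun q => q.1.2 • (Cpsi (chartPsi q)).1, hOP, memP p hp,
      (by fun_prop : ContDiffOn ℝ ∞ (fun q : Amb n => q.1.2) OP).smul sCP.fst,
      fun q hq => if_neg (notE q hq.2)⟩
  · exact fun p hp => ⟨OE, fun q => q.2.2 • (Ce (chartE q)).2, hOE, memE p hp,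
      (by fun_prop : ContDiffOn ℝ ∞ (fun q : Amb n => q.2.2) OE).smul sCE.snd,
      fun q hq => if_pos hq.2.2⟩
  · exact fun p hp => ⟨OP, _, hOP, memP p hp, sCP.snd, fun q hq => if_neg (notE q hq.2)⟩
  · intro z hz
    have hx := norm_ne_zero_iff.2 hz.1
    have hj := (jap_pos z.2).ne'
    have h1 : chartE (projE z : Amb n) = (‖z.1‖⁻¹ • z.1, z.2) := by
      simp [chartE, projE, atInf, radComp, smul_smul, hj]
    have h2 := hE.homog z hz ‖z.1‖⁻¹ (inv_pos.2 (norm_pos_iff.2 hz.1))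
    have h3 : (projE z : Amb n).2.2 = (jap z.2)⁻¹ := rfl
    simp only [gmap, un2_lft_E, Y, Z, if_pos (fE z hz), h1, h2, h3, nn_zero_right, nn_one_right,
      smul_smul, mul_inv_cancel₀ hx, mul_inv_cancel₀ hj, one_smul]
  · intro z hz
    have hx := norm_ne_zero_iff.2 hz.1
    have hj := (jap_pos z.1).ne'
    have h1 : chartPsi (projPsi z : Amb n) = (z.1, ‖z.2‖⁻¹ • z.2) := by
      simp [chartPsi, projPsi, atInf, radComp, smul_smul, hj]
    have h2 := hP.homog z hz ‖z.2‖⁻¹ (inv_pos.2 (norm_pos_iff.2 hz.1))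
    have h3 : (projPsi z : Amb n).1.2 = (jap z.1)⁻¹ := rfl
    have h4 : (projPsi z : Amb n) ∉ faceE (Eu n) (Eu n) := fun h => by
      have := h.2.2
      rw [h3] at this
      exact inv_ne_zero hj this
    simp only [gmap, un2_lft_Psi, Y, Z, if_neg h4, h1, h2, h3, nn_zero_right, nn_one_right,
      smul_smul, mul_inv_cancel₀ hx, mul_inv_cancel₀ hj, one_smul]
  · exact fun p hp => absurd hp.2 (hne p hp.1)

/-- The homogeneous symplectic extensions of a scattering canonical transformation. -/
theorem exists_homData {n : ℕ} {χ : PartialEquiv (Amb n) (Amb n)} (hχ : IsSCT χ) :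
    ∃ Y Z : Amb n → Eu n, HomData χ Y Z := by
  by_cases h : (χ.source ∩ corner (Eu n) (Eu n)).Nonempty
  · exact exists_homData_of_preservesPoisson hχ.diffeo (hχ.preservesPoisson h)
  · exact exists_homData_of_no_corner hχ fun p hp hc => h ⟨p, hp, hc⟩

/-! ### Phase functions parametrising the graph of a symplectic map -/

instance eu2ContinuousSMul (n : ℕ) : ContinuousSMul ℝ (Eu2 n) :=
  IsBoundedSMul.continuousSMul (α := ℝ) (β := Eu2 n)

/-! ### Splitting of the variables (x, y) and θ = (θ₁, θ₂) -/

section Coordinates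

variable {n N : ℕ}

/-- The coordinate `x` on `ℝ²ⁿ × ℝᴺ`. -/
def coordX (n N : ℕ) : Eu2 n × Eu N →L[ℝ] Eu n :=
  (WithLp.fstL 2 ℝ (Eu n) (Eu n)).comp (ContinuousLinearMap.fst ℝ _ _)

/-- The coordinate `y` on `ℝ²ⁿ × ℝᴺ`. -/
def coordY (n N : ℕ) : Eu2 n × Eu N →L[ℝ] Eu n :=
  (WithLp.sndL 2 ℝ (Eu n) (Eu n)).comp (ContinuousLinearMap.fst ℝ _ _)

/-- The first half of the fibre variables. -/
def fibA (ι : Eu N ≃ₗᵢ[ℝ] Eu2 n) : Eu N →L[ℝ] Eu n :=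
  (WithLp.fstL 2 ℝ (Eu n) (Eu n)).comp (ι : Eu N →L[ℝ] Eu2 n)

/-- The second half of the fibre variables. -/
def fibB (ι : Eu N ≃ₗᵢ[ℝ] Eu2 n) : Eu N →L[ℝ] Eu n :=
  (WithLp.sndL 2 ℝ (Eu n) (Eu n)).comp (ι : Eu N →L[ℝ] Eu2 n)

/-- The second half of the fibre variables, as a coordinate on `ℝ²ⁿ × ℝᴺ`. -/
def coordB (ι : Eu N ≃ₗᵢ[ℝ] Eu2 n) : Eu2 n × Eu N →L[ℝ] Eu n :=
  (fibB ι).comp (ContinuousLinearMap.snd ℝ _ _)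

theorem fib_ext (ι : Eu N ≃ₗᵢ[ℝ] Eu2 n) {θ θ' : Eu N} (hA : fibA ι θ = fibA ι θ')
    (hB : fibB ι θ = fibB ι θ') : θ = θ' :=
  ι.injective (WithLp.ofLp_injective 2 (Prod.ext hA hB))

theorem inner_fib (ι : Eu N ≃ₗᵢ[ℝ] Eu2 n) (θ θ' : Eu N) :
    inner ℝ θ θ' = inner ℝ (fibA ι θ) (fibA ι θ') + inner ℝ (fibB ι θ) (fibB ι θ') := by
  rw [← ι.inner_map_map, WithLp.prod_inner_apply]; rfl

theorem norm_fib_sq (ι : Eu N ≃ₗᵢ[ℝ] Eu2 n) (θ : Eu N) :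
    ‖θ‖ ^ 2 = ‖fibA ι θ‖ ^ 2 + ‖fibB ι θ‖ ^ 2 := by
  simp only [← real_inner_self_eq_norm_sq, inner_fib ι θ θ]

theorem exists_fib (ι : Eu N ≃ₗᵢ[ℝ] Eu2 n) (a b : Eu n) :
    ∃ θ : Eu N, fibA ι θ = a ∧ fibB ι θ = b := by
  refine ⟨ι.symm (WithLp.toLp 2 (a, b)), ?_, ?_⟩
  · change (ι (ι.symm _)).fst = a
    rw [ι.apply_symm_apply]; rfl
  · change (ι (ι.symm _)).snd = b
    rw [ι.apply_symm_apply]; rfl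

theorem eu2_ext {b b' : Eu2 n} (h1 : b.fst = b'.fst) (h2 : b.snd = b'.snd) : b = b' :=
  WithLp.ofLp_injective 2 (Prod.ext h1 h2)

end Coordinates

/-- The phase function `⟨θ₂, x - X⟩ - ⟨H(u), y - Y(u)⟩ + s(u) + (τ m/2) |x - X|²`, where
`u = (X, θ₂)`, `C = (Y, H)` and `ds = ⟨ξ, dx⟩ - ⟨H, dY⟩`. -/
structure PhaseModel {n N : ℕ} (ι : Eu N ≃ₗᵢ[ℝ] Eu2 n) (S : Set (Eu2 n × Eu N))
    (D : Set (Eu n × Eu n)) (C : Eu n × Eu n → Eu n × Eu n) (s : Eu n × Eu n → ℝ) (τ : ℝ)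
    (X : Eu2 n × Eu N → Eu n) (m : Eu2 n × Eu N → ℝ) (φ : Eu2 n × Eu N → ℝ) : Prop where
  isOpen_dom : IsOpen S
  isOpen_base : IsOpen D
  smoothC : ContDiffOn ℝ ∞ C D
  smooth_s : ContDiffOn ℝ ∞ s D
  ds : ∀ u ∈ D, ∀ d, fderiv ℝ s u d = inner ℝ u.2 d.1 - inner ℝ (C u).2 (fderiv ℝ C u d).1
  smoothX : ContDiffOn ℝ ∞ X S
  smooth_m : ContDiffOn ℝ ∞ m S
  mem : ∀ z ∈ S, (X z, coordB ι z) ∈ D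
  eq : ∀ z ∈ S, φ z = inner ℝ (coordB ι z) (coordX n N z - X z)
    - inner ℝ (C (X z, coordB ι z)).2 (coordY n N z - (C (X z, coordB ι z)).1)
    + s (X z, coordB ι z) + τ / 2 * m z * ‖coordX n N z - X z‖ ^ 2
  injective : ∀ z ∈ S, ∀ δ : Eu N,
    fibB ι δ - (τ * m z) • fderiv ℝ X z (0, δ)
      + (τ / 2 * fderiv ℝ m z (0, δ)) • (coordX n N z - X z) = 0 →
    (fderiv ℝ C (X z, coordB ι z) (fderiv ℝ X z (0, δ), fibB ι δ)).2 = 0 → δ = 0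
  horizontal : ∀ z ∈ S, ∀ b : Eu2 n, ∃ δ : Eu N, fibB ι δ = 0 ∧ fderiv ℝ X z (b, δ) = 0
  finrank_eq : N = n + n

/-! ### Critical set and non-degeneracy of the model phase -/

namespace PhaseModel

variable {n N : ℕ} {ι : Eu N ≃ₗᵢ[ℝ] Eu2 n} {S : Set (Eu2 n × Eu N)}
  {D : Set (Eu n × Eu n)} {C : Eu n × Eu n → Eu n × Eu n} {s : Eu n × Eu n → ℝ} {τ : ℝ}
  {X : Eu2 n × Eu N → Eu n} {m : Eu2 n × Eu N → ℝ} {φ : Eu2 n × Eu N → ℝ}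

theorem contDiffOn_base (h : PhaseModel ι S D C s τ X m φ) :
    ContDiffOn ℝ ∞ (fun z => (X z, coordB ι z)) S :=
  h.smoothX.prodMk (coordB ι).contDiff.contDiffOn

theorem contDiffOn_comp (h : PhaseModel ι S D C s τ X m φ) :
    ContDiffOn ℝ ∞ (fun z => C (X z, coordB ι z)) S :=
  h.smoothC.comp h.contDiffOn_base h.mem

theorem contDiffOn (h : PhaseModel ι S D C s τ X m φ) : ContDiffOn ℝ ∞ φ S := by
  have hs : ContDiffOn ℝ ∞ (fun z => s (X z, coordB ι z)) S :=
    h.smooth_s.comp h.contDiffOn_base h.mem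
  have hx : ContDiffOn ℝ ∞ (fun z => coordX n N z - X z) S :=
    (coordX n N).contDiff.contDiffOn.sub h.smoothX
  have hy : ContDiffOn ℝ ∞ (fun z => coordY n N z - (C (X z, coordB ι z)).1) S :=
    (coordY n N).contDiff.contDiffOn.sub h.contDiffOn_comp.fst
  refine ContDiffOn.congr ?_ h.eq
  exact ((((coordB ι).contDiff.contDiffOn.inner ℝ hx).sub
    (h.contDiffOn_comp.snd.inner ℝ hy)).add hs).add
    ((contDiffOn_const.mul h.smooth_m).mul (hx.norm_sq ℝ))

theorem fderiv_comp_apply (h : PhaseModel ι S D C s τ X m φ) {z : Eu2 n × Eu N} (hz : z ∈ S) :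
    HasFDerivAt (fun z => C (X z, coordB ι z))
      ((fderiv ℝ C (X z, coordB ι z)).comp ((fderiv ℝ X z).prod (coordB ι))) z := by
  have hX : HasFDerivAt X (fderiv ℝ X z) z :=
    ((h.smoothX.contDiffAt (h.isOpen_dom.mem_nhds hz)).differentiableAt (by simp)).hasFDerivAt
  have hC : HasFDerivAt C (fderiv ℝ C (X z, coordB ι z)) (X z, coordB ι z) :=
    ((h.smoothC.contDiffAt (h.isOpen_base.mem_nhds (h.mem z hz))).differentiableAt
      (by simp)).hasFDerivAt
  exact HasFDerivAt.comp (g := C) (f := fun z => (X z, coordB ι z)) z hC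
    (hX.prodMk (coordB ι).hasFDerivAt)

/-- The primitive s is chosen so that -⟨θ₂, dX⟩ + ⟨H, dY⟩ + ds = 0. Apart from ⟨θ₂, dx⟩ - ⟨H, dy⟩,
every remaining term carries a factor x - X or y - Y(u). -/
theorem fderiv_apply (h : PhaseModel ι S D C s τ X m φ) {z : Eu2 n × Eu N} (hz : z ∈ S)
    (d : Eu2 n × Eu N) :
    fderiv ℝ φ z d = inner ℝ (coordX n N z - X z) (coordB ι d)
      + inner ℝ (coordB ι z) (coordX n N d)
      - inner ℝ (C (X z, coordB ι z)).2 (coordY n N d)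
      - inner ℝ (coordY n N z - (C (X z, coordB ι z)).1)
          (fderiv ℝ C (X z, coordB ι z) (fderiv ℝ X z d, coordB ι d)).2
      + τ / 2 * fderiv ℝ m z d * ‖coordX n N z - X z‖ ^ 2
      + τ * m z * inner ℝ (coordX n N z - X z) (coordX n N d - fderiv ℝ X z d) := by
  have hX : HasFDerivAt X (fderiv ℝ X z) z :=
    ((h.smoothX.contDiffAt (h.isOpen_dom.mem_nhds hz)).differentiableAt (by simp)).hasFDerivAt
  have hm : HasFDerivAt m (fderiv ℝ m z) z :=
    ((h.smooth_m.contDiffAt (h.isOpen_dom.mem_nhds hz)).differentiableAt (by simp)).hasFDerivAt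
  have hs : HasFDerivAt s (fderiv ℝ s (X z, coordB ι z)) (X z, coordB ι z) :=
    ((h.smooth_s.contDiffAt (h.isOpen_base.mem_nhds (h.mem z hz))).differentiableAt
      (by simp)).hasFDerivAt
  have hsu : HasFDerivAt (fun z => s (X z, coordB ι z))
      ((fderiv ℝ s (X z, coordB ι z)).comp ((fderiv ℝ X z).prod (coordB ι))) z :=
    HasFDerivAt.comp (g := s) (f := fun z => (X z, coordB ι z)) z hs
      (hX.prodMk (coordB ι).hasFDerivAt)
  have hC := h.fderiv_comp_apply hz
  have hw := (coordX n N).hasFDerivAt.fun_sub hX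
  have hzz := (coordY n N).hasFDerivAt.fun_sub hC.fst
  have key := (((((coordB ι).hasFDerivAt.inner ℝ hw).fun_sub (hC.snd.inner ℝ hzz)).fun_add
    hsu).fun_add ((hm.const_mul (τ / 2)).fun_mul hw.norm_sq))
  have hφ := key.congr_of_eventuallyEq (f₁ := φ) (by
    filter_upwards [h.isOpen_dom.mem_nhds hz] with y hy
    exact h.eq y hy)
  rw [hφ.fderiv]
  have hds := h.ds _ (h.mem z hz) (fderiv ℝ X z d, coordB ι d)
  simp only [add_apply, sub_apply, smul_apply, ContinuousLinearMap.comp_apply,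
    ContinuousLinearMap.prod_apply, fderivInnerCLM_apply, hds, ContinuousLinearMap.coe_fst',
    ContinuousLinearMap.coe_snd', innerSL_apply_apply, inner_sub_right, inner_sub_left, smul_eq_mul,
    nsmul_eq_mul, Nat.cast_ofNat]
  rw [real_inner_comm (coordX n N z) (coordB ι d), real_inner_comm (X z) (coordB ι d),
    real_inner_comm (coordY n N z), real_inner_comm (C (X z, coordB ι z)).1]
  ring

/-- The differential along the fibres. -/
theorem fderiv_fibre (h : PhaseModel ι S D C s τ X m φ) {z : Eu2 n × Eu N} (hz : z ∈ S)
    (δ : Eu N) :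
    fderiv ℝ φ z (0, δ) = inner ℝ (coordX n N z - X z)
        (fibB ι δ - (τ * m z) • fderiv ℝ X z (0, δ)
          + (τ / 2 * fderiv ℝ m z (0, δ)) • (coordX n N z - X z))
      - inner ℝ (coordY n N z - (C (X z, coordB ι z)).1)
          (fderiv ℝ C (X z, coordB ι z) (fderiv ℝ X z (0, δ), fibB ι δ)).2 := by
  have h1 : coordX n N ((0, δ) : Eu2 n × Eu N) = 0 := rfl
  have h2 : coordY n N ((0, δ) : Eu2 n × Eu N) = 0 := rfl
  have h3 : coordB ι ((0, δ) : Eu2 n × Eu N) = fibB ι δ := rfl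
  rw [h.fderiv_apply hz, h1, h2, h3]
  simp only [inner_add_right, inner_sub_right, inner_smul_right, inner_zero_right]
  simp only [← real_inner_self_eq_norm_sq, inner_sub_left, inner_sub_right]
  ring

/-- The linear map occurring in `fderiv_fibre`. -/
def fibreMap (ι : Eu N ≃ₗᵢ[ℝ] Eu2 n) (C : Eu n × Eu n → Eu n × Eu n) (τ : ℝ)
    (X : Eu2 n × Eu N → Eu n) (m : Eu2 n × Eu N → ℝ) (z : Eu2 n × Eu N) :
    Eu N →L[ℝ] Eu n × Eu n :=
  (fibB ι - (τ * m z) • (fderiv ℝ X z).comp (ContinuousLinearMap.inr ℝ _ _)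
    + ((τ / 2) • (fderiv ℝ m z).comp (ContinuousLinearMap.inr ℝ _ _)).smulRight
      (coordX n N z - X z)).prod
  ((ContinuousLinearMap.snd ℝ _ _).comp ((fderiv ℝ C (X z, coordB ι z)).comp
    (((fderiv ℝ X z).comp (ContinuousLinearMap.inr ℝ _ _)).prod (fibB ι))))

theorem fibreMap_apply (z : Eu2 n × Eu N) (δ : Eu N) : fibreMap ι C τ X m z δ =
    (fibB ι δ - (τ * m z) • fderiv ℝ X z (0, δ)
      + (τ / 2 * fderiv ℝ m z (0, δ)) • (coordX n N z - X z),
    (fderiv ℝ C (X z, coordB ι z) (fderiv ℝ X z (0, δ), fibB ι δ)).2) := rfl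

theorem fibreMap_bijective (h : PhaseModel ι S D C s τ X m φ) {z : Eu2 n × Eu N} (hz : z ∈ S) :
    Function.Injective (fibreMap ι C τ X m z) ∧ Function.Surjective (fibreMap ι C τ X m z) := by
  have h1 : Function.Injective (fibreMap ι C τ X m z) := by
    rw [injective_iff_map_eq_zero]
    intro δ hδ
    exact h.injective z hz δ (congrArg Prod.fst hδ) (congrArg Prod.snd hδ)
  refine ⟨h1, (LinearMap.injective_iff_surjective_of_finrank_eq_finrank
    (f := (fibreMap ι C τ X m z).toLinearMap) ?_).1 h1⟩
  simp [h.finrank_eq]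

/-- The fibre derivative pairs the vector (x - X, -(y - Y)) with the image of δ under `fibreMap`. By
surjectivity some δ is mapped to that very vector, and the derivative along it is ‖x - X‖² + ‖y -
Y‖². -/
theorem crit_iff (h : PhaseModel ι S D C s τ X m φ) {z : Eu2 n × Eu N} (hz : z ∈ S) :
    (∀ δ : Eu N, fderiv ℝ φ z (0, δ) = 0) ↔
      coordX n N z = X z ∧ coordY n N z = (C (X z, coordB ι z)).1 := by
  refine ⟨fun h0 => ?_, fun h0 δ => ?_⟩
  · obtain ⟨δ, hδ⟩ := (h.fibreMap_bijective hz).2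
      (coordX n N z - X z, -(coordY n N z - (C (X z, coordB ι z)).1))
    have h1 := h.fderiv_fibre hz δ
    have h2 := congrArg Prod.fst hδ
    have h3 := congrArg Prod.snd hδ
    rw [fibreMap_apply] at h2 h3
    dsimp only at h2 h3
    rw [h0 δ, h2, h3, inner_neg_right, sub_neg_eq_add, real_inner_self_eq_norm_sq,
      real_inner_self_eq_norm_sq] at h1
    have h4 : ‖coordX n N z - X z‖ = 0 := by nlinarith [norm_nonneg (coordX n N z - X z)]
    have h5 : ‖coordY n N z - (C (X z, coordB ι z)).1‖ = 0 := by
      nlinarith [norm_nonneg (coordY n N z - (C (X z, coordB ι z)).1)]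
    exact ⟨sub_eq_zero.1 (norm_eq_zero.1 h4), sub_eq_zero.1 (norm_eq_zero.1 h5)⟩
  · rw [h.fderiv_fibre hz, h0.1, h0.2, sub_self, sub_self, inner_zero_left, inner_zero_left,
      sub_zero]

theorem fderiv_of_crit (h : PhaseModel ι S D C s τ X m φ) {z : Eu2 n × Eu N} (hz : z ∈ S)
    (h1 : coordX n N z = X z) (h2 : coordY n N z = (C (X z, coordB ι z)).1) (d : Eu2 n × Eu N) :
    fderiv ℝ φ z d = inner ℝ (coordB ι z) (coordX n N d)
      - inner ℝ (C (X z, coordB ι z)).2 (coordY n N d) := by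
  rw [h.fderiv_apply hz, h1, h2]
  simp

/-- On the critical set only ⟨θ₂, dx⟩ - ⟨H, dy⟩ is left of dφ, hence ∂ₓφ = θ₂ and -∂_yφ = H. -/
theorem graphMap_of_crit (h : PhaseModel ι S D C s τ X m φ) {z : Eu2 n × Eu N} (hz : z ∈ S)
    (h1 : coordX n N z = X z) (h2 : coordY n N z = (C (X z, coordB ι z)).1) :
    graphMap φ z = ((coordX n N z, coordB ι z), C (coordX n N z, coordB ι z)) := by
  have hd : HasFDerivAt (fun b => φ (b, z.2))
      ((fderiv ℝ φ z).comp (ContinuousLinearMap.inl ℝ _ _)) z.1 := by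
    have h3 : HasFDerivAt φ (fderiv ℝ φ z) (z.1, z.2) :=
      ((h.contDiffOn.contDiffAt (h.isOpen_dom.mem_nhds hz)).differentiableAt (by simp)).hasFDerivAt
    exact HasFDerivAt.comp (g := φ) (f := fun b => (b, z.2)) z.1 h3
      (hasFDerivAt_prodMk_left z.1 z.2)
  have hg : gradient (fun b => φ (b, z.2)) z.1
      = WithLp.toLp 2 (coordB ι z, -(C (X z, coordB ι z)).2) := by
    refine ext_inner_right ℝ fun b => ?_
    rw [inner_gradient_left, hd.fderiv, WithLp.prod_inner_apply, inner_neg_left]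
    exact (h.fderiv_of_crit hz h1 h2 (b, 0)).trans (sub_eq_add_neg _ _)
  rw [graphMap, hg, h1]
  refine Prod.ext (Prod.ext h1 rfl) (Prod.ext h2 (neg_neg _))

theorem hasFDerivAt_inner_of_eq_zero {G H : Type*} [NormedAddCommGroup G] [NormedSpace ℝ G]
    [NormedAddCommGroup H] [InnerProductSpace ℝ H] {a b : G → H} {a' : G →L[ℝ] H} {z : G}
    (ha : HasFDerivAt a a' z) (hb : DifferentiableAt ℝ b z) (h0 : a z = 0) :
    HasFDerivAt (fun z => inner ℝ (a z) (b z) : G → ℝ) ((innerSL ℝ (b z)).comp a') z := by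
  have h1 := ha.inner ℝ hb.hasFDerivAt
  have h2 : (fderivInnerCLM ℝ (a z, b z)).comp (a'.prod (fderiv ℝ b z))
      = (innerSL ℝ (b z)).comp a' := by
    ext d
    simp [h0, real_inner_comm]
  rwa [h2] at h1

/-- The fibre derivative is a sum of products with factors x - X and y - Y that vanish here, so only
these factors get differentiated. A linear relation with coefficients g then says that the fibre map
of g annihilates all (dx - dX, dy - dY), up to the sign in the second slot. -/
theorem nondegenerate (h : PhaseModel ι S D C s τ X m φ) {z : Eu2 n × Eu N} (hz : z ∈ S)
    (h1 : coordX n N z = X z) (h2 : coordY n N z = (C (X z, coordB ι z)).1) :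
    LinearIndependent ℝ (fun j : Fin N =>
      fderiv ℝ (fun z' => fderiv ℝ φ z' (0, EuclideanSpace.single j 1)) z) := by
  have hX : HasFDerivAt X (fderiv ℝ X z) z :=
    ((h.smoothX.contDiffAt (h.isOpen_dom.mem_nhds hz)).differentiableAt (by simp)).hasFDerivAt
  have hC := h.fderiv_comp_apply hz
  have hw := (coordX n N).hasFDerivAt.fun_sub hX
  have hzz := (coordY n N).hasFDerivAt.fun_sub hC.fst
  have hXd : DifferentiableAt ℝ (fderiv ℝ X) z :=
    ((h.smoothX.contDiffAt (h.isOpen_dom.mem_nhds hz)).fderiv_right (m := 1)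
      (by norm_cast)).differentiableAt (by simp)
  have hmd : DifferentiableAt ℝ (fderiv ℝ m) z :=
    ((h.smooth_m.contDiffAt (h.isOpen_dom.mem_nhds hz)).fderiv_right (m := 1)
      (by norm_cast)).differentiableAt (by simp)
  have hm : DifferentiableAt ℝ m z :=
    (h.smooth_m.contDiffAt (h.isOpen_dom.mem_nhds hz)).differentiableAt (by simp)
  have hCd : DifferentiableAt ℝ (fun z => fderiv ℝ C (X z, coordB ι z)) z := by
    have a1 : DifferentiableAt ℝ (fderiv ℝ C) (X z, coordB ι z) :=
      ((h.smoothC.contDiffAt (h.isOpen_base.mem_nhds (h.mem z hz))).fderiv_right (m := 1)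
        (by norm_cast)).differentiableAt (by simp)
    exact DifferentiableAt.comp (g := fderiv ℝ C) (f := fun z => (X z, coordB ι z)) z a1
      (hX.differentiableAt.prodMk (coordB ι).differentiableAt)
  have key : ∀ δ : Eu N, HasFDerivAt (fun z' => fderiv ℝ φ z' (0, δ))
      ((innerSL ℝ (fibreMap ι C τ X m z δ).1).comp (coordX n N - fderiv ℝ X z)
        - (innerSL ℝ (fibreMap ι C τ X m z δ).2).comp (coordY n N
          - (ContinuousLinearMap.fst ℝ _ _).comp ((fderiv ℝ C (X z, coordB ι z)).comp
            ((fderiv ℝ X z).prod (coordB ι))))) z := by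
    intro δ
    have hA : DifferentiableAt ℝ (fun z => (fibreMap ι C τ X m z δ).1) z := by
      simp only [fibreMap_apply]
      have := hXd.clm_apply (differentiableAt_const ((0, δ) : Eu2 n × Eu N))
      have h4 := hmd.clm_apply (differentiableAt_const ((0, δ) : Eu2 n × Eu N))
      exact ((differentiableAt_const _).sub ((hm.const_mul τ).smul this)).add
        ((h4.const_mul _).smul hw.differentiableAt)
    have hB : DifferentiableAt ℝ (fun z => (fibreMap ι C τ X m z δ).2) z := by
      simp only [fibreMap_apply]
      have := hXd.clm_apply (differentiableAt_const ((0, δ) : Eu2 n × Eu N))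
      exact (hCd.clm_apply (this.prodMk (differentiableAt_const (fibB ι δ)))).snd
    refine ((hasFDerivAt_inner_of_eq_zero hw hA (sub_eq_zero.2 h1)).fun_sub
      (hasFDerivAt_inner_of_eq_zero hzz hB (sub_eq_zero.2 h2))).congr_of_eventuallyEq ?_
    filter_upwards [h.isOpen_dom.mem_nhds hz] with y hy
    exact h.fderiv_fibre hy δ
  rw [Fintype.linearIndependent_iff]
  intro g hg
  have hδ : (WithLp.toLp 2 g : Eu N) = ∑ j, g j • EuclideanSpace.single j (1 : ℝ) := by
    ext i
    simp [Finset.sum_apply, Pi.single_apply]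
  have hsum : ∀ d, inner ℝ (fibreMap ι C τ X m z (WithLp.toLp 2 g)).1
        (coordX n N d - fderiv ℝ X z d)
      - inner ℝ (fibreMap ι C τ X m z (WithLp.toLp 2 g)).2 (coordY n N d
        - (fderiv ℝ C (X z, coordB ι z) (fderiv ℝ X z d, coordB ι d)).1) = 0 := by
    intro d
    have h3 := DFunLike.congr_fun hg d
    simp only [(key _).fderiv, sum_apply, smul_apply, sub_apply,
      ContinuousLinearMap.comp_apply, innerSL_apply_apply, zero_apply,
      ContinuousLinearMap.prod_apply, ContinuousLinearMap.coe_fst'] at h3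
    rw [← h3, hδ, map_sum, Prod.fst_sum, Prod.snd_sum, sum_inner, sum_inner,
      ← Finset.sum_sub_distrib]
    refine Finset.sum_congr rfl fun j _ => ?_
    simp only [map_smul, Prod.smul_fst, Prod.smul_snd, inner_smul_left, conj_trivial, smul_eq_mul,
      mul_sub]
  have hzero : fibreMap ι C τ X m z (WithLp.toLp 2 g) = 0 := by
    set A := fibreMap ι C τ X m z (WithLp.toLp 2 g)
    -- A horizontal vector fixes u = (X, θ₂), so dx and dy can be prescribed freely; this choice
    -- turns the relation into a sum of two squares.
    obtain ⟨δ, hδ1, hδ2⟩ := h.horizontal z hz (WithLp.toLp 2 (A.1, -A.2))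
    have h3 := hsum (WithLp.toLp 2 (A.1, -A.2), δ)
    have h4 : coordB ι ((WithLp.toLp 2 (A.1, -A.2), δ) : Eu2 n × Eu N) = 0 := hδ1
    have h5 : coordX n N ((WithLp.toLp 2 (A.1, -A.2), δ) : Eu2 n × Eu N) = A.1 := rfl
    have h6 : coordY n N ((WithLp.toLp 2 (A.1, -A.2), δ) : Eu2 n × Eu N) = -A.2 := rfl
    have h7 : ((0, 0) : Eu n × Eu n) = 0 := rfl
    rw [h4, h5, h6, hδ2, h7, map_zero, Prod.fst_zero, sub_zero, sub_zero, inner_neg_right,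
      sub_neg_eq_add, real_inner_self_eq_norm_sq, real_inner_self_eq_norm_sq] at h3
    have h8 : ‖A.1‖ = 0 := by nlinarith [norm_nonneg A.1]
    have h9 : ‖A.2‖ = 0 := by nlinarith [norm_nonneg A.2]
    exact Prod.ext (norm_eq_zero.1 h8) (norm_eq_zero.1 h9)
  have h0 := (injective_iff_map_eq_zero _).1 (h.fibreMap_bijective hz).1 _ hzero
  intro j
  exact congrArg (fun v : Eu N => v j) h0

/-- A zero of dφ is in particular a fibre-critical point, where dφ = ⟨θ₂, dx⟩ - ⟨H, dy⟩. -/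
theorem fderiv_ne_zero (h : PhaseModel ι S D C s τ X m φ) {z : Eu2 n × Eu N} (hz : z ∈ S)
    (hne : coordX n N z = X z → coordY n N z = (C (X z, coordB ι z)).1 →
      coordB ι z ≠ 0 ∨ (C (X z, coordB ι z)).2 ≠ 0) : fderiv ℝ φ z ≠ 0 := by
  intro h0
  obtain ⟨h1, h2⟩ := (h.crit_iff hz).1 fun δ => by rw [h0]; rfl
  have h3 : ∀ d, inner ℝ (coordB ι z) (coordX n N d)
      - inner ℝ (C (X z, coordB ι z)).2 (coordY n N d) = (0 : ℝ) := fun d => by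
    rw [← h.fderiv_of_crit hz h1 h2, h0]; rfl
  rcases hne h1 h2 with h4 | h4
  · have h5 := h3 (WithLp.toLp 2 (coordB ι z, 0), 0)
    refine h4 (inner_self_eq_zero (𝕜 := ℝ).1 ?_)
    simpa [coordX, coordY] using h5
  · have h5 := h3 (WithLp.toLp 2 (0, (C (X z, coordB ι z)).2), 0)
    refine h4 (inner_self_eq_zero (𝕜 := ℝ).1 ?_)
    simpa [coordX, coordY] using h5

/-- With the critical set and its image known, the bijection needs only that θ is determined by (x,
y) and θ₂ there, and that the critical points match the prescribed pieces U and V. -/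
theorem parametrises (h : PhaseModel ι S D C s τ X m φ) {U V : Set (Eu n × Eu n)}
    (hunique : ∀ z ∈ S, ∀ z' ∈ S, z.1 = z'.1 → coordB ι z = coordB ι z' →
      coordX n N z = X z → coordX n N z' = X z' → z.2 = z'.2)
    (hmaps : ∀ z ∈ S, coordX n N z = X z → coordY n N z = (C (X z, coordB ι z)).1 →
      (X z, coordB ι z) ∈ U ∧ C (X z, coordB ι z) ∈ V)
    (hsurj : ∀ u ∈ U, C u ∈ V → ∃ z ∈ S, coordX n N z = u.1 ∧ X z = u.1 ∧ coordB ι z = u.2 ∧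
      coordY n N z = (C u).1) :
    Parametrises φ S (graphOver C U V) := by
  refine ⟨h.contDiffOn, fun z hz => ?_, fun z hz => ?_, fun z hz z' hz' he => ?_, fun w hw => ?_⟩
  · obtain ⟨h1, h2⟩ := (h.crit_iff hz.1).1 hz.2
    exact h.nondegenerate hz.1 h1 h2
  · obtain ⟨h1, h2⟩ := (h.crit_iff hz.1).1 hz.2
    rw [h.graphMap_of_crit hz.1 h1 h2, h1]
    exact ⟨(hmaps z hz.1 h1 h2).1, (hmaps z hz.1 h1 h2).2, rfl⟩
  · obtain ⟨h1, h2⟩ := (h.crit_iff hz.1).1 hz.2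
    obtain ⟨h1', h2'⟩ := (h.crit_iff hz'.1).1 hz'.2
    have e1 : z.1 = z'.1 :=
      eu2_ext (congrArg (fun w => w.1.1) he) (congrArg (fun w => w.2.1) he)
    rw [h.graphMap_of_crit hz.1 h1 h2, h.graphMap_of_crit hz'.1 h1' h2'] at he
    exact Prod.ext e1 (hunique z hz.1 z' hz'.1 e1 (congrArg (fun w => w.1.2) he) h1 h1')
  · obtain ⟨hU, hV, hw⟩ := hw
    obtain ⟨z, hz, a1, a2, a3, a4⟩ := hsurj w.1 hU (hw ▸ hV)
    have h1 : coordX n N z = X z := a1.trans a2.symm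
    have e : (X z, coordB ι z) = w.1 := Prod.ext a2 a3
    have h2 : coordY n N z = (C (X z, coordB ι z)).1 := by rw [e, a4]
    refine ⟨z, ⟨hz, (h.crit_iff hz).2 ⟨h1, h2⟩⟩, ?_⟩
    rw [h.graphMap_of_crit hz h1 h2, h1, e, ← hw]

end PhaseModel

/-! ### Local models of the homogeneous extensions -/

section LocalModel

variable {n : ℕ} {χ : PartialEquiv (Amb n) (Amb n)} {Y Z : Amb n → Eu n}

theorem gmap_smul_smul (Y Z : Amb n → Eu n) {c₁ c₂ : ℝ} (z : Eu n × Eu n) {s t : ℝ} (hs : 0 < s)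
    (ht : 0 < t) : gmap Y Z (s * c₁) (t * c₂) (s • z.1, t • z.2)
      = (s • (gmap Y Z c₁ c₂ z).1, t • (gmap Y Z c₁ c₂ z).2) := by
  rw [gmap_smul_fst Y Z (c₁ := c₁) (c₂ := t * c₂) (z.1, t • z.2) hs, gmap_smul_snd Y Z z ht]

theorem mem_gcone_smul_smul {U : Set (Amb n)} {c₁ c₂ : ℝ} {z : Eu n × Eu n}
    (hz : z ∈ gcone c₁ c₂ U) {s t : ℝ} (hs : 0 < s) (ht : 0 < t) :
    (s • z.1, t • z.2) ∈ gcone (s * c₁) (t * c₂) U :=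
  mem_gcone_smul_fst (mem_gcone_smul_snd hz ht) hs

/-- The linear scaling `(x, ξ) ↦ (s x, t ξ)`. -/
def scl (n : ℕ) (s t : ℝ) : Eu n × Eu n →L[ℝ] Eu n × Eu n :=
  (s • ContinuousLinearMap.fst ℝ _ _).prod (t • ContinuousLinearMap.snd ℝ _ _)

theorem scl_apply (s t : ℝ) (z : Eu n × Eu n) : scl n s t z = (s • z.1, t • z.2) := rfl

theorem gmap_scl (Y Z : Amb n → Eu n) (c₁ c₂ : ℝ) {s t : ℝ} (hs : 0 < s) (ht : 0 < t)
    (z : Eu n × Eu n) : gmap Y Z (s * c₁) (t * c₂) z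
      = scl n s t (gmap Y Z c₁ c₂ (scl n s⁻¹ t⁻¹ z)) := by
  have h := gmap_smul_smul Y Z (c₁ := c₁) (c₂ := c₂) (scl n s⁻¹ t⁻¹ z) hs ht
  simp only [scl_apply, smul_smul, mul_inv_cancel₀ hs.ne', mul_inv_cancel₀ ht.ne', one_smul] at h ⊢
  exact h

theorem differentiableAt_gmap (h : HomData χ Y Z) {c₁ c₂ : ℝ} (hc : IsHeights c₁ c₂)
    {z : Eu n × Eu n} (hz : z ∈ gcone c₁ c₂ χ.source) :
    DifferentiableAt ℝ (gmap Y Z c₁ c₂) z :=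
  ((contDiffOn_gmap h.source_open h.smoothY h.smoothZ hc).contDiffAt
    ((isOpen_gcone hc h.source_open).mem_nhds hz)).differentiableAt (by simp)

theorem fderiv_gmap_scl (h : HomData χ Y Z) {c₁ c₂ : ℝ} (hc : IsHeights c₁ c₂) {s t : ℝ}
    (hs : 0 < s) (ht : 0 < t) {z : Eu n × Eu n} (hz : z ∈ gcone c₁ c₂ χ.source)
    (v : Eu n × Eu n) :
    fderiv ℝ (gmap Y Z (s * c₁) (t * c₂)) (s • z.1, t • z.2) v
      = scl n s t (fderiv ℝ (gmap Y Z c₁ c₂) z (scl n s⁻¹ t⁻¹ v)) := by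
  have e : scl n s⁻¹ t⁻¹ (s • z.1, t • z.2) = z := by
    simp [scl_apply, smul_smul, hs.ne', ht.ne']
  have hd : HasFDerivAt (gmap Y Z c₁ c₂) (fderiv ℝ (gmap Y Z c₁ c₂) z)
      (scl n s⁻¹ t⁻¹ (s • z.1, t • z.2)) := by
    rw [e]; exact (differentiableAt_gmap h hc hz).hasFDerivAt
  have h1 := (scl n s t).hasFDerivAt.comp _ (hd.comp _ (scl n s⁻¹ t⁻¹).hasFDerivAt)
  have h2 : gmap Y Z (s * c₁) (t * c₂) = scl n s t ∘ gmap Y Z c₁ c₂ ∘ scl n s⁻¹ t⁻¹ :=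
    funext (gmap_scl Y Z c₁ c₂ hs ht)
  rw [h2, h1.fderiv]
  rfl

/-- Scaling x by s and ξ by t multiplies the form by st; conjugation undoes this. So the three basic
pairs of heights give all admissible ones. -/
theorem isSymplecticOn_scl (h : HomData χ Y Z) {c₁ c₂ : ℝ} (hc : IsHeights c₁ c₂) {s t : ℝ}
    (hs : 0 < s) (ht : 0 < t) (hC : IsSymplecticOn (gmap Y Z c₁ c₂) (gcone c₁ c₂ χ.source)) :
    IsSymplecticOn (gmap Y Z (s * c₁) (t * c₂)) (gcone (s * c₁) (t * c₂) χ.source) := by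
  intro z hz v w
  have hz' := mem_gcone_smul_smul hz (inv_pos.2 hs) (inv_pos.2 ht)
  rw [inv_mul_cancel_left₀ hs.ne', inv_mul_cancel_left₀ ht.ne'] at hz'
  have e := fderiv_gmap_scl h hc hs ht hz'
  simp only [smul_smul, mul_inv_cancel₀ hs.ne', mul_inv_cancel₀ ht.ne', one_smul] at e
  have h1 := hC _ hz' (scl n s⁻¹ t⁻¹ v) (scl n s⁻¹ t⁻¹ w)
  rw [e, e]
  simp only [scl_apply, inner_smul_left, inner_smul_right, conj_trivial] at h1 ⊢
  refine Eq.trans ?_ ((congrArg (fun k => s * t * k) h1).trans ?_)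
  · ring
  · field_simp

/-- The extensions of all heights are symplectic. -/
theorem isSymplecticOn_gmap (h : HomData χ Y Z) {c₁ c₂ : ℝ} (hc : IsHeights c₁ c₂) :
    IsSymplecticOn (gmap Y Z c₁ c₂) (gcone c₁ c₂ χ.source) := by
  obtain ⟨h1, h2, h3⟩ := hc
  rcases h1.eq_or_lt with h1 | h1 <;> rcases h2.eq_or_lt with h2 | h2
  · rw [← h1, ← h2]; exact h.sympC
  · have := isSymplecticOn_scl h ⟨le_rfl, zero_le_one, Or.inl rfl⟩ zero_lt_one h2 h.sympE
    rw [← h1]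
    rwa [mul_zero, mul_one] at this
  · have := isSymplecticOn_scl h ⟨zero_le_one, le_rfl, Or.inr rfl⟩ h1 zero_lt_one h.sympPsi
    rw [← h2]
    rwa [mul_zero, mul_one] at this
  · exact absurd h3 (by push Not; exact ⟨h1.ne', h2.ne'⟩)

open Classical in
/-- A primitive of `⟨ξ, dx⟩ - ⟨H, dY⟩`. -/
def action (Y Z : Amb n → Eu n) (c₁ c₂ : ℝ) (u : Eu n × Eu n) : ℝ :=
  if c₁ = 0 then inner ℝ u.2 u.1 - inner ℝ (gmap Y Z c₁ c₂ u).2 (gmap Y Z c₁ c₂ u).1 else 0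

theorem contDiffOn_action (h : HomData χ Y Z) {c₁ c₂ : ℝ} (hc : IsHeights c₁ c₂) :
    ContDiffOn ℝ ∞ (action Y Z c₁ c₂) (gcone c₁ c₂ χ.source) := by
  have hg := contDiffOn_gmap h.source_open h.smoothY h.smoothZ hc
  unfold action
  split_ifs with h0
  · exact (contDiff_snd.inner ℝ contDiff_fst).contDiffOn.sub (hg.snd.inner ℝ hg.fst)
  · exact contDiffOn_const

/-- For c₁ = 0 homogeneity in x gives ⟨Y, dH⟩ = ⟨x, dξ⟩, and the product rule for ⟨ξ, x⟩ - ⟨H, Y⟩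
leaves the required form. For c₂ = 0 homogeneity in ξ gives ⟨H, dY⟩ = ⟨ξ, dx⟩, and 0 is a primitive.
-/
theorem fderiv_action (h : HomData χ Y Z) {c₁ c₂ : ℝ} (hc : IsHeights c₁ c₂) {u : Eu n × Eu n}
    (hu : u ∈ gcone c₁ c₂ χ.source) (d : Eu n × Eu n) :
    fderiv ℝ (action Y Z c₁ c₂) u d = inner ℝ u.2 d.1
      - inner ℝ (gmap Y Z c₁ c₂ u).2 (fderiv ℝ (gmap Y Z c₁ c₂) u d).1 := by
  have hg := differentiableAt_gmap h hc hu
  by_cases h0 : c₁ = 0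
  · have e : action Y Z c₁ c₂ = fun u => inner ℝ u.2 u.1
        - inner ℝ (gmap Y Z c₁ c₂ u).2 (gmap Y Z c₁ c₂ u).1 := by
      funext u; rw [action, if_pos h0]
    have h1 := inner_fst_fderiv_snd (isSymplecticOn_gmap h hc) hu hg (fun t ht => by
      have := gmap_smul_fst Y Z (c₁ := c₁) (c₂ := c₂) u ht
      rwa [h0, mul_zero, ← h0] at this) d
    have hx : HasFDerivAt (fun u : Eu n × Eu n => inner ℝ u.2 u.1) _ u :=
      (hasFDerivAt_snd (𝕜 := ℝ) (p := u)).inner ℝ hasFDerivAt_fst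
    have hd := hx.fun_sub (hg.hasFDerivAt.snd.inner ℝ hg.hasFDerivAt.fst)
    rw [e, hd.fderiv]
    simp only [sub_apply, ContinuousLinearMap.comp_apply, ContinuousLinearMap.prod_apply,
      fderivInnerCLM_apply, ContinuousLinearMap.coe_fst', ContinuousLinearMap.coe_snd']
    rw [real_inner_comm (gmap Y Z c₁ c₂ u).1, h1, real_inner_comm u.1]
    ring
  · have h2 : c₂ = 0 := hc.2.2.resolve_left h0
    have e : action Y Z c₁ c₂ = fun _ => 0 := by funext u; rw [action, if_neg h0]
    have h1 := inner_snd_fderiv_fst (isSymplecticOn_gmap h hc) hu hg (fun t ht => by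
      have := gmap_smul_snd Y Z (c₁ := c₁) (c₂ := c₂) u ht
      rwa [h2, mul_zero, ← h2] at this) d
    rw [e, h1, sub_self, fderiv_fun_const]
    rfl

theorem action_smul_smul (Y Z : Amb n → Eu n) {c₁ c₂ : ℝ} (z : Eu n × Eu n) {s t : ℝ} (hs : 0 < s)
    (ht : 0 < t) : action Y Z (s * c₁) (t * c₂) (s • z.1, t • z.2)
      = s * t * action Y Z c₁ c₂ z := by
  unfold action
  rw [gmap_smul_smul Y Z z hs ht]
  simp only [mul_eq_zero, hs.ne', false_or, inner_smul_left, inner_smul_right, conj_trivial]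
  split_ifs <;> ring

/-- The primitive vanishes at the corner. -/
theorem inner_gmap_corner (h : HomData χ Y Z) {z : Eu n × Eu n} (hz : z ∈ gcone 0 0 χ.source) :
    inner ℝ (gmap Y Z 0 0 z).2 (gmap Y Z 0 0 z).1 = (inner ℝ z.2 z.1 : ℝ) := by
  have hc : IsHeights 0 0 := ⟨le_rfl, le_rfl, Or.inl rfl⟩
  have hg := differentiableAt_gmap h hc hz
  -- Both homogeneities are used: ⟨H, dY⟩ = ⟨ξ, dx⟩ is evaluated on the Euler field (x, 0), along
  -- which dY equals Y.
  have h1 := inner_snd_fderiv_fst h.sympC hz hg (fun t ht => by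
    have := gmap_smul_snd Y Z (c₁ := 0) (c₂ := 0) z ht
    rwa [mul_zero] at this) (z.1, 0)
  have h2 := fderiv_radial_fst (C := gmap Y Z 0 0) (z := z) (k := 1) hg (fun t ht => by
    have := gmap_smul_fst Y Z (c₁ := 0) (c₂ := 0) z ht
    rw [mul_zero] at this
    rw [this, one_mul, add_sub_cancel])
  rw [h2] at h1
  simpa using h1

/-- Near a boundary point, the extensions of all heights and their primitives are restrictions of
smooth maps on the ambient space. -/
theorem exists_localModel (h : HomData χ Y Z) {p : Amb n} (hp : p ∈ χ.source) :
    ∃ (O : Set (Amb n)) (G : Amb n → Eu n × Eu n) (sh : Amb n → ℝ), IsOpen O ∧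
      ContDiffOn ℝ ∞ G O ∧ ContDiffOn ℝ ∞ sh O ∧
      (∀ s t : ℝ, 0 < s → 0 < t → (s • p.1, t • p.2) ∈ O) ∧
      ∀ q ∈ O, IsHeights q.1.2 q.2.2 → (q.1.1, q.2.1) ∈ gcone q.1.2 q.2.2 χ.source ∧
        G q = gmap Y Z q.1.2 q.2.2 (q.1.1, q.2.1) ∧
        sh q = action Y Z q.1.2 q.2.2 (q.1.1, q.2.1) := by
  obtain ⟨OY, Yh, hOY, hYh, hmY, hpY, heY⟩ := exists_hat h.source_open h.smoothY hp
  obtain ⟨OZ, Zh, hOZ, hZh, hmZ, hpZ, heZ⟩ := exists_hat h.source_open h.smoothZ hp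
  let G : Amb n → Eu n × Eu n := fun q => (nn q.1 • Yh q, nn q.2 • Zh q)
  have hG : ContDiffOn ℝ ∞ G (OY ∩ OZ) := by
    intro q hq
    have h1 := hpY _ hq.1
    have a1 : ContDiffAt ℝ ∞ (fun q : Amb n => nn q.1) q := contDiffAt_nn_comp contDiffAt_fst h1.1
    have a2 : ContDiffAt ℝ ∞ (fun q : Amb n => nn q.2) q := contDiffAt_nn_comp contDiffAt_snd h1.2
    exact ((a1.smul (hYh.contDiffAt (hOY.mem_nhds hq.1))).prodMk
      (a2.smul (hZh.contDiffAt (hOZ.mem_nhds hq.2)))).contDiffWithinAt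
  have hval : ∀ q ∈ OY ∩ OZ, IsHeights q.1.2 q.2.2 →
      (q.1.1, q.2.1) ∈ gcone q.1.2 q.2.2 χ.source ∧
        G q = gmap Y Z q.1.2 q.2.2 (q.1.1, q.2.1) := by
    intro q hq hc
    have h1 := heY _ hq.1 hc.1 hc.2.1 hc.2.2
    have h2 := heZ _ hq.2 hc.1 hc.2.1 hc.2.2
    exact ⟨⟨(hpY _ hq.1).1, (hpY _ hq.1).2, h1.1⟩, Prod.ext (congrArg (fun y => nn q.1 • y) h1.2)
      (congrArg (fun y => nn q.2 • y) h2.2)⟩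
  by_cases hpE : p.1.2 = 0
  -- Near the exit face the primitive is computed after setting the first height to 0. If that
  -- height was positive, the second one is 0, so the flattened point has both heights 0 and the
  -- formula gives 0 there, as it must on the ψ-face.
  · let r : Amb n → Amb n := fun q => ((q.1.1, 0), q.2)
    have hr : ContDiff ℝ ∞ r := by simp only [r]; fun_prop
    refine ⟨OY ∩ OZ ∩ r ⁻¹' (OY ∩ OZ), G,
      fun q => inner ℝ q.2.1 q.1.1 - inner ℝ (G (r q)).2 (G (r q)).1,
      (hOY.inter hOZ).inter ((hOY.inter hOZ).preimage hr.continuous), hG.mono inter_subset_left,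
      ?_, fun s t hs ht => ?_, fun q hq hc => ?_⟩
    · have h1 : ContDiffOn ℝ ∞ (fun q => G (r q)) (OY ∩ OZ ∩ r ⁻¹' (OY ∩ OZ)) :=
        hG.comp hr.contDiffOn fun q hq => hq.2
      have h2 : ContDiff ℝ ∞ (fun q : Amb n => inner ℝ q.2.1 q.1.1) :=
        (contDiff_fst.comp contDiff_snd).inner ℝ (contDiff_fst.comp contDiff_fst)
      exact h2.contDiffOn.sub (h1.snd.inner ℝ h1.fst)
    · have h1 : r (s • p.1, t • p.2) = (s • p.1, t • p.2) := by
        simp only [r]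
        exact Prod.ext (Prod.ext rfl (by simp [hpE])) rfl
      refine ⟨⟨hmY s t hs ht, hmZ s t hs ht⟩, ?_⟩
      rw [mem_preimage, h1]
      exact ⟨hmY s t hs ht, hmZ s t hs ht⟩
    · refine ⟨(hval q hq.1 hc).1, (hval q hq.1 hc).2, ?_⟩
      by_cases h0 : q.1.2 = 0
      · have h1 : r q = q := Prod.ext (Prod.ext rfl h0.symm) rfl
        rw [action, if_pos h0]
        change inner ℝ q.2.1 q.1.1 - inner ℝ (G (r q)).2 (G (r q)).1 = _
        rw [h1, (hval q hq.1 hc).2]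
      · have h2 : q.2.2 = 0 := hc.2.2.resolve_left h0
        obtain ⟨h3, h4⟩ := hval (r q) hq.2 ⟨le_rfl, hc.2.1, Or.inl rfl⟩
        simp only [r, h2] at h3
        replace h4 : G (r q) = gmap Y Z 0 0 (q.1.1, q.2.1) := by simpa only [r, h2] using h4
        rw [action, if_neg h0]
        change inner ℝ q.2.1 q.1.1 - inner ℝ (G (r q)).2 (G (r q)).1 = (0 : ℝ)
        rw [h4, inner_gmap_corner h h3, sub_self]
  · refine ⟨OY ∩ OZ ∩ {q | q.1.2 ≠ 0}, G, fun _ => 0, (hOY.inter hOZ).inter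
      (isOpen_ne_fun (by fun_prop) continuous_const), hG.mono inter_subset_left, contDiffOn_const,
      fun s t hs ht => ⟨⟨hmY s t hs ht, hmZ s t hs ht⟩, ?_⟩, fun q hq hc => ?_⟩
    · exact mul_ne_zero hs.ne' hpE
    · exact ⟨(hval q hq.1 hc).1, (hval q hq.1 hc).2, by rw [action, if_neg hq.2]⟩

end LocalModel

/-! ### The phase functions in compactified coordinates -/

/-- The ambient space of `∂(𝕊²ⁿ₊ × 𝕊ᴺ₊)`. -/
abbrev Cmp (n N : ℕ) : Type := (Eu2 n × ℝ) × (Eu N × ℝ)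

section Compact

variable {n N : ℕ} (ι : Eu N ≃ₗᵢ[ℝ] Eu2 n)

/-- The coordinate `x` on the compactified space. -/
def cmpX (n N : ℕ) : Cmp n N →L[ℝ] Eu n :=
  (coordX n N).comp ((ContinuousLinearMap.fst ℝ (Eu2 n) ℝ).prodMap
    (ContinuousLinearMap.fst ℝ (Eu N) ℝ))

/-- The coordinate `y` on the compactified space. -/
def cmpY (n N : ℕ) : Cmp n N →L[ℝ] Eu n :=
  (coordY n N).comp ((ContinuousLinearMap.fst ℝ (Eu2 n) ℝ).prodMap
    (ContinuousLinearMap.fst ℝ (Eu N) ℝ))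

/-- The first half of the fibre variables on the compactified space. -/
def cmpA : Cmp n N →L[ℝ] Eu n :=
  (fibA ι).comp ((ContinuousLinearMap.fst ℝ _ _).comp (ContinuousLinearMap.snd ℝ _ _))

/-- The second half of the fibre variables on the compactified space. -/
def cmpB : Cmp n N →L[ℝ] Eu n :=
  (fibB ι).comp ((ContinuousLinearMap.fst ℝ _ _).comp (ContinuousLinearMap.snd ℝ _ _))

/-- The base point `((θ₁, ρ), (θ₂, σ))`. -/
def baseOf : Cmp n N →L[ℝ] Amb n :=
  ((cmpA ι).prod ((ContinuousLinearMap.snd ℝ _ _).comp (ContinuousLinearMap.fst ℝ _ _))).prod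
    ((cmpB ι).prod ((ContinuousLinearMap.snd ℝ _ _).comp (ContinuousLinearMap.snd ℝ _ _)))

/-- The phase function in compactified coordinates. -/
def cmpPhase (G : Amb n → Eu n × Eu n) (sh : Amb n → ℝ) (τ : ℝ) (P : Cmp n N) : ℝ :=
  inner ℝ (cmpB ι P) (cmpX n N P - cmpA ι P)
    - inner ℝ (G (baseOf ι P)).2 (cmpY n N P - (G (baseOf ι P)).1)
    + sh (baseOf ι P) + τ / 2 * ‖cmpX n N P - cmpA ι P‖ ^ 2

/-- The derivative of `θ₁ / |(θ, c)|`, up to a factor. -/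
def cmpTan (P : Cmp n N) : Eu N →L[ℝ] Eu n :=
  fibA ι - (innerSL ℝ P.2.1).smulRight (cmpA ι P)

/-- The fibre map of the phase function in compactified coordinates. -/
def cmpFibre (G : Amb n → Eu n × Eu n) (τ : ℝ) (P : Cmp n N) : Eu N →L[ℝ] Eu n × Eu n :=
  (fibB ι - τ • cmpTan ι P
    + ((τ / 2) • innerSL ℝ P.2.1).smulRight (cmpX n N P - cmpA ι P)).prod
  ((ContinuousLinearMap.snd ℝ _ _).comp ((fderiv ℝ G (baseOf ι P)).comp
    (((cmpTan ι P).prod 0).prod ((fibB ι).prod 0))))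

theorem cmpTan_apply (P : Cmp n N) (δ : Eu N) :
    cmpTan ι P δ = fibA ι δ - (inner ℝ P.2.1 δ : ℝ) • cmpA ι P := rfl

theorem cmpFibre_apply (G : Amb n → Eu n × Eu n) (τ : ℝ) (P : Cmp n N) (δ : Eu N) :
    cmpFibre ι G τ P δ = (fibB ι δ - τ • cmpTan ι P δ
      + (τ / 2 * inner ℝ P.2.1 δ) • (cmpX n N P - cmpA ι P),
      (fderiv ℝ G (baseOf ι P) ((cmpTan ι P δ, 0), (fibB ι δ, 0))).2) := rfl

theorem contDiffOn_cmpPhase {O : Set (Amb n)} {G : Amb n → Eu n × Eu n} {sh : Amb n → ℝ}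
    (hG : ContDiffOn ℝ ∞ G O) (hs : ContDiffOn ℝ ∞ sh O) (τ : ℝ) :
    ContDiffOn ℝ ∞ (cmpPhase (N := N) ι G sh τ) (baseOf ι ⁻¹' O) := by
  have h1 : ContDiffOn ℝ ∞ (fun P : Cmp n N => G (baseOf ι P)) (baseOf ι ⁻¹' O) :=
    hG.comp (baseOf ι).contDiff.contDiffOn fun _ h => h
  have h2 : ContDiffOn ℝ ∞ (fun P : Cmp n N => sh (baseOf ι P)) (baseOf ι ⁻¹' O) :=
    hs.comp (baseOf ι).contDiff.contDiffOn fun _ h => h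
  have h3 : ContDiff ℝ ∞ (fun P : Cmp n N => cmpX n N P - cmpA ι P) :=
    (cmpX n N).contDiff.sub (cmpA ι).contDiff
  exact ((((cmpB ι).contDiff.inner ℝ h3).contDiffOn.sub
    (h1.snd.inner ℝ ((cmpY n N).contDiff.contDiffOn.sub h1.fst))).add h2).add
    (contDiff_const.mul (h3.norm_sq ℝ)).contDiffOn

theorem continuousOn_cmpFibre {O : Set (Amb n)} (hO : IsOpen O) {G : Amb n → Eu n × Eu n}
    (hG : ContDiffOn ℝ ∞ G O) (τ : ℝ) :
    ContinuousOn (cmpFibre (N := N) ι G τ) (baseOf ι ⁻¹' O) := by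
  rw [continuousOn_clm_apply]
  intro δ
  have hi : Continuous (fun P : Cmp n N => (inner ℝ P.2.1 δ : ℝ)) := by fun_prop
  have ht : Continuous (fun P : Cmp n N => cmpTan ι P δ) :=
    continuous_const.sub (hi.smul (cmpA ι).continuous)
  have hf : ContinuousOn (fun P : Cmp n N => fderiv ℝ G (baseOf ι P)) (baseOf ι ⁻¹' O) :=
    (hG.continuousOn_fderiv_of_isOpen hO (by simp)).comp (baseOf ι).continuous.continuousOn
      fun _ h => h
  simp only [cmpFibre_apply]
  refine ContinuousOn.prodMk ?_ (hf.clm_apply ?_).snd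
  · exact ((continuous_const.sub (ht.const_smul τ)).add ((continuous_const.mul hi).smul
      ((cmpX n N).continuous.sub (cmpA ι).continuous))).continuousOn
  · exact (by fun_prop : Continuous fun P : Cmp n N =>
      ((cmpTan ι P δ, (0 : ℝ)), (fibB ι δ, (0 : ℝ)))).continuousOn

/-- The function `X` of the phase model. -/
def phaseX (c₁ c₂ : ℝ) (z : Eu2 n × Eu N) : Eu n :=
  (nn (z.1, c₁) * (nn (z.2, c₂))⁻¹) • fibA ι z.2

/-- The function `m` of the phase model. -/
def phaseM (n N : ℕ) (c₁ c₂ : ℝ) (z : Eu2 n × Eu N) : ℝ := nn (z.2, c₂) * (nn (z.1, c₁))⁻¹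

theorem hasFDerivAt_nn {E : Type} [NormedAddCommGroup E] [InnerProductSpace ℝ E] {x : E} {c : ℝ}
    (h : 0 < nn (x, c)) :
    HasFDerivAt (fun x : E => nn (x, c)) ((nn (x, c))⁻¹ • innerSL ℝ x) x := by
  have h1 : HasFDerivAt (fun x : E => ‖x‖ ^ 2 + c ^ 2) (2 • (innerSL ℝ x).comp
      (ContinuousLinearMap.id ℝ E)) x := (hasFDerivAt_id x).norm_sq.add_const _
  have h2 : ‖x‖ ^ 2 + c ^ 2 ≠ 0 := by
    have := nn_sq (x, c)
    rw [← this]; positivity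
  have h3 := h1.sqrt h2
  have h4 : (1 / (2 * √(‖x‖ ^ 2 + c ^ 2))) • 2 • (innerSL ℝ x).comp (ContinuousLinearMap.id ℝ E)
      = (nn (x, c))⁻¹ • innerSL ℝ x := by
    ext v
    have h5 : √(‖x‖ ^ 2 + c ^ 2) = nn (x, c) := rfl
    simp only [h5, smul_apply, smul_eq_mul, nsmul_eq_mul, Nat.cast_ofNat,
      ContinuousLinearMap.comp_id]
    field_simp
  rw [h4] at h3
  exact h3

theorem hasFDerivAt_nn_fst {c₁ : ℝ} {z : Eu2 n × Eu N} (h1 : 0 < nn (z.1, c₁)) :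
    HasFDerivAt (fun z : Eu2 n × Eu N => nn (z.1, c₁))
      (((nn (z.1, c₁))⁻¹ • innerSL ℝ z.1).comp (ContinuousLinearMap.fst ℝ _ _)) z :=
  HasFDerivAt.comp (g := fun x => nn (x, c₁)) (f := fun z : Eu2 n × Eu N => z.1) z
    (hasFDerivAt_nn h1) hasFDerivAt_fst

theorem hasFDerivAt_nn_snd {c₂ : ℝ} {z : Eu2 n × Eu N} (h2 : 0 < nn (z.2, c₂)) :
    HasFDerivAt (fun z : Eu2 n × Eu N => nn (z.2, c₂))
      (((nn (z.2, c₂))⁻¹ • innerSL ℝ z.2).comp (ContinuousLinearMap.snd ℝ _ _)) z :=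
  HasFDerivAt.comp (g := fun x => nn (x, c₂)) (f := fun z : Eu2 n × Eu N => z.2) z
    (hasFDerivAt_nn h2) hasFDerivAt_snd

theorem hasFDerivAt_inv_real {E : Type*} [NormedAddCommGroup E] [NormedSpace ℝ E] {f : E → ℝ}
    {f' : E →L[ℝ] ℝ} {x : E} (hf : HasFDerivAt f f' x) (h0 : f x ≠ 0) :
    HasFDerivAt (fun x => (f x)⁻¹) (-(f x ^ 2)⁻¹ • f') x :=
  (hasDerivAt_inv h0).comp_hasFDerivAt x hf

theorem fderiv_phaseX {c₁ c₂ : ℝ} {z : Eu2 n × Eu N} (h1 : 0 < nn (z.1, c₁))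
    (h2 : 0 < nn (z.2, c₂)) (d : Eu2 n × Eu N) :
    fderiv ℝ (phaseX ι c₁ c₂) z d = (nn (z.1, c₁) * (nn (z.2, c₂))⁻¹) • fibA ι d.2
      + ((nn (z.1, c₁))⁻¹ * (nn (z.2, c₂))⁻¹ * inner ℝ z.1 d.1
        - nn (z.1, c₁) * ((nn (z.2, c₂))⁻¹) ^ 3 * inner ℝ z.2 d.2) • fibA ι z.2 := by
  have hA : HasFDerivAt (fun z : Eu2 n × Eu N => fibA ι z.2)
      ((fibA ι).comp (ContinuousLinearMap.snd ℝ _ _)) z :=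
    HasFDerivAt.comp (g := fibA ι) (f := Prod.snd) z (fibA ι).hasFDerivAt hasFDerivAt_snd
  have key := ((hasFDerivAt_nn_fst h1).fun_mul
    (hasFDerivAt_inv_real (hasFDerivAt_nn_snd h2) h2.ne')).fun_smul hA
  have h3 : phaseX ι c₁ c₂ = fun z : Eu2 n × Eu N =>
    (nn (z.1, c₁) * (nn (z.2, c₂))⁻¹) • fibA ι z.2 := rfl
  rw [h3, key.fderiv]
  simp only [add_apply, smul_apply, ContinuousLinearMap.comp_apply, ContinuousLinearMap.coe_fst',
    ContinuousLinearMap.coe_snd', innerSL_apply_apply, smul_eq_mul,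
    ContinuousLinearMap.smulRight_apply]
  congr 2
  field_simp
  ring

theorem fderiv_phaseM {c₁ c₂ : ℝ} {z : Eu2 n × Eu N} (h1 : 0 < nn (z.1, c₁))
    (h2 : 0 < nn (z.2, c₂)) (δ : Eu N) :
    fderiv ℝ (phaseM n N c₁ c₂) z (0, δ)
      = (nn (z.1, c₁))⁻¹ * (nn (z.2, c₂))⁻¹ * inner ℝ z.2 δ := by
  have key := (hasFDerivAt_nn_snd h2).fun_mul
    (hasFDerivAt_inv_real (hasFDerivAt_nn_fst h1) h1.ne')
  have h3 : phaseM n N c₁ c₂ = fun z : Eu2 n × Eu N => nn (z.2, c₂) * (nn (z.1, c₁))⁻¹ := rfl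
  rw [h3, key.fderiv]
  simp only [add_apply, smul_apply, ContinuousLinearMap.comp_apply, ContinuousLinearMap.coe_fst',
    ContinuousLinearMap.coe_snd', innerSL_apply_apply, smul_eq_mul, inner_zero_right]
  ring

theorem cmpA_un2 (c₁ c₂ : ℝ) (z : Eu2 n × Eu N) :
    cmpA ι (un2 (lft c₁ c₂ z)) = (nn (z.2, c₂))⁻¹ • fibA ι z.2 :=
  map_smul (fibA ι) _ _

theorem cmpB_un2 (c₁ c₂ : ℝ) (z : Eu2 n × Eu N) :
    cmpB ι (un2 (lft c₁ c₂ z)) = (nn (z.2, c₂))⁻¹ • coordB ι z :=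
  map_smul (fibB ι) _ _

theorem cmpX_un2 (c₁ c₂ : ℝ) (z : Eu2 n × Eu N) :
    cmpX n N (un2 (lft c₁ c₂ z)) = (nn (z.1, c₁))⁻¹ • coordX n N z := rfl

theorem cmpY_un2 (c₁ c₂ : ℝ) (z : Eu2 n × Eu N) :
    cmpY n N (un2 (lft c₁ c₂ z)) = (nn (z.1, c₁))⁻¹ • coordY n N z := rfl

theorem phaseX_eq {c₁ c₂ : ℝ} (z : Eu2 n × Eu N) :
    phaseX ι c₁ c₂ z = nn (z.1, c₁) • cmpA ι (un2 (lft c₁ c₂ z)) := by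
  rw [cmpA_un2, smul_smul]; rfl

theorem coordB_eq {c₁ c₂ : ℝ} {z : Eu2 n × Eu N} (h2 : 0 < nn (z.2, c₂)) :
    coordB ι z = nn (z.2, c₂) • cmpB ι (un2 (lft c₁ c₂ z)) := by
  rw [cmpB_un2, smul_smul, mul_inv_cancel₀ h2.ne', one_smul]

theorem fderiv_phaseX_fibre {c₁ c₂ : ℝ} {z : Eu2 n × Eu N} (h1 : 0 < nn (z.1, c₁))
    (h2 : 0 < nn (z.2, c₂)) (δ : Eu N) :
    fderiv ℝ (phaseX ι c₁ c₂) z (0, δ)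
      = (nn (z.1, c₁) * (nn (z.2, c₂))⁻¹) • cmpTan ι (un2 (lft c₁ c₂ z)) δ := by
  have h3 : (inner ℝ (un2 (lft c₁ c₂ z)).2.1 δ : ℝ) = (nn (z.2, c₂))⁻¹ * inner ℝ z.2 δ :=
    inner_smul_left _ _ _
  rw [fderiv_phaseX ι h1 h2, cmpTan_apply, cmpA_un2, h3, inner_zero_right, mul_zero, zero_sub,
    smul_sub, smul_smul, smul_smul, sub_eq_add_neg, ← neg_smul]
  congr 2
  ring

/-- A change b of (x, y) affects X only through |(x, y, c₁)|, hence along θ₁, and can be compensated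
by moving θ₁ along itself. This is possible because ‖θ₁‖ < |(θ, c₂)|, so that θ₁/|(θ, c₂)| really
changes. -/
theorem exists_horizontal {c₁ c₂ : ℝ} {z : Eu2 n × Eu N} (h1 : 0 < nn (z.1, c₁))
    (h2 : 0 < nn (z.2, c₂)) (hA : ‖cmpA ι (un2 (lft c₁ c₂ z))‖ < 1) (b : Eu2 n) :
    ∃ δ : Eu N, fibB ι δ = 0 ∧ fderiv ℝ (phaseX ι c₁ c₂) z (b, δ) = 0 := by
  set l := nn (z.1, c₁)
  set m := nn (z.2, c₂)
  set a : ℝ := inner ℝ (fibA ι z.2) (fibA ι z.2)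
  have ha : (m⁻¹) ^ 2 * a < 1 := by
    rw [cmpA_un2, norm_smul, Real.norm_eq_abs, abs_of_pos (inv_pos.2 h2)] at hA
    have h3 : 0 ≤ m⁻¹ * ‖fibA ι z.2‖ := mul_nonneg (inv_pos.2 h2).le (norm_nonneg _)
    have h4 : (m⁻¹) ^ 2 * a = (m⁻¹ * ‖fibA ι z.2‖) ^ 2 := by
      rw [mul_pow, ← real_inner_self_eq_norm_sq]
    rw [h4]
    nlinarith
  obtain ⟨e, he1, he2⟩ := exists_fib ι (fibA ι z.2) 0
  -- The coefficient solves the scalar linear equation left after factoring out θ₁ in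
  -- `fderiv_phaseX`.
  refine ⟨(-(l⁻¹ * l⁻¹ * inner ℝ z.1 b) / (1 - (m⁻¹) ^ 2 * a)) • e, ?_, ?_⟩
  · rw [map_smul, he2, smul_zero]
  · have h5 : (inner ℝ z.2 e : ℝ) = a := by rw [inner_fib ι, he1, he2, inner_zero_right, add_zero]
    have h6 : 1 - (m⁻¹) ^ 2 * a ≠ 0 := by linarith
    rw [fderiv_phaseX ι h1 h2]
    dsimp only
    rw [map_smul, he1, inner_smul_right, h5, smul_smul, ← add_smul]
    convert zero_smul ℝ (fibA ι z.2)
    change l * m⁻¹ * (-(l⁻¹ * l⁻¹ * inner ℝ z.1 b) / (1 - m⁻¹ ^ 2 * a)) +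
      (l⁻¹ * m⁻¹ * inner ℝ z.1 b
        - l * m⁻¹ ^ 3 * (-(l⁻¹ * l⁻¹ * inner ℝ z.1 b) / (1 - m⁻¹ ^ 2 * a) * a)) = 0
    generalize inner ℝ z.1 b = k
    have h7 : l * l⁻¹ = 1 := mul_inv_cancel₀ h1.ne'
    set r := 1 - m⁻¹ ^ 2 * a
    have h8 : r * r⁻¹ = 1 := mul_inv_cancel₀ h6
    rw [div_eq_mul_inv]
    have h9 : l * m⁻¹ * (-(l⁻¹ * l⁻¹ * k) * r⁻¹) +
      (l⁻¹ * m⁻¹ * k - l * m⁻¹ ^ 3 * (-(l⁻¹ * l⁻¹ * k) * r⁻¹ * a))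
      = m⁻¹ * k * l⁻¹ * (1 - (l * l⁻¹) * r⁻¹ * (1 - m⁻¹ ^ 2 * a)) := by ring
    rw [h9, h7, one_mul, mul_comm r⁻¹, h8, sub_self, mul_zero]

end Compact

/-- Smooth ambient extensions of the maps of all heights and of their primitives. -/
structure LocalModel {n : ℕ} (χ : PartialEquiv (Amb n) (Amb n)) (Y Z : Amb n → Eu n)
    (O : Set (Amb n)) (G : Amb n → Eu n × Eu n) (sh : Amb n → ℝ) : Prop where
  isOpen : IsOpen O
  smoothG : ContDiffOn ℝ ∞ G O
  val : ∀ q ∈ O, IsHeights q.1.2 q.2.2 → (q.1.1, q.2.1) ∈ gcone q.1.2 q.2.2 χ.source ∧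
    G q = gmap Y Z q.1.2 q.2.2 (q.1.1, q.2.1) ∧ sh q = action Y Z q.1.2 q.2.2 (q.1.1, q.2.1)

/-! ### From the ambient model to the cones by homogeneity -/

section Model

variable {n N : ℕ} {χ : PartialEquiv (Amb n) (Amb n)} {Y Z : Amb n → Eu n} {O : Set (Amb n)}
  {G : Amb n → Eu n × Eu n} {sh : Amb n → ℝ} (ι : Eu N ≃ₗᵢ[ℝ] Eu2 n)

/-- Near the given point `gmap` is G restricted to the slice of fixed heights, so its derivative is
that of G along vectors with zero height components. -/
theorem LocalModel.fderiv_gmap (M : LocalModel χ Y Z O G sh) {q : Amb n} (hq : q ∈ O)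
    (hc : IsHeights q.1.2 q.2.2) (v : Eu n × Eu n) :
    fderiv ℝ (gmap Y Z q.1.2 q.2.2) (q.1.1, q.2.1) v = fderiv ℝ G q ((v.1, 0), (v.2, 0)) := by
  let r : Eu n × Eu n → Amb n := fun u => ((u.1, q.1.2), (u.2, q.2.2))
  have hr : HasFDerivAt r (((ContinuousLinearMap.fst ℝ _ _).prod 0).prod
      ((ContinuousLinearMap.snd ℝ _ _).prod 0)) (q.1.1, q.2.1) :=
    (hasFDerivAt_fst.prodMk (hasFDerivAt_const _ _)).prodMk
      (hasFDerivAt_snd.prodMk (hasFDerivAt_const _ _))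
  have hG : HasFDerivAt G (fderiv ℝ G q) (r (q.1.1, q.2.1)) :=
    ((M.smoothG.contDiffAt (M.isOpen.mem_nhds hq)).differentiableAt (by simp)).hasFDerivAt
  have h1 := (HasFDerivAt.comp (g := G) (f := r) _ hG hr).congr_of_eventuallyEq
    (f₁ := gmap Y Z q.1.2 q.2.2) (by
      filter_upwards [hr.continuousAt.preimage_mem_nhds (M.isOpen.mem_nhds hq)] with u hu
      exact (M.val (r u) hu hc).2.1.symm)
  rw [h1.fderiv]
  rfl

theorem isHeights_un2 {c₁ c₂ : ℝ} (hc : IsHeights c₁ c₂) (z : Eu2 n × Eu N) :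
    IsHeights (un2 (lft c₁ c₂ z)).1.2 (un2 (lft c₁ c₂ z)).2.2 :=
  ⟨mul_nonneg (inv_nonneg.2 (nn_nonneg _)) hc.1, mul_nonneg (inv_nonneg.2 (nn_nonneg _)) hc.2.1,
    hc.2.2.imp (fun h => by simp [un2, un, lft, h]) fun h => by simp [un2, un, lft, h]⟩

/-- The values of the local model at a point of the cone. -/
theorem LocalModel.at_point (M : LocalModel χ Y Z O G sh) {c₁ c₂ : ℝ} (hc : IsHeights c₁ c₂)
    {z : Eu2 n × Eu N} (h1 : 0 < nn (z.1, c₁)) (h2 : 0 < nn (z.2, c₂))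
    (hO : baseOf ι (un2 (lft c₁ c₂ z)) ∈ O) :
    (phaseX ι c₁ c₂ z, coordB ι z) ∈ gcone c₁ c₂ χ.source ∧
    gmap Y Z c₁ c₂ (phaseX ι c₁ c₂ z, coordB ι z) =
      scl n (nn (z.1, c₁)) (nn (z.2, c₂)) (G (baseOf ι (un2 (lft c₁ c₂ z)))) ∧
    action Y Z c₁ c₂ (phaseX ι c₁ c₂ z, coordB ι z) =
      nn (z.1, c₁) * nn (z.2, c₂) * sh (baseOf ι (un2 (lft c₁ c₂ z))) := by
  obtain ⟨a1, a2, a3⟩ := M.val _ hO (isHeights_un2 hc z)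
  have e1 : nn (z.1, c₁) * (un2 (lft c₁ c₂ z)).1.2 = c₁ := mul_inv_cancel_left₀ h1.ne' _
  have e2 : nn (z.2, c₂) * (un2 (lft c₁ c₂ z)).2.2 = c₂ := mul_inv_cancel_left₀ h2.ne' _
  have b1 := mem_gcone_smul_smul a1 h1 h2
  have b2 := gmap_smul_smul Y Z (c₁ := (un2 (lft c₁ c₂ z)).1.2) (c₂ := (un2 (lft c₁ c₂ z)).2.2)
    ((baseOf ι (un2 (lft c₁ c₂ z))).1.1, (baseOf ι (un2 (lft c₁ c₂ z))).2.1) h1 h2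
  have b3 := action_smul_smul Y Z (c₁ := (un2 (lft c₁ c₂ z)).1.2) (c₂ := (un2 (lft c₁ c₂ z)).2.2)
    ((baseOf ι (un2 (lft c₁ c₂ z))).1.1, (baseOf ι (un2 (lft c₁ c₂ z))).2.1) h1 h2
  have e3 : (phaseX ι c₁ c₂ z, coordB ι z)
      = (nn (z.1, c₁) • (baseOf ι (un2 (lft c₁ c₂ z))).1.1,
        nn (z.2, c₂) • (baseOf ι (un2 (lft c₁ c₂ z))).2.1) :=
    Prod.ext (phaseX_eq ι z) (coordB_eq ι h2)
  rw [e3, a2, a3]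
  rw [e1, e2] at b2 b3
  refine ⟨?_, b2, b3⟩
  convert b1 using 2
  · exact e1.symm
  · exact e2.symm

/-- The factor in front of v makes the rescaled argument a common multiple of (v, w). It cancels
against the degree of the second component, so the value depends on the direction of z only. -/
theorem LocalModel.fderiv_at_point (H : HomData χ Y Z) (M : LocalModel χ Y Z O G sh) {c₁ c₂ : ℝ}
    (hc : IsHeights c₁ c₂) {z : Eu2 n × Eu N} (h1 : 0 < nn (z.1, c₁)) (h2 : 0 < nn (z.2, c₂))
    (hO : baseOf ι (un2 (lft c₁ c₂ z)) ∈ O) (v w : Eu n) :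
    (fderiv ℝ (gmap Y Z c₁ c₂) (phaseX ι c₁ c₂ z, coordB ι z)
      ((nn (z.1, c₁) * (nn (z.2, c₂))⁻¹) • v, w)).2
      = (fderiv ℝ G (baseOf ι (un2 (lft c₁ c₂ z))) ((v, 0), (w, 0))).2 := by
  obtain ⟨a1, a2, a3⟩ := M.val _ hO (isHeights_un2 hc z)
  have e1 : nn (z.1, c₁) * (un2 (lft c₁ c₂ z)).1.2 = c₁ := mul_inv_cancel_left₀ h1.ne' _
  have e2 : nn (z.2, c₂) * (un2 (lft c₁ c₂ z)).2.2 = c₂ := mul_inv_cancel_left₀ h2.ne' _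
  have e3 : (phaseX ι c₁ c₂ z, coordB ι z)
      = (nn (z.1, c₁) • (baseOf ι (un2 (lft c₁ c₂ z))).1.1,
        nn (z.2, c₂) • (baseOf ι (un2 (lft c₁ c₂ z))).2.1) :=
    Prod.ext (phaseX_eq ι z) (coordB_eq ι h2)
  have b := fderiv_gmap_scl H (isHeights_un2 hc z) h1 h2 a1
    ((nn (z.1, c₁) * (nn (z.2, c₂))⁻¹) • v, w)
  rw [e1, e2] at b
  rw [e3, b, scl_apply, scl_apply]
  have e4 : ((nn (z.1, c₁))⁻¹ • (nn (z.1, c₁) * (nn (z.2, c₂))⁻¹) • v, (nn (z.2, c₂))⁻¹ • w)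
      = (nn (z.2, c₂))⁻¹ • (v, w) := by
    rw [smul_smul, ← mul_assoc, inv_mul_cancel₀ h1.ne', one_mul]; rfl
  dsimp only
  rw [e4, map_smul, Prod.smul_snd, smul_smul, mul_inv_cancel₀ h2.ne', one_smul]
  exact congrArg Prod.snd (M.fderiv_gmap hO (isHeights_un2 hc z) (v, w))

theorem contDiffOn_nn_gcone {E F : Type} [NormedAddCommGroup E] [InnerProductSpace ℝ E]
    [NormedAddCommGroup F] [InnerProductSpace ℝ F] {c₁ c₂ : ℝ} {U : Set ((E × ℝ) × (F × ℝ))} :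
    ContDiffOn ℝ ∞ (fun z : E × F => nn (z.1, c₁)) (gcone c₁ c₂ U) ∧
      ContDiffOn ℝ ∞ (fun z : E × F => nn (z.2, c₂)) (gcone c₁ c₂ U) :=
  ⟨fun z hz => (contDiffAt_nn_comp (f := fun z : E × F => (z.1, c₁)) (by fun_prop)
      hz.1).contDiffWithinAt,
    fun z hz => (contDiffAt_nn_comp (f := fun z : E × F => (z.2, c₂)) (by fun_prop)
      hz.2.1).contDiffWithinAt⟩

/-- The phase functions satisfy the hypotheses of the phase model on all three faces. -/
theorem LocalModel.phaseModel (H : HomData χ Y Z) (M : LocalModel χ Y Z O G sh) {c₁ c₂ : ℝ}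
    (hc : IsHeights c₁ c₂) (hN : N = n + n) {τ : ℝ} {Ω : Set (Cmp n N)} (hΩ : IsOpen Ω)
    (hO : ∀ P ∈ Ω, baseOf ι P ∈ O) (hA : ∀ P ∈ Ω, ‖cmpA ι P‖ < 1)
    (hinj : ∀ P ∈ Ω, Function.Injective (cmpFibre ι G τ P)) {φ : Eu2 n × Eu N → ℝ}
    (hφ : ∀ z ∈ gcone c₁ c₂ (Ω ∩ bdry (Eu2 n) (Eu N)),
      φ z = nn (z.1, c₁) * nn (z.2, c₂) * cmpPhase ι G sh τ (un2 (lft c₁ c₂ z))) :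
    PhaseModel ι (gcone c₁ c₂ (Ω ∩ bdry (Eu2 n) (Eu N))) (gcone c₁ c₂ χ.source) (gmap Y Z c₁ c₂)
      (action Y Z c₁ c₂) τ (phaseX ι c₁ c₂) (phaseM n N c₁ c₂) φ where
  isOpen_dom := isOpen_gcone hc ⟨Ω, hΩ, rfl⟩
  isOpen_base := isOpen_gcone hc H.source_open
  smoothC := contDiffOn_gmap H.source_open H.smoothY H.smoothZ hc
  smooth_s := contDiffOn_action H hc
  ds u hu d := fderiv_action H hc hu d
  smoothX := (contDiffOn_nn_gcone.1.mul (contDiffOn_nn_gcone.2.inv fun z hz => hz.2.1.ne')).smul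
    ((fibA ι).contDiff.comp contDiff_snd).contDiffOn
  smooth_m := contDiffOn_nn_gcone.2.mul (contDiffOn_nn_gcone.1.inv fun z hz => hz.1.ne')
  mem z hz := (M.at_point ι hc hz.1 hz.2.1 (hO _ hz.2.2.1)).1
  -- All terms of the model phase have degree one in the base norm and in the fibre norm; m is the
  -- ratio that makes this true of the quadratic term.
  eq z hz := by
    obtain ⟨-, a2, a3⟩ := M.at_point ι hc hz.1 hz.2.1 (hO _ hz.2.2.1)
    have h1 := hz.1.ne'
    have h2 := hz.2.1.ne'
    have e1 : coordX n N z = nn (z.1, c₁) • cmpX n N (un2 (lft c₁ c₂ z)) := by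
      rw [cmpX_un2, smul_smul, mul_inv_cancel₀ h1, one_smul]
    have e2 : coordY n N z = nn (z.1, c₁) • cmpY n N (un2 (lft c₁ c₂ z)) := by
      rw [cmpY_un2, smul_smul, mul_inv_cancel₀ h1, one_smul]
    rw [hφ z hz, a2, a3, e1, e2, phaseX_eq, coordB_eq ι (c₁ := c₁) hz.2.1, scl_apply, cmpPhase,
      phaseM]
    dsimp only
    rw [← smul_sub, ← smul_sub, norm_smul, inner_smul_left, inner_smul_right, inner_smul_left,
      inner_smul_right, mul_pow, Real.norm_eq_abs, sq_abs]
    simp only [conj_trivial]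
    field_simp
  -- By homogeneity the two conditions are those of `cmpFibre` at the projected point, so
  -- injectivity over Ω gives it over all three cones.
  injective z hz δ hδ1 hδ2 := by
    have h1 := hz.1.ne'
    have h2 := hz.2.1.ne'
    refine (injective_iff_map_eq_zero _).1 (hinj _ hz.2.2.1) δ ?_
    rw [fderiv_phaseX_fibre ι hz.1 hz.2.1] at hδ1 hδ2
    rw [M.fderiv_at_point ι H hc hz.1 hz.2.1 (hO _ hz.2.2.1)] at hδ2
    rw [cmpFibre_apply, hδ2]
    refine Prod.ext ?_ rfl
    rw [fderiv_phaseM hz.1 hz.2.1, smul_smul, phaseM, phaseX_eq] at hδ1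
    have e1 : coordX n N z = nn (z.1, c₁) • cmpX n N (un2 (lft c₁ c₂ z)) := by
      rw [cmpX_un2, smul_smul, mul_inv_cancel₀ h1, one_smul]
    have h3 : (inner ℝ (un2 (lft c₁ c₂ z)).2.1 δ : ℝ) = (nn (z.2, c₂))⁻¹ * inner ℝ z.2 δ :=
      inner_smul_left _ _ _
    rw [e1, ← smul_sub, smul_smul] at hδ1
    rw [h3]
    refine Eq.trans ?_ hδ1
    dsimp only
    congr 2
    · congr 1
      field_simp
    · field_simp
  horizontal z hz b := exists_horizontal ι hz.1 hz.2.1 (hA _ hz.2.2.1) b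
  finrank_eq := hN

end Model

/-! ### The critical points in compactified coordinates -/

section Jmap

variable {n N : ℕ} {χ : PartialEquiv (Amb n) (Amb n)} {Y Z : Amb n → Eu n} (ι : Eu N ≃ₗᵢ[ℝ] Eu2 n)

/-- The normalising factor of the base variables. -/
def jK (Y : Amb n → Eu n) (p : Amb n) : ℝ := (√(1 + ‖Y p‖ ^ 2))⁻¹

/-- The normalising factor of the fibre variables. -/
def jR (Y : Amb n → Eu n) (p : Amb n) : ℝ := √(1 - ‖jK Y p • p.1.1‖ ^ 2)

/-- The critical point of the phase function over a boundary point. -/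
def jmap (Y : Amb n → Eu n) (p : Amb n) : Cmp n N :=
  ((WithLp.toLp 2 (jK Y p • p.1.1, jK Y p • Y p), jK Y p * p.1.2),
    (ι.symm (WithLp.toLp 2 (jK Y p • p.1.1, jR Y p • p.2.1)), jR Y p * p.2.2))

theorem fibA_symm (a b : Eu n) : fibA ι (ι.symm (WithLp.toLp 2 (a, b))) = a := by
  change (ι (ι.symm _)).fst = a
  rw [ι.apply_symm_apply]; rfl

theorem fibB_symm (a b : Eu n) : fibB ι (ι.symm (WithLp.toLp 2 (a, b))) = b := by
  change (ι (ι.symm _)).snd = b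
  rw [ι.apply_symm_apply]; rfl

theorem jK_pos (p : Amb n) : 0 < jK Y p := inv_pos.2 (Real.sqrt_pos.2 (by positivity))

theorem cmpA_jmap (p : Amb n) : cmpA ι (jmap ι Y p) = jK Y p • p.1.1 := fibA_symm ι _ _

theorem cmpX_jmap (p : Amb n) : cmpX n N (jmap ι Y p) = jK Y p • p.1.1 := rfl

theorem cmpB_jmap (p : Amb n) : cmpB ι (jmap ι Y p) = jR Y p • p.2.1 := fibB_symm ι _ _

theorem baseOf_jmap (p : Amb n) : baseOf ι (jmap ι Y p) = (jK Y p • p.1, jR Y p • p.2) :=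
  Prod.ext (Prod.ext (cmpA_jmap ι p) rfl) (Prod.ext (cmpB_jmap ι p) rfl)

theorem continuousOn_jmap {S : Set (Amb n)} (hY : ContinuousOn Y S) :
    ContinuousOn (jmap (N := N) ι Y) S := by
  have hk : ContinuousOn (jK Y) S :=
    (Real.continuous_sqrt.comp_continuousOn (continuousOn_const.add (hY.norm.pow 2))).inv₀
      fun p _ => (Real.sqrt_pos.2 (add_pos_of_pos_of_nonneg one_pos (sq_nonneg _))).ne'
  have hx : ContinuousOn (fun p : Amb n => jK Y p • p.1.1) S := hk.smul (by fun_prop)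
  have hr : ContinuousOn (jR Y) S :=
    Real.continuous_sqrt.comp_continuousOn (continuousOn_const.sub (hx.norm.pow 2))
  have ht : Continuous (fun v : Eu n × Eu n => (WithLp.toLp 2 v : Eu2 n)) :=
    WithLp.prod_continuous_toLp 2 _ _
  exact ((ht.comp_continuousOn (hx.prodMk (hk.smul hY))).prodMk (hk.mul (by fun_prop))).prodMk
    ((ι.symm.continuous.comp_continuousOn (ht.comp_continuousOn
      (hx.prodMk (hr.smul (by fun_prop))))).prodMk (hr.mul (by fun_prop)))

theorem norm_eu2_sq (b : Eu2 n) : ‖b‖ ^ 2 = ‖b.fst‖ ^ 2 + ‖b.snd‖ ^ 2 := by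
  simp only [← real_inner_self_eq_norm_sq]
  exact WithLp.prod_inner_apply b b

/-- The norms of the fibre variables over a point of the cone. -/
theorem nn_fibre_sq {c₁ c₂ : ℝ} {z : Eu2 n × Eu N} (h2 : 0 < nn (z.2, c₂)) :
    (1 - ‖cmpA ι (un2 (lft c₁ c₂ z))‖ ^ 2) * nn (z.2, c₂) ^ 2 = nn (coordB ι z, c₂) ^ 2 := by
  have h3 := nn_sq (z.2, c₂)
  have h4 := norm_fib_sq ι z.2
  have h5 := nn_sq (coordB ι z, c₂)
  have h6 : fibB ι z.2 = coordB ι z := rfl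
  rw [cmpA_un2, norm_smul, mul_pow, Real.norm_eq_abs, sq_abs, sub_mul, mul_assoc,
    mul_comm (‖fibA ι z.2‖ ^ 2), ← mul_assoc, ← mul_pow, inv_mul_cancel₀ h2.ne', h5, h3]
  dsimp only at h3 ⊢
  rw [h4, h6]
  ring

/-- The point of the compactified space that belongs to a critical point. -/
theorem jmap_eq {c₁ c₂ : ℝ} {z : Eu2 n × Eu N} (h1 : 0 < nn (z.1, c₁)) (h2 : 0 < nn (z.2, c₂))
    (hl : 0 < nn (coordX n N z, c₁)) (hl2 : 0 < nn (coordB ι z, c₂))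
    (hX : phaseX ι c₁ c₂ z = coordX n N z)
    (hy : coordY n N z = (gmap Y Z c₁ c₂ (coordX n N z, coordB ι z)).1) :
    jmap ι Y (un2 (lft c₁ c₂ (coordX n N z, coordB ι z))) = un2 (lft c₁ c₂ z) := by
  set u := (coordX n N z, coordB ι z)
  set p := un2 (lft c₁ c₂ u)
  set l := nn (coordX n N z, c₁)
  set l₂ := nn (coordB ι z, c₂)
  have hYp : Y p = l⁻¹ • coordY n N z := by
    rw [hy]
    change Y p = l⁻¹ • l • Y p
    rw [smul_smul, inv_mul_cancel₀ hl.ne', one_smul]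
  -- On the critical set y = l Y(p), so |(x, y, c₁)|² = l²(1 + |Y(p)|²): the normalisation of (x, y)
  -- is a function of p alone.
  have hk : jK Y p * l⁻¹ = (nn (z.1, c₁))⁻¹ := by
    have h3 : nn (z.1, c₁) = √(1 + ‖Y p‖ ^ 2) * l := by
      rw [← Real.sqrt_sq hl.le, ← Real.sqrt_mul (by positivity), nn]
      congr 1
      rw [hYp, norm_smul, mul_pow, Real.norm_eq_abs, sq_abs, add_mul, one_mul, mul_right_comm,
        ← mul_pow, inv_mul_cancel₀ hl.ne', one_pow, one_mul, nn_sq]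
      dsimp only
      rw [norm_eu2_sq z.1]
      change ‖coordX n N z‖ ^ 2 + ‖coordY n N z‖ ^ 2 + c₁ ^ 2 = _
      ring
    rw [h3, mul_inv, jK]
  have hx : jK Y p • p.1.1 = (nn (z.1, c₁))⁻¹ • coordX n N z := by
    rw [← hk, ← smul_smul]; rfl
  have hA : fibA ι ((nn (z.2, c₂))⁻¹ • z.2) = jK Y p • p.1.1 := by
    rw [hx, ← hX, phaseX, smul_smul, ← mul_assoc, inv_mul_cancel₀ h1.ne', one_mul, map_smul]
  -- The share of θ₁ in the norm of (θ, c₂) equals that of x in the norm of (x, y, c₁), so the fibre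
  -- normalisation is a function of p too.
  have hr : jR Y p * l₂⁻¹ = (nn (z.2, c₂))⁻¹ := by
    have h3 := nn_fibre_sq ι (c₁ := c₁) h2
    have h4 : cmpA ι (un2 (lft c₁ c₂ z)) = jK Y p • p.1.1 := hA
    rw [h4] at h3
    have h5 : 1 - ‖jK Y p • p.1.1‖ ^ 2 = (l₂ * (nn (z.2, c₂))⁻¹) ^ 2 := by
      rw [mul_pow, ← h3, mul_assoc, ← mul_pow, mul_inv_cancel₀ h2.ne', one_pow, mul_one]
    rw [jR, h5, Real.sqrt_sq (mul_nonneg hl2.le (inv_nonneg.2 h2.le)), mul_right_comm,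
      mul_inv_cancel₀ hl2.ne', one_mul]
  refine Prod.ext (Prod.ext ?_ ?_) (Prod.ext ?_ ?_)
  · refine eu2_ext ?_ ?_
    · exact hx
    · change jK Y p • Y p = (nn (z.1, c₁))⁻¹ • coordY n N z
      rw [hYp, smul_smul, hk]
  · change jK Y p * (l⁻¹ * c₁) = (nn (z.1, c₁))⁻¹ * c₁
    rw [← mul_assoc, hk]
  · refine fib_ext ι ?_ ?_
    · exact (fibA_symm ι _ _).trans hA.symm
    · refine (fibB_symm ι _ _).trans ?_
      change jR Y p • l₂⁻¹ • coordB ι z = fibB ι ((nn (z.2, c₂))⁻¹ • z.2)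
      rw [smul_smul, hr, map_smul]; rfl
  · change jR Y p * (l₂⁻¹ * c₂) = (nn (z.2, c₂))⁻¹ * c₂
    rw [← mul_assoc, hr]

/-- Every point of the graph comes from a critical point. -/
theorem exists_crit_point {c₁ c₂ : ℝ} {u : Eu n × Eu n} (hl : 0 < nn (u.1, c₁))
    (hl2 : 0 < nn (u.2, c₂)) (hr : ‖jK Y (un2 (lft c₁ c₂ u)) • (un2 (lft c₁ c₂ u)).1.1‖ < 1) :
    ∃ z : Eu2 n × Eu N, 0 < nn (z.1, c₁) ∧ 0 < nn (z.2, c₂) ∧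
      jmap ι Y (un2 (lft c₁ c₂ u)) = un2 (lft c₁ c₂ z) ∧ coordX n N z = u.1 ∧
      phaseX ι c₁ c₂ z = u.1 ∧ coordB ι z = u.2 ∧ coordY n N z = (gmap Y Z c₁ c₂ u).1 := by
  set p := un2 (lft c₁ c₂ u)
  set y := (gmap Y Z c₁ c₂ u).1
  set l := nn (u.1, c₁)
  let b : Eu2 n := WithLp.toLp 2 (u.1, y)
  have hy : y = l • Y p := rfl
  have hb : ‖b‖ ^ 2 = ‖u.1‖ ^ 2 + ‖y‖ ^ 2 := norm_eu2_sq b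
  have h1 : 0 < nn (b, c₁) := by
    have h3 : l ≤ nn (b, c₁) := Real.sqrt_le_sqrt (by
      dsimp only; rw [hb]; linarith [sq_nonneg ‖y‖])
    exact hl.trans_le h3
  have hk : jK Y p * l⁻¹ = (nn (b, c₁))⁻¹ := by
    have h3 : nn (b, c₁) = √(1 + ‖Y p‖ ^ 2) * l := by
      rw [← Real.sqrt_sq hl.le, ← Real.sqrt_mul (by positivity), nn]
      congr 1
      dsimp only
      rw [hb, hy, norm_smul, mul_pow, Real.norm_eq_abs, sq_abs, nn_sq]
      ring
    rw [h3, mul_inv, jK]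
  have hx : jK Y p • p.1.1 = (nn (b, c₁))⁻¹ • u.1 := by
    rw [← hk, ← smul_smul]; rfl
  set r := jR Y p
  have hr2 : r ^ 2 = 1 - ‖jK Y p • p.1.1‖ ^ 2 :=
    Real.sq_sqrt (by nlinarith [norm_nonneg (jK Y p • p.1.1)])
  have hr0 : 0 < r := Real.sqrt_pos.2 (by nlinarith [norm_nonneg (jK Y p • p.1.1)])
  -- The value forced on |(θ, c₂)| by `nn_fibre_sq`; θ₁ is then fixed by X = x.
  set m := nn (u.2, c₂) * r⁻¹
  have hm : 0 < m := mul_pos hl2 (inv_pos.2 hr0)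
  let θ : Eu N := ι.symm (WithLp.toLp 2 (m • jK Y p • p.1.1, u.2))
  have hθA : fibA ι θ = m • jK Y p • p.1.1 := fibA_symm ι _ _
  have hθB : fibB ι θ = u.2 := fibB_symm ι _ _
  have hmr : m * r = nn (u.2, c₂) := inv_mul_cancel_right₀ hr0.ne' _
  have h2 : nn (θ, c₂) = m := by
    have h3 : ‖θ‖ ^ 2 + c₂ ^ 2 = m ^ 2 := by
      have h4 := nn_sq (u.2, c₂)
      rw [norm_fib_sq ι, hθA, hθB, norm_smul, mul_pow, Real.norm_eq_abs, sq_abs]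
      rw [← hmr, mul_pow, hr2] at h4
      dsimp only at h4
      linarith
    rw [nn, ← Real.sqrt_sq hm.le]
    exact congrArg _ h3
  have hX : phaseX ι c₁ c₂ (b, θ) = u.1 := by
    rw [phaseX]
    dsimp only
    rw [h2, hθA, hx, smul_smul, smul_smul]
    have : nn (b, c₁) * m⁻¹ * m * (nn (b, c₁))⁻¹ = 1 := by
      field_simp
    rw [this, one_smul]
  refine ⟨(b, θ), h1, by dsimp only; rw [h2]; exact hm, ?_, rfl, hX, hθB, rfl⟩
  have hu : (coordX n N (b, θ), coordB ι (b, θ)) = u := Prod.ext rfl hθB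
  have := jmap_eq (Y := Y) (Z := Z) ι (z := (b, θ)) (c₁ := c₁) (c₂ := c₂) h1
    (by dsimp only; rw [h2]; exact hm) hl (by
      rw [show coordB ι (b, θ) = u.2 from hθB]; exact hl2) hX (by rw [hu]; rfl)
  rw [hu] at this
  exact this

theorem gmap_mem_gcone_target (H : HomData χ Y Z) {c₁ c₂ : ℝ} {u : Eu n × Eu n}
    (hu : u ∈ gcone c₁ c₂ χ.source) : gmap Y Z c₁ c₂ u ∈ gcone c₁ c₂ χ.target ∧
      un2 (lft c₁ c₂ (gmap Y Z c₁ c₂ u)) = χ (un2 (lft c₁ c₂ u)) := by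
  set p := un2 (lft c₁ c₂ u)
  obtain ⟨h1, h2, h3⟩ := hu
  obtain ⟨h4, h5⟩ := H.pos p h3
  have e1 : ((gmap Y Z c₁ c₂ u).1, c₁) = nn (u.1, c₁) • (Y p, p.1.2) :=
    Prod.ext rfl (mul_inv_cancel_left₀ h1.ne' _).symm
  have e2 : ((gmap Y Z c₁ c₂ u).2, c₂) = nn (u.2, c₂) • (Z p, p.2.2) :=
    Prod.ext rfl (mul_inv_cancel_left₀ h2.ne' _).symm
  have e3 : un2 (lft c₁ c₂ (gmap Y Z c₁ c₂ u)) = χ p := by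
    rw [H.proj p h3]
    simp only [un2, lft, e1, e2, un_smul h1, un_smul h2]
  refine ⟨⟨?_, ?_, ?_⟩, e3⟩
  · rw [e1, nn_smul h1.le]; exact mul_pos h1 h4
  · rw [e2, nn_smul h2.le]; exact mul_pos h2 h5
  · rw [e3]; exact χ.map_source h3

/-- Critical points over Ω correspond to the points of the source that `jmap` sends into Ω. The
image condition is automatic, since V is the whole target. -/
theorem LocalModel.parametrises {O : Set (Amb n)}
    {G : Amb n → Eu n × Eu n} {sh : Amb n → ℝ} (H : HomData χ Y Z) (M : LocalModel χ Y Z O G sh)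
    {c₁ c₂ : ℝ} (hc : IsHeights c₁ c₂) (hN : N = n + n) {τ : ℝ} {Ω : Set (Cmp n N)}
    (hΩ : IsOpen Ω) (hO : ∀ P ∈ Ω, baseOf ι P ∈ O) (hA : ∀ P ∈ Ω, ‖cmpA ι P‖ < 1)
    (hinj : ∀ P ∈ Ω, Function.Injective (cmpFibre ι G τ P)) {φ : Eu2 n × Eu N → ℝ}
    (hφ : ∀ z ∈ gcone c₁ c₂ (Ω ∩ bdry (Eu2 n) (Eu N)),
      φ z = nn (z.1, c₁) * nn (z.2, c₂) * cmpPhase ι G sh τ (un2 (lft c₁ c₂ z))) :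
    Parametrises φ (gcone c₁ c₂ (Ω ∩ bdry (Eu2 n) (Eu N)))
      (graphOver (gmap Y Z c₁ c₂) (gcone c₁ c₂ (χ.source ∩ jmap ι Y ⁻¹' Ω))
        (gcone c₁ c₂ χ.target)) := by
  have hP := M.phaseModel ι H hc hN hΩ hO hA hinj hφ
  refine hP.parametrises ?_ ?_ ?_
  -- On the critical set θ₁/|(θ, c₂)| = x/|(x, y, c₁)| depends on the base point only, and has norm
  -- < 1. With θ₂ given, `nn_fibre_sq` then determines |(θ, c₂)|, hence θ₁.
  · intro z hz z' hz' h1 hB hX hX'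
    have e1 := nn_fibre_sq ι (c₁ := c₁) hz.2.1
    have e2 := nn_fibre_sq ι (c₁ := c₁) hz'.2.1
    have a1 : cmpA ι (un2 (lft c₁ c₂ z)) = (nn (z.1, c₁))⁻¹ • coordX n N z := by
      rw [hX, phaseX_eq, smul_smul, inv_mul_cancel₀ hz.1.ne', one_smul]
    have a2 : cmpA ι (un2 (lft c₁ c₂ z')) = (nn (z.1, c₁))⁻¹ • coordX n N z := by
      have : coordX n N z = coordX n N z' := congrArg (fun b : Eu2 n => b.fst) h1
      rw [this, hX', phaseX_eq, h1, smul_smul, inv_mul_cancel₀ hz'.1.ne', one_smul]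
    have hlt := hA _ hz.2.2.1
    rw [← hB, ← e1, a1, a2] at e2
    rw [a1] at hlt
    have hpos : 1 - ‖(nn (z.1, c₁))⁻¹ • coordX n N z‖ ^ 2 ≠ 0 := by
      nlinarith [norm_nonneg ((nn (z.1, c₁))⁻¹ • coordX n N z)]
    have e3 : nn (z'.2, c₂) = nn (z.2, c₂) :=
      (sq_eq_sq₀ (nn_nonneg _) (nn_nonneg _)).1 (mul_left_cancel₀ hpos e2)
    refine fib_ext ι ?_ hB
    rw [cmpA_un2] at a1 a2
    rw [← a2, e3] at a1
    exact smul_right_injective _ (inv_ne_zero hz.2.1.ne') a1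
  · intro z hz hX hy
    have hu := hP.mem z hz
    have hj := jmap_eq (Y := Y) (Z := Z) ι hz.1 hz.2.1 (by rw [hX]; exact hu.1) hu.2.1 hX.symm
      (by rw [hy, hX])
    refine ⟨⟨hu.1, hu.2.1, hu.2.2, ?_⟩, (gmap_mem_gcone_target H hu).1⟩
    rw [mem_preimage, ← hX, hj]
    exact hz.2.2.1
  · intro u hu _
    have hr := hA _ hu.2.2.2
    rw [cmpA_jmap] at hr
    obtain ⟨z, h1, h2, hj, hx, hX, hB, hy⟩ :=
      exists_crit_point (N := N) (Z := Z) ι hu.1 hu.2.1 hr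
    refine ⟨z, ⟨h1, h2, ?_, hc.mem_bdry h1 h2⟩, hx, hX, hB, hy⟩
    rw [← hj]
    exact hu.2.2.2

/-- For c₂ = 0, (1 - ‖A‖²)|θ|² = |θ₂|² with ‖A‖ < 1 shows θ₂ ≠ 0 whenever θ ≠ 0. For c₂ > 0 the zero
section is a possible location of critical points and has to be excluded by hypothesis. -/
theorem LocalModel.fderiv_ne_zero {O : Set (Amb n)}
    {G : Amb n → Eu n × Eu n} {sh : Amb n → ℝ} (H : HomData χ Y Z) (M : LocalModel χ Y Z O G sh)
    {c₁ c₂ : ℝ} (hc : IsHeights c₁ c₂) (hN : N = n + n) {τ : ℝ} {Ω : Set (Cmp n N)}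
    (hΩ : IsOpen Ω) (hO : ∀ P ∈ Ω, baseOf ι P ∈ O) (hA : ∀ P ∈ Ω, ‖cmpA ι P‖ < 1)
    (hinj : ∀ P ∈ Ω, Function.Injective (cmpFibre ι G τ P)) {φ : Eu2 n × Eu N → ℝ}
    (hφ : ∀ z ∈ gcone c₁ c₂ (Ω ∩ bdry (Eu2 n) (Eu N)),
      φ z = nn (z.1, c₁) * nn (z.2, c₂) * cmpPhase ι G sh τ (un2 (lft c₁ c₂ z)))
    (hne : c₂ = 0 ∨ ∀ P ∈ Ω, cmpB ι P ≠ 0 ∨ (G (baseOf ι P)).2 ≠ 0) :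
    ∀ z ∈ gcone c₁ c₂ (Ω ∩ bdry (Eu2 n) (Eu N)), fderiv ℝ φ z ≠ 0 := by
  intro z hz
  have hP := M.phaseModel ι H hc hN hΩ hO hA hinj hφ
  refine hP.fderiv_ne_zero hz fun _ _ => ?_
  rcases hne with h0 | hne
  · left
    intro hB
    have e1 := nn_fibre_sq ι (c₁ := c₁) hz.2.1
    have e2 : nn ((0 : Eu n), (0 : ℝ)) ^ 2 = 0 := by rw [nn_sq]; simp
    rw [hB] at e1
    replace e1 : _ = (0 : ℝ) := e1.trans (by rw [h0]; exact e2)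
    have hlt := hA _ hz.2.2.1
    have hpos : 0 < 1 - ‖cmpA ι (un2 (lft c₁ c₂ z))‖ ^ 2 := by
      nlinarith [norm_nonneg (cmpA ι (un2 (lft c₁ c₂ z)))]
    have := mul_pos hpos (pow_pos hz.2.1 2)
    rw [e1] at this
    norm_num at this
  · refine (hne _ hz.2.2.1).imp (fun h => ?_) fun h => ?_
    · rw [coordB_eq ι hz.2.1]
      exact smul_ne_zero hz.2.1.ne' h
    · rw [(M.at_point ι hc hz.1 hz.2.1 (hO _ hz.2.2.1)).2.1]
      exact smul_ne_zero hz.2.1.ne' h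

end Jmap

/-! ### Parametrisation near a boundary point -/

theorem exists_contDiff_eventuallyEq {E : Type*} [NormedAddCommGroup E] [NormedSpace ℝ E]
    [FiniteDimensional ℝ E] {f : E → ℝ} {O : Set E} (hO : IsOpen O) (hf : ContDiffOn ℝ ∞ f O)
    {x : E} (hx : x ∈ O) : ∃ g : E → ℝ, ContDiff ℝ ∞ g ∧ g =ᶠ[𝓝 x] f := by
  obtain ⟨ε, hε, hball⟩ := Metric.isOpen_iff.1 hO x hx
  let b : ContDiffBump x := ⟨ε / 4, ε / 2, by positivity, by linarith⟩
  refine ⟨fun y => b y * f y, ?_, ?_⟩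
  · rw [contDiff_iff_contDiffAt]
    intro y
    by_cases hy : y ∈ Metric.ball x ε
    · exact b.contDiffAt.mul (hf.contDiffAt (hO.mem_nhds (hball hy)))
    · refine (contDiffAt_const (c := (0 : ℝ))).congr_of_eventuallyEq ?_
      have h1 : y ∈ (Metric.closedBall x (ε / 2))ᶜ := by
        simp only [mem_compl_iff, Metric.mem_closedBall, Metric.mem_ball, not_le, not_lt] at hy ⊢
        linarith
      filter_upwards [Metric.isClosed_closedBall.isOpen_compl.mem_nhds h1] with w hw
      rw [mem_compl_iff, Metric.mem_closedBall, not_le] at hw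
      rw [b.zero_of_le_dist hw.le, zero_mul]
  · filter_upwards [b.eventuallyEq_one] with y hy
    rw [hy, Pi.one_apply, one_mul]

theorem exists_fibre_equiv (n : ℕ) : Nonempty (Eu (n + n) ≃ₗᵢ[ℝ] Eu2 n) := by
  have h : Module.finrank ℝ (Eu2 n) = n + n := by
    rw [(WithLp.linearEquiv 2 ℝ (Eu n × Eu n)).finrank_eq]; simp
  exact ⟨((stdOrthonormalBasis ℝ (Eu2 n)).reindex (finCongr h)).repr.symm⟩

section Point

variable {n N : ℕ} {χ : PartialEquiv (Amb n) (Amb n)} {Y Z : Amb n → Eu n}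

/-- Strictness comes from `H.pos`: |x|² + c₁² = 1 and |Y|² + c₁² > 0 give |x|² < 1 + |Y|². -/
theorem norm_jK_smul_lt_one (H : HomData χ Y Z) {p : Amb n} (hp : p ∈ χ.source)
    (hb : p ∈ bdry (Eu n) (Eu n)) : ‖jK Y p • p.1.1‖ < 1 := by
  have h1 := (mem_hemi_of_mem_bdry hb).1.1
  have h2 := nn_sq (Y p, p.1.2)
  have h3 := pow_pos (H.pos p hp).1 2
  rw [h2] at h3
  dsimp only at h3
  rw [norm_smul, Real.norm_eq_abs, abs_of_pos (jK_pos p), jK, inv_mul_lt_iff₀ (by positivity),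
    mul_one]
  exact Real.lt_sqrt_of_sq_lt (by linarith)

theorem jR_pos (H : HomData χ Y Z) {p : Amb n} (hp : p ∈ χ.source)
    (hb : p ∈ bdry (Eu n) (Eu n)) : 0 < jR Y p := by
  have := norm_jK_smul_lt_one H hp hb
  exact Real.sqrt_pos.2 (by nlinarith [norm_nonneg (jK Y p • p.1.1)])

theorem isHeights_of_mem_bdry {p : Amb n} (hb : p ∈ bdry (Eu n) (Eu n)) {s t : ℝ} (hs : 0 < s)
    (ht : 0 < t) : IsHeights (s • p.1).2 (t • p.2).2 := by
  have h := mem_hemi_of_mem_bdry hb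
  refine ⟨mul_nonneg hs.le h.1.2, mul_nonneg ht.le h.2.2, ?_⟩
  rcases hb with hb | hb
  · exact Or.inl (by simp [hb.2.2])
  · exact Or.inr (by simp [hb.2.2])

variable (ι : Eu N ≃ₗᵢ[ℝ] Eu2 n)

/-- For a suitable parameter, the fibre map at the base point is injective. -/
theorem LocalModel.exists_injective {O : Set (Amb n)} {G : Amb n → Eu n × Eu n} {sh : Amb n → ℝ}
    (H : HomData χ Y Z) (M : LocalModel χ Y Z O G sh) {p : Amb n} (hp : p ∈ χ.source)
    (hb : p ∈ bdry (Eu n) (Eu n)) (hO : baseOf ι (jmap ι Y p) ∈ O) :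
    ∃ τ : ℝ, Function.Injective (cmpFibre ι G τ (jmap ι Y p)) := by
  set P : Cmp n N := jmap ι Y p
  have hc : IsHeights (baseOf ι P).1.2 (baseOf ι P).2.2 := by
    rw [baseOf_jmap]; exact isHeights_of_mem_bdry hb (jK_pos p) (jR_pos H hp hb)
  obtain ⟨hmem, -, -⟩ := M.val _ hO hc
  set L := fderiv ℝ (gmap Y Z (baseOf ι P).1.2 (baseOf ι P).2.2)
    ((baseOf ι P).1.1, (baseOf ι P).2.1)
  have hL : ∀ v w, symp (L v) (L w) = symp v w := isSymplecticOn_gmap H hc _ hmem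
  obtain ⟨τ, hτ⟩ := exists_transversal hL one_pos
  let T : Eu n →ₗ[ℝ] Eu n :=
    ((ContinuousLinearMap.snd ℝ _ _).comp (L.comp (ContinuousLinearMap.inl ℝ _ _))
      + τ • (ContinuousLinearMap.snd ℝ _ _).comp (L.comp (ContinuousLinearMap.inr ℝ _ _))
      : Eu n →L[ℝ] Eu n).toLinearMap
  have hT : Function.Injective T := LinearMap.injective_iff_surjective.2 fun v => by
    obtain ⟨w, hw⟩ := hτ v
    exact ⟨w, by rw [one_smul] at hw; exact hw⟩
  refine ⟨τ, (injective_iff_map_eq_zero _).2 fun δ hδ => ?_⟩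
  rw [cmpFibre_apply] at hδ
  have h1 := congrArg Prod.fst hδ
  have h2 := congrArg Prod.snd hδ
  -- At the critical point the quadratic correction drops out. A kernel vector has θ₂-part τ times
  -- its tangential part, and the second component becomes the invertible T applied to the
  -- tangential part.
  have h3 : cmpX n N P - cmpA ι P = 0 := by rw [cmpX_jmap, cmpA_jmap, sub_self]
  dsimp only at h1 h2
  rw [h3, smul_zero, add_zero] at h1
  have h4 : fibB ι δ = τ • cmpTan ι P δ := sub_eq_zero.1 h1
  have h5 := M.fderiv_gmap hO hc (cmpTan ι P δ, fibB ι δ)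
  dsimp only at h5
  rw [← h5] at h2
  have h6 : T (cmpTan ι P δ) = 0 := by
    have e : (cmpTan ι P δ, fibB ι δ) = (cmpTan ι P δ, 0) + τ • ((0 : Eu n), cmpTan ι P δ) := by
      rw [h4]; simp
    change (L (cmpTan ι P δ, fibB ι δ)).2 = 0 at h2
    rw [e, map_add, map_smul] at h2
    exact h2
  have h7 : cmpTan ι P δ = 0 := (injective_iff_map_eq_zero T).1 hT _ h6
  have h8 : fibB ι δ = 0 := by rw [h4, h7, smul_zero]
  rw [cmpTan_apply, sub_eq_zero] at h7
  -- With zero tangential part, δ is a multiple of A in the θ₁-direction, the multiple being k = ⟨θ,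
  -- δ⟩. Pairing with θ gives k = k‖A‖², so k = 0.
  have h9 : (inner ℝ P.2.1 δ : ℝ) = 0 := by
    have e1 : (inner ℝ P.2.1 δ : ℝ) = inner ℝ P.2.1 δ * ‖cmpA ι P‖ ^ 2 := by
      conv_lhs => rw [inner_fib ι, h8, inner_zero_right, add_zero, h7, inner_smul_right]
      rw [← real_inner_self_eq_norm_sq]; rfl
    have e2 : ‖cmpA ι P‖ < 1 := by rw [cmpA_jmap]; exact norm_jK_smul_lt_one H hp hb
    have e3 : (1 - ‖cmpA ι P‖ ^ 2) ≠ 0 := by nlinarith [norm_nonneg (cmpA ι P)]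
    have e4 : (inner ℝ P.2.1 δ : ℝ) * (1 - ‖cmpA ι P‖ ^ 2) = 0 := by linarith
    exact (mul_eq_zero.1 e4).resolve_right e3
  rw [h9, zero_smul] at h7
  exact fib_ext ι (h7.trans (map_zero _).symm) (h8.trans (map_zero _).symm)

theorem bdry_of_isRelOpen {U : Set (Amb n)} (hU : IsRelOpen U (bdry (Eu n) (Eu n))) :
    U ⊆ bdry (Eu n) (Eu n) := by
  obtain ⟨O, -, rfl⟩ := hU
  exact inter_subset_right

/-- The parametrisation of the graph near a boundary point. -/
theorem exists_parametrisation (H : HomData χ Y Z)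
    (htarget : IsRelOpen χ.target (bdry (Eu n) (Eu n))) {p : Amb n} (hp : p ∈ χ.source) :
    ∃ (N : ℕ) (φ φe φpsi φpsie : Eu2 n × Eu N → ℝ) (U V : Set (Amb n)) (Γ : Set (Cmp n N)),
      SGCl 1 1 φ ∧ IsPrincipalSymbol 1 1 φ φe φpsi φpsie ∧
      IsRelOpen U (bdry (Eu n) (Eu n)) ∧ p ∈ U ∧ U ⊆ χ.source ∧
      IsRelOpen V (bdry (Eu n) (Eu n)) ∧ χ p ∈ V ∧ V ⊆ χ.target ∧
      IsRelOpen Γ (bdry (Eu2 n) (Eu N)) ∧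
      Parametrises φe (coneE Γ) (graphOver (gmap Y Z 0 1) (coneE U) (coneE V)) ∧
      Parametrises φpsi (conePsi Γ) (graphOver (gmap Y Z 1 0) (conePsi U) (conePsi V)) ∧
      Parametrises φpsie (coneC Γ) (graphOver (gmap Y Z 0 0) (coneC U) (coneC V)) ∧
      (p.2.1 ≠ 0 ∨ (χ p).2.1 ≠ 0 → ∀ z ∈ coneE Γ, fderiv ℝ φe z ≠ 0) ∧
      (∀ z ∈ conePsi Γ, fderiv ℝ φpsi z ≠ 0) ∧ (∀ z ∈ coneC Γ, fderiv ℝ φpsie z ≠ 0) := by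
  obtain ⟨ι⟩ := exists_fibre_equiv n
  have hb := bdry_of_isRelOpen H.source_open hp
  obtain ⟨O, G, sh, hOo, hG, hs, hcone, hval⟩ := exists_localModel H hp
  have M : LocalModel χ Y Z O G sh := ⟨hOo, hG, hval⟩
  set P : Cmp n (n + n) := jmap ι Y p with hPdef
  have hPO : baseOf ι P ∈ O := by
    rw [baseOf_jmap]; exact hcone _ _ (jK_pos p) (jR_pos H hp hb)
  obtain ⟨τ, hτ⟩ := M.exists_injective ι H hp hb hPO
  have oO : IsOpen (baseOf (N := n + n) ι ⁻¹' O) := hOo.preimage (baseOf ι).continuous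
  -- The compactified phase exists only near P; the symbol class needs a function f smooth on the
  -- whole ambient space that agrees with it near P.
  obtain ⟨f, hf, hfe⟩ := exists_contDiff_eventuallyEq oO
    (contDiffOn_cmpPhase (N := n + n) ι hG hs τ) hPO
  have hPA : ‖cmpA ι P‖ < 1 := by rw [cmpA_jmap]; exact norm_jK_smul_lt_one H hp hb
  have hc : IsHeights (baseOf ι P).1.2 (baseOf ι P).2.2 := by
    rw [baseOf_jmap]; exact isHeights_of_mem_bdry hb (jK_pos p) (jR_pos H hp hb)
  have hne : p.2.1 ≠ 0 ∨ (χ p).2.1 ≠ 0 → cmpB ι P ≠ 0 ∨ (G (baseOf ι P)).2 ≠ 0 := by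
    rintro (h | h)
    · left
      rw [cmpB_jmap]
      exact smul_ne_zero (jR_pos H hp hb).ne' h
    · right
      obtain ⟨h1, h2, -⟩ := hval _ hPO hc
      rw [h2]
      have h3 : un2 (lft (baseOf ι P).1.2 (baseOf ι P).2.2
          ((baseOf ι P).1.1, (baseOf ι P).2.1)) = p := by
        have e := mem_hemi_of_mem_bdry hb
        change un2 (baseOf ι P) = p
        rw [baseOf_jmap]
        simp only [un2, un_smul (jK_pos p), un_smul (jR_pos H hp hb),
          un_eq_self (nn_of_mem_hemi e.1), un_eq_self (nn_of_mem_hemi e.2)]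
      have h4 : Z p ≠ 0 := by
        intro h0
        rw [H.proj p hp] at h
        exact h (by simp [un2, un, h0])
      rw [gmap, h3]
      exact smul_ne_zero h1.2.1.ne' h4
  -- Every requirement is an open condition that holds at P; injectivity is open because `cmpFibre`
  -- depends continuously on the point.
  have hevent : ∀ᶠ Q in 𝓝 P, baseOf ι Q ∈ O ∧ ‖cmpA ι Q‖ < 1 ∧
      Function.Injective (cmpFibre ι G τ Q) ∧ f Q = cmpPhase ι G sh τ Q ∧
      (p.2.1 ≠ 0 ∨ (χ p).2.1 ≠ 0 → cmpB ι Q ≠ 0 ∨ (G (baseOf ι Q)).2 ≠ 0) := by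
    have e1 : ∀ᶠ Q in 𝓝 P, baseOf ι Q ∈ O := oO.mem_nhds hPO
    have e2 : ∀ᶠ Q in 𝓝 P, ‖cmpA ι Q‖ < 1 :=
      (cmpA ι).continuous.norm.continuousAt.eventually_lt continuousAt_const hPA
    have e3 : ∀ᶠ Q in 𝓝 P, Function.Injective (cmpFibre ι G τ Q) :=
      ((continuousOn_cmpFibre ι hOo hG τ).continuousAt (oO.mem_nhds hPO)).eventually
        (ContinuousLinearMap.isOpen_injective.mem_nhds hτ)
    have e4 : ∀ᶠ Q in 𝓝 P, (p.2.1 ≠ 0 ∨ (χ p).2.1 ≠ 0 →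
        cmpB ι Q ≠ 0 ∨ (G (baseOf ι Q)).2 ≠ 0) := by
      by_cases h : p.2.1 ≠ 0 ∨ (χ p).2.1 ≠ 0
      · rcases hne h with h1 | h1
        · filter_upwards [(cmpB ι).continuous.continuousAt.eventually_ne h1] with Q hQ _
          exact Or.inl hQ
        · have h2 : ContinuousAt (fun Q => (G (baseOf ι Q)).2) P :=
            continuous_snd.continuousAt.comp (((hG.continuousOn.continuousAt
              (hOo.mem_nhds hPO))).comp (baseOf ι).continuous.continuousAt)
          filter_upwards [h2.eventually_ne h1] with Q hQ _
          exact Or.inr hQ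
      · exact Eventually.of_forall fun Q h' => absurd h' h
    filter_upwards [e1, e2, e3, hfe, e4] with Q a1 a2 a3 a4 a5
    exact ⟨a1, a2, a3, a4, a5⟩
  obtain ⟨Ω, hΩ, oΩ, hPΩ⟩ := eventually_nhds_iff.1 hevent
  have h01 : IsHeights 0 1 := ⟨le_rfl, zero_le_one, Or.inl rfl⟩
  have h10 : IsHeights 1 0 := ⟨zero_le_one, le_rfl, Or.inr rfl⟩
  have h00 : IsHeights 0 0 := ⟨le_rfl, le_rfl, Or.inl rfl⟩
  have k1 : ∀ Q ∈ Ω, baseOf ι Q ∈ O := fun Q hQ => (hΩ Q hQ).1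
  have k2 : ∀ Q ∈ Ω, ‖cmpA ι Q‖ < 1 := fun Q hQ => (hΩ Q hQ).2.1
  have k3 : ∀ Q ∈ Ω, Function.Injective (cmpFibre ι G τ Q) := fun Q hQ => (hΩ Q hQ).2.2.1
  have phE : ∀ z ∈ gcone 0 1 (Ω ∩ bdry (Eu2 n) (Eu (n + n))), ‖z.1‖ * jap z.2 * f (projE z)
      = nn (z.1, 0) * nn (z.2, 1) * cmpPhase ι G sh τ (un2 (lft 0 1 z)) := fun z hz => by
    rw [nn_zero_right, nn_one_right, ← (hΩ _ hz.2.2.1).2.2.2.1, un2_lft_E]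
  have phP : ∀ z ∈ gcone 1 0 (Ω ∩ bdry (Eu2 n) (Eu (n + n))), jap z.1 * ‖z.2‖ * f (projPsi z)
      = nn (z.1, 1) * nn (z.2, 0) * cmpPhase ι G sh τ (un2 (lft 1 0 z)) := fun z hz => by
    rw [nn_zero_right, nn_one_right, ← (hΩ _ hz.2.2.1).2.2.2.1, un2_lft_Psi]
  have phC : ∀ z ∈ gcone 0 0 (Ω ∩ bdry (Eu2 n) (Eu (n + n))), ‖z.1‖ * ‖z.2‖ * f (projC z)
      = nn (z.1, 0) * nn (z.2, 0) * cmpPhase ι G sh τ (un2 (lft 0 0 z)) := fun z hz => by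
    rw [nn_zero_right, nn_zero_right, ← (hΩ _ hz.2.2.1).2.2.2.1, un2_lft_C]
  refine ⟨n + n, compactSymbol 1 1 f, _, _, _, χ.source ∩ jmap ι Y ⁻¹' Ω, χ.target,
    Ω ∩ bdry (Eu2 n) (Eu (n + n)), sgCl_compactSymbol 1 1 hf,
    isPrincipalSymbol_compactSymbol hf.continuous, ?_, ⟨hp, hPΩ⟩, inter_subset_left, htarget,
    χ.map_source hp, subset_rfl, ⟨Ω, oΩ, rfl⟩, ?_, ?_, ?_, ?_, ?_, ?_⟩
  -- Continuity of `jmap` is available on the source only, so its preimage is first open relative to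
  -- the source, and the source is relatively open in the boundary.
  · obtain ⟨W, hW, hWe⟩ := continuousOn_iff'.1
      (continuousOn_jmap (N := n + n) ι H.smoothY.continuousOn) Ω oΩ
    obtain ⟨OS, hOS, hSe⟩ := H.source_open
    refine ⟨W ∩ OS, hW.inter hOS, ?_⟩
    rw [inter_comm, hWe, inter_assoc, ← hSe]
  · simp only [coneE_eq_gcone]
    exact M.parametrises ι H h01 rfl oΩ k1 k2 k3 phE
  · simp only [conePsi_eq_gcone]
    exact M.parametrises ι H h10 rfl oΩ k1 k2 k3 phP
  · simp only [coneC_eq_gcone]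
    exact M.parametrises ι H h00 rfl oΩ k1 k2 k3 phC
  · intro h
    simp only [coneE_eq_gcone]
    exact M.fderiv_ne_zero ι H h01 rfl oΩ k1 k2 k3 phE
      (Or.inr fun Q hQ => (hΩ Q hQ).2.2.2.2 h)
  · simp only [conePsi_eq_gcone]
    exact M.fderiv_ne_zero ι H h10 rfl oΩ k1 k2 k3 phP (Or.inl rfl)
  · simp only [coneC_eq_gcone]
    exact M.fderiv_ne_zero ι H h00 rfl oΩ k1 k2 k3 phC (Or.inl rfl)

end Point

/-! ### The extensions and their corner symbols -/

section Extensions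

variable {n : ℕ} {χ : PartialEquiv (Amb n) (Amb n)} {Y Z : Amb n → Eu n}

theorem HomData.isHomExtE (H : HomData χ Y Z) : IsHomExtE χ (gmap Y Z 0 1) := by
  have hc : IsHeights 0 1 := ⟨le_rfl, zero_le_one, Or.inl rfl⟩
  have h := fun z (hz : z ∈ coneE χ.source) =>
    gmap_mem_gcone_target H (coneE_eq_gcone χ.source ▸ hz)
  refine ⟨?_, fun z hz => ?_, fun z hz => ?_, fun z hz t ht => ?_⟩
  · rw [coneE_eq_gcone]; exact contDiffOn_gmap H.source_open H.smoothY H.smoothZ hc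
  · have h1 := (h z hz).1
    rw [← coneE_eq_gcone] at h1
    exact h1.1
  · have h1 := (h z hz).2
    rwa [un2_lft_E, un2_lft_E] at h1
  · have h1 := gmap_smul_fst Y Z (c₁ := 0) (c₂ := 1) z ht
    rwa [mul_zero] at h1

theorem HomData.isHomExtPsi (H : HomData χ Y Z) : IsHomExtPsi χ (gmap Y Z 1 0) := by
  have hc : IsHeights 1 0 := ⟨zero_le_one, le_rfl, Or.inr rfl⟩
  have h := fun z (hz : z ∈ conePsi χ.source) =>
    gmap_mem_gcone_target H (conePsi_eq_gcone χ.source ▸ hz)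
  refine ⟨?_, fun z hz => ?_, fun z hz => ?_, fun z hz t ht => ?_⟩
  · rw [conePsi_eq_gcone]; exact contDiffOn_gmap H.source_open H.smoothY H.smoothZ hc
  · have h1 := (h z hz).1
    rw [← conePsi_eq_gcone] at h1
    exact h1.1
  · have h1 := (h z hz).2
    rwa [un2_lft_Psi, un2_lft_Psi] at h1
  · have h1 := gmap_smul_snd Y Z (c₁ := 1) (c₂ := 0) z ht
    rwa [mul_zero] at h1

theorem HomData.isHomExtC (H : HomData χ Y Z) : IsHomExtC χ (gmap Y Z 0 0) := by
  have hc : IsHeights 0 0 := ⟨le_rfl, le_rfl, Or.inl rfl⟩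
  have h := fun z (hz : z ∈ coneC χ.source) =>
    gmap_mem_gcone_target H (coneC_eq_gcone χ.source ▸ hz)
  refine ⟨?_, fun z hz => ?_, fun z hz => ?_, fun z hz s t hs ht => ?_⟩
  · rw [coneC_eq_gcone]; exact contDiffOn_gmap H.source_open H.smoothY H.smoothZ hc
  · have h1 := (h z hz).1
    rw [← coneC_eq_gcone] at h1
    exact ⟨h1.1, h1.2.1⟩
  · have h1 := (h z hz).2
    rwa [un2_lft_C, un2_lft_C] at h1
  · have h1 := gmap_smul_smul Y Z (c₁ := 0) (c₂ := 0) z hs ht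
    rwa [mul_zero, mul_zero] at h1

theorem tendsto_of_smoothOn {S : Set (Amb n)} (hS : IsRelOpen S (bdry (Eu n) (Eu n)))
    {V : Amb n → Eu n} (hV : SmoothOn V S) {q : ℝ → Amb n} {p : Amb n} (hp : p ∈ S)
    (hq : Tendsto q atTop (𝓝 p)) (hb : ∀ᶠ t in atTop, q t ∈ bdry (Eu n) (Eu n)) :
    Tendsto (fun t => V (q t)) atTop (𝓝 (V p)) := by
  have h1 : ∀ᶠ t in atTop, q t ∈ S := by
    obtain ⟨O, hO, rfl⟩ := hS
    filter_upwards [hq.eventually (hO.mem_nhds hp.1), hb] with t h2 h3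
    exact ⟨h2, h3⟩
  exact (hV.continuousOn p hp).tendsto.comp (tendsto_nhdsWithin_iff.2 ⟨hq, h1⟩)

/-- The corner is approached from within each face. There Y and Z are continuous, and t⁻¹⟨tξ⟩ → |ξ|,
t⁻¹⟨tx⟩ → |x| account for the norm factors. -/
theorem HomData.isCornerSymbol (H : HomData χ Y Z) :
    IsCornerSymbolOfMaps (coneC χ.source) (gmap Y Z 0 1) (gmap Y Z 1 0) (gmap Y Z 0 0) := by
  rintro z ⟨hx, hξ, hz⟩
  have hE : Tendsto (fun t : ℝ => (projE (z.1, t • z.2) : Amb n)) atTop (𝓝 (projC z)) :=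
    tendsto_const_nhds.prodMk_nhds (tendsto_radComp_smul hξ)
  have hP : Tendsto (fun t : ℝ => (projPsi (t • z.1, z.2) : Amb n)) atTop (𝓝 (projC z)) :=
    (tendsto_radComp_smul hx).prodMk_nhds tendsto_const_nhds
  have bE : ∀ᶠ t : ℝ in atTop, (projE (z.1, t • z.2) : Amb n) ∈ bdry (Eu n) (Eu n) :=
    Eventually.of_forall fun t => by
      rw [← un2_lft_E]
      exact IsHeights.mem_bdry ⟨le_rfl, zero_le_one, Or.inl rfl⟩
        (by rw [nn_zero_right]; exact norm_pos_iff.2 hx) (by rw [nn_one_right]; exact jap_pos _)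
  have bP : ∀ᶠ t : ℝ in atTop, (projPsi (t • z.1, z.2) : Amb n) ∈ bdry (Eu n) (Eu n) :=
    Eventually.of_forall fun t => by
      rw [← un2_lft_Psi]
      exact IsHeights.mem_bdry ⟨zero_le_one, le_rfl, Or.inr rfl⟩
        (by rw [nn_one_right]; exact jap_pos _) (by rw [nn_zero_right]; exact norm_pos_iff.2 hξ)
  simp only [gmap, un2_lft_E, un2_lft_Psi, un2_lft_C, nn_zero_right, nn_one_right, smul_smul]
  exact ⟨(tendsto_of_smoothOn H.source_open H.smoothY hz hE bE).const_smul _,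
    (tendsto_inv_mul_jap_smul z.2).smul (tendsto_of_smoothOn H.source_open H.smoothZ hz hE bE),
    (tendsto_inv_mul_jap_smul z.1).smul (tendsto_of_smoothOn H.source_open H.smoothY hz hP bP),
    (tendsto_of_smoothOn H.source_open H.smoothZ hz hP bP).const_smul _⟩

end Extensions

end

end SGGeom

/-! ### The theorem, assembled from the coefficient functions Y and Z -/

theorem mainTheorem5 (n : ℕ) (χ : PartialEquiv (SGGeom.Amb n) (SGGeom.Amb n))
    (hχ : SGGeom.IsSCT χ) :
    ∃ Ce Cpsi Cpsie : SGGeom.Eu n × SGGeom.Eu n → SGGeom.Eu n × SGGeom.Eu n,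
      -- the homogeneous symplectic extensions of `χ`
      (SGGeom.IsHomExtE χ Ce ∧ SGGeom.IsSymplecticOn Ce (SGGeom.coneE χ.source)) ∧
      (SGGeom.IsHomExtPsi χ Cpsi ∧ SGGeom.IsSymplecticOn Cpsi (SGGeom.conePsi χ.source)) ∧
      (SGGeom.IsHomExtC χ Cpsie ∧ SGGeom.IsSymplecticOn Cpsie (SGGeom.coneC χ.source)) ∧
      SGGeom.IsCornerSymbolOfMaps (SGGeom.coneC χ.source) Ce Cpsi Cpsie ∧
      -- near every point of the graph they are parametrised by an `SG`-phase function
      ∀ p ∈ χ.source, ∃ (N : ℕ) (φ φe φpsi φpsie : SGGeom.Eu2 n × SGGeom.Eu N → ℝ)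
        (U V : Set (SGGeom.Amb n))
        (Γ : Set ((SGGeom.Eu2 n × ℝ) × (SGGeom.Eu N × ℝ))),
        SGGeom.SGCl 1 1 φ ∧
        SGGeom.IsPrincipalSymbol 1 1 φ φe φpsi φpsie ∧
        SGGeom.IsRelOpen U (SGGeom.bdry (SGGeom.Eu n) (SGGeom.Eu n)) ∧ p ∈ U ∧ U ⊆ χ.source ∧
        SGGeom.IsRelOpen V (SGGeom.bdry (SGGeom.Eu n) (SGGeom.Eu n)) ∧ χ p ∈ V ∧
          V ⊆ χ.target ∧
        SGGeom.IsRelOpen Γ (SGGeom.bdry (SGGeom.Eu2 n) (SGGeom.Eu N)) ∧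
        SGGeom.Parametrises φe (SGGeom.coneE Γ)
          (SGGeom.graphOver Ce (SGGeom.coneE U) (SGGeom.coneE V)) ∧
        SGGeom.Parametrises φpsi (SGGeom.conePsi Γ)
          (SGGeom.graphOver Cpsi (SGGeom.conePsi U) (SGGeom.conePsi V)) ∧
        SGGeom.Parametrises φpsie (SGGeom.coneC Γ)
          (SGGeom.graphOver Cpsie (SGGeom.coneC U) (SGGeom.coneC V)) ∧
        -- the phases have no critical points, except for an exit phase at the zero section
        (p.2.1 ≠ 0 ∨ (χ p).2.1 ≠ 0 → ∀ z ∈ SGGeom.coneE Γ, fderiv ℝ φe z ≠ 0) ∧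
        (∀ z ∈ SGGeom.conePsi Γ, fderiv ℝ φpsi z ≠ 0) ∧
        (∀ z ∈ SGGeom.coneC Γ, fderiv ℝ φpsie z ≠ 0) := by
  obtain ⟨Y, Z, H⟩ := SGGeom.exists_homData hχ
  refine ⟨SGGeom.gmap Y Z 0 1, SGGeom.gmap Y Z 1 0, SGGeom.gmap Y Z 0 0,
    ⟨H.isHomExtE, ?_⟩, ⟨H.isHomExtPsi, ?_⟩, ⟨H.isHomExtC, ?_⟩, H.isCornerSymbol, fun p hp =>
      SGGeom.exists_parametrisation H hχ.diffeo.target_open hp⟩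
  · rw [SGGeom.coneE_eq_gcone]; exact H.sympE
  · rw [SGGeom.conePsi_eq_gcone]; exact H.sympPsi
  · rw [SGGeom.coneC_eq_gcone]; exact H.sympC
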